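/- Let $D=(0,1)$, $H=L^2(D;\mathbb R)$ with inner product $\langle\cdot,\cdot\rangle$ and norm $\|\cdot\|$, and let $V=C(D,\mathbb R)$ with the supremum norm $\|\cdot\|_V$. Let $A=-\frac{d^2}{dx^2}$ with homogeneous Dirichlet boundary conditions on $D$; it has eigenvalues $\lambda_i=\pi^2i^2$ and the orthonormal basis of eigenfunctions $e_i(x)=\sqrt2\sin(i\pi x)$, $i\ge1$. For $\beta\in\mathbb R$ write $\|u\|_\beta=\|A^{\beta/2}u\|=\big(\sum_{i\ge1}\lambda_i^{\beta}\langle u,e_i\rangle^2\big)^{1/2}$. For $N\ge 1$ let $P_N u=\sum_{i=1}^N\langle u,e_i\rangle e_i$, $H^N=P_NH$, $A_N=AP_N$ and $E_N(t)=e^{-tA_N}$ on $H^N$. Let $T>0$, let $f(v)=a_3v^3+a_2v^2+a_1v+a_0$ with $a_3<0$ and $a_2,a_1,a_0\in\mathbb R$, and let $F(v)(x)=f(v(x))$ for $v\in L^6(D;\mathbb R)$, $F_N=P_NF$. Let $W(t)=\sum_{n\ge1}\beta_n(t)e_n$, $t\in[0,T]$, be a cylindrical $I$-Wiener process on a probability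 space $(\Omega,\mathcal F,\mathbb P)$ with a normal filtration $(\mathcal F_t)_{t\in[0,T]}$, where the $\beta_n$ are independent real standard Brownian motions. Let $X_0:\Omega\to H$ be $\mathcal F_0/\mathcal B(H)$-measurable. For $M,N\ge1$, $\tau=T/M$ and $t_m=m\tau$, define $Y^{M,N}_{t_0}=P_NX_0$ and, for $0\le m\le M-1$, $$Y^{M,N}_{t_{m+1}}=E_N(\tau)Y^{M,N}_{t_m}+\frac{A_N^{-1}\big(I-E_N(\tau)\big)F_N(Y^{M,N}_{t_m})}{1+\tau\|F_N(Y^{M,N}_{t_m})\|}+\int_{t_m}^{t_{m+1}}E_N(t_{m+1}-s)P_N\,dW(s).$$ Theorem. For every $p\in[2,\infty)$ the following holds for all sufficiently large $p_0\in\mathbb N$ (how large depends on $p$ only). If $$\mathbb E\big[\|X_0\|_\beta^{p_0}\big]<\infty\ \text{ for every }\beta<\tfrac12,\qquad \mathbb E\big[\|X_0\|_V^{p_0}\big]<\infty,\qquad \sup_{N\ge1}\|P_NX_0\|_{L^{p_0}(\Omega,V)}<\infty,$$ then each $\|Y^{M,N}_{t_m}\|_V$ is a ($\mathbb P$-a.e.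 measurable) random variable and $$\sup_{M,N\ge1}\ \sup_{m\in\{0,1,\dots,M\}}\mathbb E\big[\|Y^{M,N}_{t_m}\|_V^{p}\big]<\infty.$$ -/

import Mathlib

open MeasureTheory ProbabilityTheory Filter Topology
open scoped ENNReal NNReal

noncomputable section

namespace TamedAllenCahn

/-! ### The space `H = L²(0,1)`, the Dirichlet Laplacian and its Galerkin truncations -/

/-- The spatial domain `D = (0, 1)`. -/
def dom : Set ℝ := Set.Ioo 0 1

/-- Lebesgue measure on `D`. -/
def leb : Measure ℝ := volume.restrict dom

instance : IsFiniteMeasure leb :=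
  ⟨by rw [leb, Measure.restrict_apply_univ, dom, Real.volume_Ioo]; exact ENNReal.ofReal_lt_top⟩

/-- The Hilbert space `H = L²(D; ℝ)`. -/
abbrev H : Type := Lp ℝ 2 leb

/-- The eigenvalues `π² i²`, `i = 1, 2, …`, of `A`, the negative Dirichlet Laplacian on `D`.
All sequences are indexed from `0`, so index `n` here stands for `i = n + 1`. -/
def eigval (n : ℕ) : ℝ := Real.pi ^ 2 * ((n : ℝ) + 1) ^ 2

/-- The eigenfunctions `x ↦ √2 sin(i π x)`, with `i = n + 1`. -/
def eigfun (n : ℕ) (x : ℝ) : ℝ := √2 * Real.sin (((n : ℝ) + 1) * Real.pi * x)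

/-- `eigfun n` is an eigenfunction of `A = -d²/dx²` with eigenvalue `eigval n`. -/
lemma neg_deriv_deriv_eigfun (n : ℕ) (x : ℝ) :
    -(deriv (deriv (eigfun n)) x) = eigval n * eigfun n x := by
  have h1 : ∀ y, HasDerivAt (fun z : ℝ => ((n : ℝ) + 1) * Real.pi * z)
      (((n : ℝ) + 1) * Real.pi) y := fun y => by
    simpa using (hasDerivAt_id y).const_mul (((n : ℝ) + 1) * Real.pi)
  have h2 : deriv (eigfun n) = fun y =>
      √2 * (Real.cos (((n : ℝ) + 1) * Real.pi * y) * (((n : ℝ) + 1) * Real.pi)) :=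
    funext fun y => (((h1 y).sin).const_mul √2).deriv
  rw [h2, ((((h1 x).cos).mul_const _).const_mul √2).deriv, eigval, eigfun]
  ring

/-- `eigfun n` satisfies the homogeneous Dirichlet boundary conditions. -/
lemma eigfun_boundary (n : ℕ) : eigfun n 0 = 0 ∧ eigfun n 1 = 0 := by
  refine ⟨by simp [eigfun], ?_⟩
  have := Real.sin_nat_mul_pi (n + 1)
  push_cast at this
  simp [eigfun, this]

lemma eigfun_memLp (n : ℕ) : MemLp (eigfun n) 2 leb := by
  refine MemLp.of_bound (C := √2) ?_ (ae_of_all _ fun x => ?_)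
  · exact (by unfold eigfun; fun_prop : Continuous (eigfun n)).aestronglyMeasurable
  · rw [eigfun, norm_mul, Real.norm_of_nonneg (Real.sqrt_nonneg 2)]
    exact mul_le_of_le_one_right (Real.sqrt_nonneg 2) (Real.abs_sin_le_one _)

/-- The orthonormal basis of eigenfunctions, as elements of `H`. -/
def basis (n : ℕ) : H := (eigfun_memLp n).toLp (eigfun n)

/-- The operator `u ↦ ∑_{n < N} g(λ_n) ⟨e_n, u⟩ e_n`. On `H^N = span {e_n : n < N}` this is
`g(A_N)`, where `A_N = A P_N`. -/
def galerkinOp (N : ℕ) (g : ℝ → ℝ) : H →L[ℝ] H :=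
  ∑ n ∈ Finset.range N, g (eigval n) • (innerSL ℝ (basis n)).smulRight (basis n)

/-- The projection `P_N` of `H` onto `H^N`. -/
def proj (N : ℕ) : H →L[ℝ] H := galerkinOp N fun _ => 1

/-- The semigroup `E_N(t) = exp(-t A_N)` on `H^N`. -/
def semigroup (N : ℕ) (t : ℝ) : H →L[ℝ] H := galerkinOp N fun l => Real.exp (-(t * l))

/-- The inverse `A_N⁻¹` of `A_N` on `H^N`. -/
def invA (N : ℕ) : H →L[ℝ] H := galerkinOp N fun l => l⁻¹

/-- The norm `‖u‖_b = ‖A^{b/2} u‖` of the space `Ḣ^b = dom (A^{b/2})`, equal to `∞` when `u` does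
not belong to that space. -/
def fracNorm (b : ℝ) (u : H) : ℝ≥0∞ :=
  (∑' n, ENNReal.ofReal (eigval n ^ b * inner ℝ (basis n) u ^ 2)) ^ (1 / 2 : ℝ)

/-- The norm of `V = C(D, ℝ)`: the supremum over `D` of the continuous representative of `u`
(which is unique on `D`), and `∞` when `u` has no continuous representative. -/
def supNorm (u : H) : ℝ≥0∞ :=
  ⨅ (g : ℝ → ℝ) (_ : ContinuousOn g dom) (_ : u =ᵐ[leb] g), (⨆ x ∈ dom, ‖g x‖ₑ)

/-! ### The nonlinearity -/

/-- The cubic polynomial `f`. -/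
def cubic (a₃ a₂ a₁ a₀ v : ℝ) : ℝ := a₃ * v ^ 3 + a₂ * v ^ 2 + a₁ * v + a₀

/-- If `u ∈ L⁶(D)` and `f` is a cubic polynomial, then `f ∘ u ∈ L²(D)`. -/
lemma cubic_memLp (a₃ a₂ a₁ a₀ : ℝ) {u : ℝ → ℝ} (hu : MemLp u 6 leb) :
    MemLp (fun x => cubic a₃ a₂ a₁ a₀ (u x)) 2 leb := by
  have h3 : MemLp (fun x => ‖u x‖ ^ (3 : ℝ≥0∞).toReal) 2 leb := by
    have h := hu.norm_rpow_div 3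
    have e1 : (6 : ℝ≥0∞) / 3 = 2 := by
      rw [ENNReal.div_eq_inv_mul, show (6 : ℝ≥0∞) = 3 * 2 by norm_num, ← mul_assoc,
        ENNReal.inv_mul_cancel (by norm_num) (by norm_num), one_mul]
    rwa [e1] at h
  have e2 : (3 : ℝ≥0∞).toReal = ((3 : ℕ) : ℝ) := by norm_num
  simp only [e2, Real.rpow_natCast] at h3
  have hc : ∀ c : ℝ, MemLp (fun _ : ℝ => c) 2 leb := fun c => memLp_const c
  have h4 : MemLp (fun x => 1 + ‖u x‖ ^ 3) 2 leb := MemLp.add (hc 1) h3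
  have key : ∀ k : ℕ, k ≤ 3 → MemLp (fun x => u x ^ k) 2 leb := fun k hk => by
    refine MemLp.mono h4 (hu.1.pow k) (ae_of_all _ fun x => ?_)
    have h0 : 0 ≤ ‖u x‖ ^ 3 := by positivity
    rw [norm_pow, Real.norm_of_nonneg (by linarith : 0 ≤ 1 + ‖u x‖ ^ 3)]
    rcases le_total ‖u x‖ 1 with h | h
    · have := pow_le_one₀ (n := k) (norm_nonneg (u x)) h
      linarith
    · have := pow_le_pow_right₀ h hk
      linarith
  have h5 : MemLp (fun x => a₃ * u x ^ 3 + a₂ * u x ^ 2 + a₁ * u x ^ 1 + a₀) 2 leb :=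
    MemLp.add (MemLp.add (MemLp.add ((key 3 le_rfl).const_mul a₃)
      ((key 2 (by norm_num)).const_mul a₂)) ((key 1 (by norm_num)).const_mul a₁)) (hc a₀)
  simpa only [cubic, pow_one] using h5

open Classical in
/-- The Nemytskii operator `F(u)(x) = f(u(x))`; it is used on `L⁶(D)` only, where `cubic_memLp`
applies, and is set to `0` at those `u ∈ H` for which `f ∘ u ∉ H`. -/
def nemytskii (f : ℝ → ℝ) (u : H) : H :=
  if h : MemLp (fun x => f (u x)) 2 leb then h.toLp _ else 0

/-! ### Noise -/

variable {Ω : Type*} {mΩ : MeasurableSpace Ω}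

/-- `ℱ` is a normal filtration on `[0, T]`: it is right-continuous and `ℱ 0` contains all null
events. -/
structure IsNormalFiltration (P : Measure Ω) (T : ℝ) (ℱ : Filtration ℝ mΩ) : Prop where
  null_mem : ∀ s : Set Ω, MeasurableSet s → P s = 0 → MeasurableSet[ℱ 0] s
  right_cont : ∀ t, 0 ≤ t → t < T → (⨅ s > t, ℱ s) = ℱ t

/-- `W(t) = ∑ₙ Bₙ(t) eₙ`, `t ∈ [0, T]`, is a cylindrical `I`-Wiener process with respect to the
filtration `ℱ`: the `Bₙ` are independent real standard Brownian motions on `[0, T]`, adapted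
to `ℱ`, and the increments of `W` after time `s` are independent of `ℱ s`. -/
structure IsCylindricalWiener (P : Measure Ω) (T : ℝ) (ℱ : Filtration ℝ mΩ)
    (B : ℕ → ℝ → Ω → ℝ) : Prop where
  start_zero : ∀ n, ∀ᵐ ω ∂P, B n 0 ω = 0
  continuous_paths : ∀ n, ∀ᵐ ω ∂P, ContinuousOn (fun t => B n t ω) (Set.Icc 0 T)
  adapted : ∀ n t, 0 ≤ t → t ≤ T → Measurable[ℱ t] (B n t)
  gaussian_increments : ∀ n s t, 0 ≤ s → s ≤ t → t ≤ T →
    HasLaw (fun ω => B n t ω - B n s ω) (gaussianReal 0 (t - s).toNNReal) P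
  indep_past : ∀ s t, 0 ≤ s → s ≤ t → t ≤ T →
    Indep (MeasurableSpace.comap (fun ω n => B n t ω - B n s ω) MeasurableSpace.pi) (ℱ s) P
  indep_family : iIndepFun (fun n ω (t : Set.Icc (0 : ℝ) T) => B n t ω) P

/-- The random variable `I` is (a version of) the stochastic integral `∫_a^b g(s) dB(s)` of the
deterministic continuous integrand `g`: the limit in `L²(P)` of the integrals of the step functions
that interpolate `g` at the left end points of equidistant partitions of `[a, b]`. -/
def IsStochIntegral (P : Measure Ω) (B : ℝ → Ω → ℝ) (a b : ℝ) (g : ℝ → ℝ) (I : Ω → ℝ) : Prop :=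
  MemLp I 2 P ∧
  Tendsto (fun K : ℕ => eLpNorm (fun ω =>
      (∑ k ∈ Finset.range (K + 1), g (a + k * ((b - a) / (K + 1 : ℕ))) *
        (B (a + (k + 1 : ℕ) * ((b - a) / (K + 1 : ℕ))) ω
          - B (a + k * ((b - a) / (K + 1 : ℕ))) ω)) - I ω) 2 P) atTop (𝓝 0)

open Classical in
/-- The stochastic integral `∫_a^b g(s) dB(s)`. The limit defining it exists for every Brownian
motion on `[0, T] ⊇ [a, b]` and every continuous `g`, and it is unique up to null sets. -/
def stochIntegral (P : Measure Ω) (B : ℝ → Ω → ℝ) (a b : ℝ) (g : ℝ → ℝ) : Ω → ℝ :=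
  if h : ∃ I, IsStochIntegral P B a b g I then h.choose else 0

/-- `∫_a^b E_N(b - s) P_N dW(s) = ∑_{n < N} (∫_a^b exp(-λ_n (b - s)) dB_n(s)) e_n`. -/
def stochConv (P : Measure Ω) (B : ℕ → ℝ → Ω → ℝ) (N : ℕ) (a b : ℝ) (ω : Ω) : H :=
  ∑ n ∈ Finset.range N,
    stochIntegral P (B n) a b (fun s => Real.exp (-((b - s) * eigval n))) ω • basis n

/-! ### Initial data and the scheme -/

/-- The assumptions on the initial value `X₀`, with integrability exponent `p₀`. -/
structure IsInitialValue (P : Measure Ω) (ℱ : Filtration ℝ mΩ) (p₀ : ℕ) (X₀ : Ω → H) :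
    Prop where
  measurable_init : @Measurable Ω H (ℱ 0) (borel H) X₀
  frac_moment : ∀ b : ℝ, b < 1 / 2 → (∫⁻ ω, fracNorm b (X₀ ω) ^ p₀ ∂P) < ∞
  sup_moment : (∫⁻ ω, supNorm (X₀ ω) ^ p₀ ∂P) < ∞
  proj_moment : (⨆ (N : ℕ) (_ : 1 ≤ N),
    (∫⁻ ω, supNorm (proj N (X₀ ω)) ^ p₀ ∂P) ^ (1 / p₀ : ℝ)) < ∞

/-- The tamed accelerated exponential Euler approximations `Y^{M,N}_{t_m}`, where `t_m = m τ` and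
`τ = T / M`:
`Y_0 = P_N X₀` and
`Y_{m+1} = E_N(τ) Y_m + A_N⁻¹ (I - E_N(τ)) F_N(Y_m) / (1 + τ ‖F_N(Y_m)‖)
  + ∫_{t_m}^{t_{m+1}} E_N(t_{m+1} - s) P_N dW(s)`, with `F_N = P_N F`. -/
def scheme (P : Measure Ω) (T : ℝ) (f : ℝ → ℝ) (B : ℕ → ℝ → Ω → ℝ) (X₀ : Ω → H) (M N : ℕ) :
    ℕ → Ω → H
  | 0, ω => proj N (X₀ ω)
  | m + 1, ω =>
    let τ : ℝ := T / M
    let Y : H := scheme P T f B X₀ M N m ω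
    let FY : H := proj N (nemytskii f Y)
    semigroup N τ Y + (1 + τ * ‖FY‖)⁻¹ • invA N (FY - semigroup N τ FY)
      + stochConv P B N (m * τ) ((m + 1 : ℕ) * τ) ω

end TamedAllenCahn

end

open TamedAllenCahn

open MeasureTheory ProbabilityTheory Filter Topology
open scoped ENNReal NNReal

noncomputable section

namespace TamedAllenCahn

/-! ### Finite sine sums: coordinates, orthonormality and the supremum norm. -/

section

/-! In coordinates (`scheme_eq_sineElt`, `supNorm_sineElt`) the scheme is a recursion for the
coefficients of a sine polynomial. It splits as `Y = v + Z`: `Z` (`linCoeff`) carries the initial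
value and the noise without the nonlinearity, and `v` (`IsDriftPart`) starts at zero and is driven
by the tamed nonlinearity evaluated at `v + Z`. The proof bounds `v` pathwise by `Z` and then bounds
the moments of `Z`.

Pathwise bound. Put `Q = 1 + τ ∑ ‖Z_j‖^9`, with supremum norms. As long as `‖Y_j‖^6 ≤ M`, the taming
factor is bounded below and the quadratic error of the explicit step is summable. The dissipativity
of the cubic (`cubic_dissipative`) then gives an energy estimate (`IsDriftPart.energy_le`): both
`‖v_m‖²` in L² and `τ ∑ ∫ v_j⁴` are at most a constant times `Q`. To pass to the supremum norm,
Duhamel's formula is combined with the smoothing factor `t^{-1/2}` from L¹ to the supremum norm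
(`IsDriftPart.abs_sineSum_le`). The dangerous term `t^{-1/2} ∫ |v|³` is split by `weighted_cube_le`
into `∫ v⁴` and `σ t^{-3/4} ∫ v²`, where `σ²` bounds `‖v‖` at earlier times. The first is controlled
by the energy, the second has an integrable singularity and only the square root of the earlier
bound in front. Hence the induction closes with `‖v_m‖ ≤ K Q²` (`exists_drift_bound_of_moderate`).

If the level `M^{1/6}` is exceeded, taming still gives `‖v_m‖ ≤ K M`
(`IsDriftPart.sineNorm_le_apriori`). At the first index `j` of exceedance the good bound still
holds, so `M < (K Q² + ‖Z_j‖)^6`. A high power of this inequality, divided by `M`, bounds `M^p` by a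
time average of powers of `‖Z‖` (`exists_pow_le_of_controlled`). Thus no maximum over time is
needed, only moments of `Z` uniform in time.

Moments of `Z`. For the initial value, the decreasing multipliers `exp(-λ_n t)` and Abel summation
give a combination of the projections `P_k X₀` with total weight at most one
(`eLpNorm_sineNorm_mul_le`). For the noise, every linear functional is Gaussian with variance at
most `∑ b_n²/λ_n`. A one-dimensional Sobolev inequality on dyadic frequency blocks gives a
convergent geometric series (`eLpNorm_sineNorm_le_of_gaussian_bound`). The Gaussian computation is
made for step-function integrands and passed to the limit
(`IsCylindricalWiener.eLpNorm_sineNorm_noise_le`). -/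

lemma eigval_pos (n : ℕ) : 0 < eigval n := by unfold eigval; positivity

@[fun_prop]
lemma continuous_eigfun (n : ℕ) : Continuous (eigfun n) := by unfold eigfun; fun_prop

lemma abs_eigfun_le (n : ℕ) (x : ℝ) : |eigfun n x| ≤ √2 := by
  rw [eigfun, abs_mul, abs_of_nonneg (Real.sqrt_nonneg 2)]
  exact mul_le_of_le_one_right (Real.sqrt_nonneg 2) (Real.abs_sin_le_one _)

instance isProbabilityMeasure_leb : IsProbabilityMeasure leb :=
  ⟨by rw [leb, Measure.restrict_apply_univ, dom, Real.volume_Ioo]; simp⟩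

lemma integral_leb (g : ℝ → ℝ) : ∫ x, g x ∂leb = ∫ x in (0 : ℝ)..1, g x := by
  rw [intervalIntegral.integral_of_le zero_le_one, leb, dom, integral_Ioc_eq_integral_Ioo]

lemma ae_leb_mem : ∀ᵐ x ∂leb, x ∈ Set.Ioo (0 : ℝ) 1 :=
  ae_restrict_mem measurableSet_Ioo

lemma integrable_leb_of_continuous {g : ℝ → ℝ} (hg : Continuous g) : Integrable g leb :=
  (hg.continuousOn.integrableOn_compact (μ := volume) isCompact_Icc).mono_set
    Set.Ioo_subset_Icc_self

lemma integral_cos_int_mul_pi (k : ℤ) (hk : k ≠ 0) :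
    ∫ x in (0 : ℝ)..1, Real.cos (((k : ℝ) * Real.pi) * x) = 0 := by
  have hk' : (k : ℝ) * Real.pi ≠ 0 := mul_ne_zero (by exact_mod_cast hk) Real.pi_ne_zero
  rw [intervalIntegral.integral_comp_mul_left (fun y => Real.cos y) hk', integral_cos]
  simp [Real.sin_int_mul_pi]

lemma integral_eigfun_mul_eigfun (i j : ℕ) :
    ∫ x, eigfun i x * eigfun j x ∂leb = if i = j then 1 else 0 := by
  have h : ∀ x, eigfun i x * eigfun j x =
      Real.cos ((((i - j : ℤ) : ℝ) * Real.pi) * x)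
        - Real.cos ((((i + j + 2 : ℤ) : ℝ) * Real.pi) * x) := fun x => by
    have e1 : (((i - j : ℤ) : ℝ) * Real.pi) * x =
        ((i : ℝ) + 1) * Real.pi * x - ((j : ℝ) + 1) * Real.pi * x := by push_cast; ring
    have e2 : (((i + j + 2 : ℤ) : ℝ) * Real.pi) * x =
        ((i : ℝ) + 1) * Real.pi * x + ((j : ℝ) + 1) * Real.pi * x := by push_cast; ring
    rw [e1, e2, Real.cos_sub, Real.cos_add, eigfun, eigfun]
    linear_combination (Real.sin (((i : ℝ) + 1) * Real.pi * x) *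
      Real.sin (((j : ℝ) + 1) * Real.pi * x)) * Real.mul_self_sqrt (zero_le_two (α := ℝ))
  rw [integral_leb]
  simp only [h]
  rw [intervalIntegral.integral_sub
    (Continuous.intervalIntegrable (by fun_prop) _ _)
    (Continuous.intervalIntegrable (by fun_prop) _ _),
    -- The frequencies are `i + 1` and `j + 1`, so their sum `i + j + 2` never vanishes; only the
    -- difference can.
    integral_cos_int_mul_pi (i + j + 2 : ℤ) (by omega)]
  split_ifs with hij
  · subst hij; simp
  · rw [integral_cos_int_mul_pi _ (by omega)]; simp

/-- The function `∑_{n < N} y_n e_n`. -/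
def sineSum (N : ℕ) (y : ℕ → ℝ) (x : ℝ) : ℝ := ∑ n ∈ Finset.range N, y n * eigfun n x

@[fun_prop]
lemma continuous_sineSum (N : ℕ) (y : ℕ → ℝ) : Continuous (sineSum N y) := by
  unfold sineSum
  exact continuous_finsetSum _ fun n _ => continuous_const.mul (continuous_eigfun n)

lemma sineSum_add (N : ℕ) (y z : ℕ → ℝ) (x : ℝ) :
    sineSum N (y + z) x = sineSum N y x + sineSum N z x := by
  simp [sineSum, add_mul, Finset.sum_add_distrib]

/-- The element `∑_{n < N} y_n e_n` of `H`. -/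
def sineElt (N : ℕ) (y : ℕ → ℝ) : H := ∑ n ∈ Finset.range N, y n • basis n

lemma basis_ae (n : ℕ) : basis n =ᵐ[leb] eigfun n := (eigfun_memLp n).coeFn_toLp

lemma sineElt_ae (N : ℕ) (y : ℕ → ℝ) : sineElt N y =ᵐ[leb] sineSum N y := by
  induction N with
  | zero =>
    filter_upwards [Lp.coeFn_zero ℝ 2 leb] with x hx
    simp [sineElt, sineSum]
  | succ N ih =>
    have e : sineElt (N + 1) y = sineElt N y + y N • basis N := by
      simp [sineElt, Finset.sum_range_succ]
    rw [e]
    filter_upwards [Lp.coeFn_add (sineElt N y) (y N • basis N), ih,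
      Lp.coeFn_smul (y N) (basis N), basis_ae N] with x h1 h2 h3 h4
    rw [h1, Pi.add_apply, h2, h3, Pi.smul_apply, h4]
    simp [sineSum, Finset.sum_range_succ]

lemma inner_basis_eq (n : ℕ) (u : H) : inner ℝ (basis n) u = ∫ x, eigfun n x * u x ∂leb := by
  rw [L2.inner_def]
  refine integral_congr_ae ?_
  filter_upwards [basis_ae n] with x hx
  rw [hx]; simp [mul_comm]

lemma inner_basis_basis (i j : ℕ) : inner ℝ (basis i) (basis j) = if i = j then (1 : ℝ) else 0 := by
  rw [inner_basis_eq, ← integral_eigfun_mul_eigfun]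
  refine integral_congr_ae ?_
  filter_upwards [basis_ae j] with x hx
  rw [hx]

lemma galerkinOp_apply (N : ℕ) (g : ℝ → ℝ) (u : H) :
    galerkinOp N g u = sineElt N fun n => g (eigval n) * inner ℝ (basis n) u := by
  simp [galerkinOp, sineElt, smul_smul]

lemma inner_basis_sineElt (N n : ℕ) (y : ℕ → ℝ) :
    inner ℝ (basis n) (sineElt N y) = if n < N then y n else 0 := by
  simp [sineElt, inner_sum, inner_smul_right, inner_basis_basis]

lemma sineElt_congr {N : ℕ} {y z : ℕ → ℝ} (h : ∀ n < N, y n = z n) : sineElt N y = sineElt N z :=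
  Finset.sum_congr rfl fun n hn => by rw [h n (Finset.mem_range.1 hn)]

lemma sineElt_add (N : ℕ) (y z : ℕ → ℝ) : sineElt N y + sineElt N z = sineElt N (y + z) := by
  simp [sineElt, add_smul, Finset.sum_add_distrib]

lemma sineElt_sub (N : ℕ) (y z : ℕ → ℝ) : sineElt N y - sineElt N z = sineElt N (y - z) := by
  simp [sineElt, sub_smul, Finset.sum_sub_distrib]

lemma smul_sineElt (N : ℕ) (c : ℝ) (y : ℕ → ℝ) : c • sineElt N y = sineElt N (c • y) := by
  simp [sineElt, Finset.smul_sum, smul_smul]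

lemma norm_sineElt (N : ℕ) (y : ℕ → ℝ) : ‖sineElt N y‖ = √(∑ n ∈ Finset.range N, y n ^ 2) := by
  rw [norm_eq_sqrt_real_inner]
  congr 1
  conv_lhs => rw [sineElt, sum_inner]
  refine Finset.sum_congr rfl fun n hn => ?_
  rw [inner_smul_left, ← sineElt, inner_basis_sineElt, if_pos (Finset.mem_range.1 hn)]
  simp [sq]

/-- The restriction of `∑_{n < N} y_n e_n` to `[0, 1]`. -/
def sineCont (N : ℕ) (y : ℕ → ℝ) : C(unitInterval, ℝ) :=
  ⟨fun x => sineSum N y x, (continuous_sineSum N y).comp continuous_subtype_val⟩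

/-- The supremum norm of `∑_{n < N} y_n e_n`. -/
def sineNorm (N : ℕ) (y : ℕ → ℝ) : ℝ := ‖sineCont N y‖

lemma sineNorm_nonneg (N : ℕ) (y : ℕ → ℝ) : 0 ≤ sineNorm N y := norm_nonneg _

lemma abs_sineSum_le {N : ℕ} {y : ℕ → ℝ} {x : ℝ} (hx : x ∈ Set.Icc (0 : ℝ) 1) :
    |sineSum N y x| ≤ sineNorm N y :=
  (sineCont N y).norm_coe_le_norm ⟨x, hx⟩

lemma sineNorm_le {N : ℕ} {y : ℕ → ℝ} {C : ℝ} (hC : 0 ≤ C)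
    (h : ∀ x ∈ Set.Icc (0 : ℝ) 1, |sineSum N y x| ≤ C) : sineNorm N y ≤ C :=
  (ContinuousMap.norm_le _ hC).2 fun x => h x x.2

lemma sineNorm_add_le (N : ℕ) (y z : ℕ → ℝ) :
    sineNorm N (y + z) ≤ sineNorm N y + sineNorm N z :=
  sineNorm_le (add_nonneg (sineNorm_nonneg _ _) (sineNorm_nonneg _ _)) fun x hx => by
    rw [sineSum_add]
    exact (abs_add_le _ _).trans (add_le_add (abs_sineSum_le hx) (abs_sineSum_le hx))

lemma sineNorm_le_sum (N : ℕ) (y : ℕ → ℝ) :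
    sineNorm N y ≤ √2 * ∑ n ∈ Finset.range N, |y n| := by
  refine sineNorm_le (by positivity) fun x _ => ?_
  rw [Finset.mul_sum]
  refine (Finset.abs_sum_le_sum_abs _ _).trans (Finset.sum_le_sum fun n _ => ?_)
  rw [abs_mul, mul_comm]
  exact mul_le_mul_of_nonneg_right (abs_eigfun_le n x) (abs_nonneg _)

/-- Only finitely many coordinates enter, and they enter linearly, so continuity holds for the
product topology. This is the source of all measurability of supremum norms below. -/
lemma continuous_sineNorm (N : ℕ) : Continuous (sineNorm N) := by
  have h : ∀ y, sineCont N y = ∑ n ∈ Finset.range N, y n •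
      (⟨fun x => eigfun n x, (continuous_eigfun n).comp continuous_subtype_val⟩ :
        C(unitInterval, ℝ)) := fun y => by
    ext x
    simp [sineCont, sineSum, ContinuousMap.coe_sum]
  unfold sineNorm
  simp only [h]
  fun_prop

/-- Used in both directions to turn convergence of the coefficients into convergence of the norms.
-/
lemma abs_sineNorm_sub_le (N : ℕ) (y z : ℕ → ℝ) :
    sineNorm N y ≤ sineNorm N z + √2 * ∑ n ∈ Finset.range N, |y n - z n| := by
  have h := sineNorm_add_le N z (y - z)
  rw [add_sub_cancel] at h
  exact h.trans (add_le_add le_rfl (sineNorm_le_sum N _))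

/-- Continuous functions that agree almost everywhere on an open set agree on it, so every
representative admitted in the infimum gives the same supremum. Passing from the open to the closed
interval costs nothing, by density. -/
lemma supNorm_sineElt (N : ℕ) (y : ℕ → ℝ) :
    supNorm (sineElt N y) = ENNReal.ofReal (sineNorm N y) := by
  have hsup : (⨆ x ∈ dom, ‖sineSum N y x‖ₑ) = ENNReal.ofReal (sineNorm N y) := by
    apply le_antisymm
    · refine iSup₂_le fun x hx => ?_
      rw [Real.enorm_eq_ofReal_abs]
      exact ENNReal.ofReal_le_ofReal (abs_sineSum_le (Set.Ioo_subset_Icc_self hx))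
    · by_cases htop : (⨆ x ∈ dom, ‖sineSum N y x‖ₑ) = ∞
      · rw [htop]; exact le_top
      refine ENNReal.ofReal_le_of_le_toReal (sineNorm_le ENNReal.toReal_nonneg ?_)
      have hcl : IsClosed {x : ℝ | |sineSum N y x| ≤ (⨆ x ∈ dom, ‖sineSum N y x‖ₑ).toReal} :=
        isClosed_le (continuous_sineSum N y).abs continuous_const
      have hsub : Set.Icc (0 : ℝ) 1 ⊆
          {x : ℝ | |sineSum N y x| ≤ (⨆ x ∈ dom, ‖sineSum N y x‖ₑ).toReal} := by
        rw [← closure_Ioo (zero_ne_one (α := ℝ))]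
        refine hcl.closure_subset_iff.2 fun x hx => ?_
        rw [Set.mem_ofPred_eq, ← Real.norm_eq_abs, ← toReal_enorm]
        exact ENNReal.toReal_mono htop
          (le_iSup₂ (f := fun x (_ : x ∈ dom) => ‖sineSum N y x‖ₑ) x hx)
      exact hsub
  rw [← hsup]
  apply le_antisymm
  · exact iInf_le_of_le (sineSum N y) (iInf_le_of_le (continuous_sineSum N y).continuousOn
      (iInf_le_of_le (sineElt_ae N y) le_rfl))
  · refine le_iInf fun g => le_iInf fun hg => le_iInf fun hug => ?_
    have hae : sineSum N y =ᵐ[volume.restrict dom] g := (sineElt_ae N y).symm.trans hug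
    have heq : Set.EqOn (sineSum N y) g dom :=
      Measure.eqOn_open_of_ae_eq hae isOpen_Ioo (continuous_sineSum N y).continuousOn hg
    exact iSup₂_mono fun x hx => by rw [heq hx]

/-! ### The scheme in coordinates. -/

/-- The coefficients of `F_N(∑_{n < N} y_n e_n)`. -/
def nemCoeff (N : ℕ) (f : ℝ → ℝ) (y : ℕ → ℝ) (n : ℕ) : ℝ :=
  ∫ x, eigfun n x * f (sineSum N y x) ∂leb

lemma memLp_of_continuous {g : ℝ → ℝ} (hg : Continuous g) (p : ℝ≥0∞) : MemLp g p leb := by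
  obtain ⟨C, hC⟩ := isCompact_Icc.exists_bound_of_continuousOn (s := Set.Icc (0 : ℝ) 1)
    hg.continuousOn
  refine MemLp.of_bound hg.aestronglyMeasurable C ?_
  filter_upwards [ae_leb_mem] with x hx using hC x (Set.Ioo_subset_Icc_self hx)

lemma inner_basis_nemytskii (N n : ℕ) {f : ℝ → ℝ} (hf : Continuous f) (y : ℕ → ℝ) :
    inner ℝ (basis n) (nemytskii f (sineElt N y)) = nemCoeff N f y n := by
  have hae : (fun x => f (sineElt N y x)) =ᵐ[leb] fun x => f (sineSum N y x) := by
    filter_upwards [sineElt_ae N y] with x hx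
    rw [hx]
  -- Sine sums are bounded, so the default value `0` of `nemytskii` never occurs.
  have hmem : MemLp (fun x => f (sineElt N y x)) 2 leb :=
    (memLp_congr_ae hae).2 (memLp_of_continuous (hf.comp (continuous_sineSum N y)) 2)
  rw [inner_basis_eq, nemytskii, dif_pos hmem, nemCoeff]
  refine integral_congr_ae ?_
  filter_upwards [hmem.coeFn_toLp, hae] with x h1 h2
  rw [h1, h2]

/-- The scalar `1 / (1 + τ ‖F_N(∑_{n < N} y_n e_n)‖)`. -/
def taming (τ : ℝ) (N : ℕ) (f : ℝ → ℝ) (y : ℕ → ℝ) : ℝ :=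
  (1 + τ * √(∑ n ∈ Finset.range N, nemCoeff N f y n ^ 2))⁻¹

/-- The coefficients of the scheme with initial coefficients `ξ` and noise increments `η`. -/
def schemeCoeff (τ : ℝ) (N : ℕ) (f : ℝ → ℝ) (ξ : ℕ → ℝ) (η : ℕ → ℕ → ℝ) : ℕ → ℕ → ℝ
  | 0, n => ξ n
  | m + 1, n =>
    Real.exp (-(τ * eigval n)) * schemeCoeff τ N f ξ η m n
      + taming τ N f (schemeCoeff τ N f ξ η m) *
        ((1 - Real.exp (-(τ * eigval n))) / eigval n
          * nemCoeff N f (schemeCoeff τ N f ξ η m) n)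
      + η m n

variable {Ω : Type*} {mΩ : MeasurableSpace Ω}

/-- All operators of the scheme are diagonal in the sine basis. The coefficients are defined for
every index, but `sineElt N` only sees those below `N`. -/
lemma scheme_eq_sineElt (P : Measure Ω) (T : ℝ) {f : ℝ → ℝ} (hf : Continuous f)
    (B : ℕ → ℝ → Ω → ℝ) (X₀ : Ω → H) (M N m : ℕ) (ω : Ω) :
    scheme P T f B X₀ M N m ω = sineElt N (schemeCoeff (T / M) N f
      (fun n => inner ℝ (basis n) (X₀ ω))
      (fun j n => stochIntegral P (B n) (j * (T / M)) ((j + 1 : ℕ) * (T / M))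
        (fun s => Real.exp (-(((j + 1 : ℕ) * (T / M) - s) * eigval n))) ω) m) := by
  induction m with
  | zero => simp [scheme, proj, galerkinOp_apply, schemeCoeff]
  | succ m ih =>
    have hF : proj N (nemytskii f (scheme P T f B X₀ M N m ω)) = sineElt N (nemCoeff N f
        (schemeCoeff (T / M) N f (fun n => inner ℝ (basis n) (X₀ ω))
      (fun j n => stochIntegral P (B n) (j * (T / M)) ((j + 1 : ℕ) * (T / M))
        (fun s => Real.exp (-(((j + 1 : ℕ) * (T / M) - s) * eigval n))) ω) m)) := by
      rw [ih, proj, galerkinOp_apply]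
      simp only [one_mul, inner_basis_nemytskii N _ hf]
    rw [scheme]
    have hW : stochConv P B N (m * (T / M)) ((m + 1 : ℕ) * (T / M)) ω = sineElt N fun n =>
        stochIntegral P (B n) (m * (T / M)) ((m + 1 : ℕ) * (T / M))
          (fun s => Real.exp (-(((m + 1 : ℕ) * (T / M) - s) * eigval n))) ω := rfl
    rw [hF, hW, ih, norm_sineElt, semigroup, invA]
    simp only [galerkinOp_apply, sineElt_sub, smul_sineElt, sineElt_add]
    refine sineElt_congr fun n hn => ?_
    simp only [Pi.add_apply, Pi.smul_apply, smul_eq_mul, inner_basis_sineElt, if_pos hn,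
      Pi.sub_apply, schemeCoeff, taming]
    ring

end

section

/-! ### The cubic nonlinearity -/

lemma continuous_cubic (a₃ a₂ a₁ a₀ : ℝ) : Continuous (cubic a₃ a₂ a₁ a₀) := by
  unfold cubic; fun_prop

lemma abs_cubic_le (a₃ a₂ a₁ a₀ : ℝ) :
    ∃ A, 0 ≤ A ∧ ∀ u, |cubic a₃ a₂ a₁ a₀ u| ≤ A * (1 + |u| ^ 3) := by
  refine ⟨|a₃| + |a₂| + |a₁| + |a₀|, by positivity, fun u => ?_⟩
  have h0 : 0 ≤ |u| := abs_nonneg u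
  have h1 : |u| ≤ 1 + |u| ^ 3 := by nlinarith [mul_nonneg h0 (sq_nonneg (|u| - 1))]
  have h2 : |u| ^ 2 ≤ 1 + |u| ^ 3 := by
    nlinarith [mul_nonneg h0 (sq_nonneg (|u| - 1)), sq_nonneg (|u| - 1)]
  have h3 : |u| ^ 3 ≤ 1 + |u| ^ 3 := by linarith
  have h4 : 1 ≤ 1 + |u| ^ 3 := by linarith [pow_nonneg h0 3]
  have e : |cubic a₃ a₂ a₁ a₀ u| ≤ |a₃| * |u| ^ 3 + |a₂| * |u| ^ 2 + |a₁| * |u| + |a₀| := by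
    rw [cubic, ← abs_pow, ← abs_pow, ← abs_mul, ← abs_mul, ← abs_mul]
    exact (abs_add_le _ _).trans (add_le_add ((abs_add_le _ _).trans
      (add_le_add (abs_add_le _ _) le_rfl)) le_rfl)
  have g1 := mul_le_mul_of_nonneg_left h1 (abs_nonneg a₁)
  have g2 := mul_le_mul_of_nonneg_left h2 (abs_nonneg a₂)
  have g3 := mul_le_mul_of_nonneg_left h3 (abs_nonneg a₃)
  have g4 := mul_le_mul_of_nonneg_left h4 (abs_nonneg a₀)
  linarith

/-- Young's inequality up to constants, by comparing `w` with `ε v`. -/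
lemma cube_mul_le {ε : ℝ} (hε : 0 < ε) {v w : ℝ} (hv : 0 ≤ v) (hw : 0 ≤ w) :
    v ^ 3 * w ≤ ε * v ^ 4 + (ε ^ 3)⁻¹ * w ^ 4 := by
  rcases le_total w (ε * v) with h | h
  · have := mul_le_mul_of_nonneg_left h (pow_nonneg hv 3)
    have : 0 ≤ (ε ^ 3)⁻¹ * w ^ 4 := by positivity
    nlinarith
  · have h1 : v ≤ w / ε := by rw [le_div_iff₀ hε]; linarith
    have h2 : v ^ 3 ≤ (w / ε) ^ 3 := pow_le_pow_left₀ hv h1 3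
    have h3 := mul_le_mul_of_nonneg_right h2 hw
    have h4 : (w / ε) ^ 3 * w = (ε ^ 3)⁻¹ * w ^ 4 := by rw [div_pow]; field_simp
    have : 0 ≤ ε * v ^ 4 := by positivity
    linarith

/-- Apart from `a₃ v⁴`, every monomial has degree at most three in `v`, so Young's inequality
absorbs it into half of the leading term. The quartic gain in `v` survives and is what later
controls the cubic growth. -/
lemma cubic_dissipative {a₃ : ℝ} (ha : a₃ < 0) (a₂ a₁ a₀ : ℝ) :
    ∃ c D, 0 < c ∧ 0 ≤ D ∧ ∀ v z,
      v * cubic a₃ a₂ a₁ a₀ (v + z) ≤ -c * v ^ 4 + D * (1 + z ^ 4) := by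
  set K : ℝ := 3 * |a₃| + 2 * |a₂| + |a₁| + |a₀| with hK
  have hK0 : 0 < K := by have := abs_pos.2 ha.ne; positivity
  -- Chosen so that `4 K ε = -a₃ / 2`, half of the leading coefficient.
  set ε : ℝ := -a₃ / (8 * K) with hε
  have hε0 : 0 < ε := div_pos (by linarith) (by positivity)
  refine ⟨-a₃ / 2, 32 * K * ((ε ^ 3)⁻¹ + 1), by linarith, by positivity, fun v z => ?_⟩
  obtain ⟨w, hw⟩ : ∃ w, w = 1 + |z| := ⟨_, rfl⟩
  obtain ⟨x, hx⟩ : ∃ x, x = |v| := ⟨_, rfl⟩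
  have hx0 : 0 ≤ x := hx ▸ abs_nonneg v
  have hw1 : 1 ≤ w := by rw [hw]; linarith [abs_nonneg z]
  have hz : |z| ≤ w := by rw [hw]; linarith
  have hw0 : 0 ≤ w := by linarith
  -- Since `w = 1 + |z| ≥ 1`, every remaining term, whatever its degree, is dominated by the single
  -- quartic form `x w (x + w)²`.
  have key : v * cubic a₃ a₂ a₁ a₀ (v + z) - a₃ * v ^ 4 ≤ K * (x * w * (x + w) ^ 2) := by
    have e : v * cubic a₃ a₂ a₁ a₀ (v + z) - a₃ * v ^ 4 =
        a₃ * (v * z * (3 * v ^ 2 + 3 * v * z + z ^ 2)) + a₂ * (v * (v + z) ^ 2)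
          + a₁ * (v * (v + z)) + a₀ * v := by rw [cubic]; ring
    have t3 : |v * z * (3 * v ^ 2 + 3 * v * z + z ^ 2)| ≤ 3 * (x * w * (x + w) ^ 2) := by
      have i1 : |3 * v ^ 2 + 3 * v * z + z ^ 2| ≤ 3 * (x + w) ^ 2 := by
        have j1 : |3 * v ^ 2 + 3 * v * z + z ^ 2| ≤ 3 * x ^ 2 + 3 * x * |z| + |z| ^ 2 := by
          refine (abs_add_three _ _ _).trans ?_
          rw [abs_mul, abs_mul, abs_mul, abs_pow, abs_pow, hx]; simp
        nlinarith [abs_nonneg z, mul_le_mul_of_nonneg_left hz hx0,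
          pow_le_pow_left₀ (abs_nonneg z) hz 2]
      rw [abs_mul, abs_mul, ← hx]
      calc x * |z| * |3 * v ^ 2 + 3 * v * z + z ^ 2| ≤ x * w * (3 * (x + w) ^ 2) := by gcongr
        _ = _ := by ring
    have hs : |v + z| ≤ x + w := (abs_add_le _ _).trans (by rw [hx]; linarith)
    have hxw : 1 ≤ x + w := by linarith
    have t2 : |v * (v + z) ^ 2| ≤ 2 * (x * w * (x + w) ^ 2) := by
      rw [abs_mul, abs_pow, ← hx]
      have h1 : |v + z| ^ 2 ≤ (x + w) ^ 2 := pow_le_pow_left₀ (abs_nonneg _) hs 2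
      have h2 : x * |v + z| ^ 2 ≤ x * (x + w) ^ 2 := by gcongr
      have h3 : x * (x + w) ^ 2 * 1 ≤ x * (x + w) ^ 2 * w := by gcongr
      have h4 : 0 ≤ x * (x + w) ^ 2 * w := by positivity
      linarith
    have t1 : |v * (v + z)| ≤ x * w * (x + w) ^ 2 := by
      rw [abs_mul, ← hx]
      have h1 : |v + z| ≤ w * (x + w) ^ 2 := by nlinarith
      calc x * |v + z| ≤ x * (w * (x + w) ^ 2) := by gcongr
        _ = _ := by ring
    have t0 : |v| ≤ x * w * (x + w) ^ 2 := by
      rw [← hx]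
      have h1 : 1 ≤ w * (x + w) ^ 2 := by nlinarith
      calc x = x * 1 := by ring
        _ ≤ x * (w * (x + w) ^ 2) := by gcongr
        _ = _ := by ring
    have b : ∀ a s : ℝ, a * s ≤ |a| * |s| := fun a s => by rw [← abs_mul]; exact le_abs_self _
    have c3 := (b a₃ _).trans (mul_le_mul_of_nonneg_left t3 (abs_nonneg a₃))
    have c2 := (b a₂ _).trans (mul_le_mul_of_nonneg_left t2 (abs_nonneg a₂))
    have c1 := (b a₁ _).trans (mul_le_mul_of_nonneg_left t1 (abs_nonneg a₁))
    have c0 := (b a₀ _).trans (mul_le_mul_of_nonneg_left t0 (abs_nonneg a₀))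
    rw [e, hK]
    linarith
  have hy : x * w * (x + w) ^ 2 ≤ 4 * (x ^ 3 * w + w ^ 4) := by
    rcases le_total x w with h | h
    · have : x * w * (x + w) ^ 2 ≤ w * w * (w + w) ^ 2 := by gcongr
      have h3 : 0 ≤ x ^ 3 * w := by positivity
      nlinarith
    · have : x * w * (x + w) ^ 2 ≤ x * w * (x + x) ^ 2 := by gcongr
      have h3 : 0 ≤ w ^ 4 := by positivity
      nlinarith
  have hc := cube_mul_le hε0 hx0 hw0
  have hx4 : x ^ 4 = v ^ 4 := by rw [hx]; exact (Even.pow_abs (by decide) v)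
  have hw4 : w ^ 4 ≤ 8 * (1 + z ^ 4) := by
    have : z ^ 4 = |z| ^ 4 := (Even.pow_abs (by decide) z).symm
    rw [this, hw]
    nlinarith [sq_nonneg (|z| - 1), sq_nonneg (|z| ^ 2 - 1), sq_nonneg (|z| ^ 2 - |z|),
      sq_nonneg (|z| + 1), mul_nonneg (sq_nonneg (|z| - 1)) (abs_nonneg z), abs_nonneg z]
  have e1 : 4 * K * ε = -a₃ / 2 := by rw [hε]; field_simp; ring
  have h1 : K * (x * w * (x + w) ^ 2) ≤ K * (4 * (ε * x ^ 4 + (ε ^ 3)⁻¹ * w ^ 4 + w ^ 4)) := by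
    have := hy.trans (mul_le_mul_of_nonneg_left (add_le_add hc (le_refl (w ^ 4)))
      (by norm_num : (0 : ℝ) ≤ 4))
    exact mul_le_mul_of_nonneg_left this hK0.le
  have h2 : K * (4 * (ε * x ^ 4 + (ε ^ 3)⁻¹ * w ^ 4 + w ^ 4)) =
      4 * K * ε * x ^ 4 + 4 * K * ((ε ^ 3)⁻¹ + 1) * w ^ 4 := by ring
  have h3 : 4 * K * ((ε ^ 3)⁻¹ + 1) * w ^ 4 ≤ 4 * K * ((ε ^ 3)⁻¹ + 1) * (8 * (1 + z ^ 4)) :=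
    mul_le_mul_of_nonneg_left hw4 (by positivity)
  rw [h2, e1, hx4] at h1
  linarith

/-! ### Time-stepping of a single mode -/

/-- The cross term on the right has the same factor `2τ` in every mode, so that summation over the
modes produces `∫ v f(y)`, where dissipativity applies. The true cross term carries a mode-dependent
factor; the discrepancy is absorbed by the contraction of the semigroup and by `τ² g²`. -/
lemma mode_energy {l τ : ℝ} (hl : 0 < l) (hτ : 0 < τ) (v g : ℝ) :
    (Real.exp (-(τ * l)) * v + (1 - Real.exp (-(τ * l))) / l * g) ^ 2 ≤
      v ^ 2 + 2 * τ * (g * v) + 2 * τ ^ 2 * g ^ 2 := by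
  set a := Real.exp (-(τ * l)) with ha
  set u := (1 - a) / l with hu
  have ha0 : 0 < a := Real.exp_pos _
  have hx : 0 < τ * l := mul_pos hτ hl
  have ha1 : a ≤ 1 := Real.exp_le_one_iff.2 (by linarith)
  have hu1 : u ≤ τ := by
    rw [hu, div_le_iff₀ hl]
    have := Real.add_one_le_exp (-(τ * l))
    linarith
  have hu2 : a * τ ≤ u := by
    rw [hu, le_div_iff₀ hl]
    have h1 := Real.add_one_le_exp (τ * l)
    have h2 : a * Real.exp (τ * l) = 1 := by rw [ha, ← Real.exp_add]; simp
    nlinarith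
  have hu0 : 0 ≤ u := (mul_nonneg ha0.le hτ.le).trans hu2
  -- `r` is the relative defect of the cross term. As `r² ≤ 1 - a²`, the square `(r v + τ g)² ≥ 0`
  -- pays for it.
  obtain ⟨r, hr⟩ : ∃ r, r = 1 - a * u / τ := ⟨_, rfl⟩
  have hrτ : r * τ = τ - a * u := by rw [hr]; field_simp
  have hr0 : 0 ≤ r := by
    have : 0 ≤ r * τ := by rw [hrτ]; nlinarith
    exact nonneg_of_mul_nonneg_left this hτ
  have hr1 : r ≤ 1 - a ^ 2 := by
    have : r * τ ≤ (1 - a ^ 2) * τ := by rw [hrτ]; nlinarith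
    exact le_of_mul_le_mul_right this hτ
  have hr2 : r ^ 2 ≤ 1 - a ^ 2 := by nlinarith
  have h1 : 0 ≤ (r * v + τ * g) ^ 2 := sq_nonneg _
  have h2 : r ^ 2 * v ^ 2 ≤ (1 - a ^ 2) * v ^ 2 := mul_le_mul_of_nonneg_right hr2 (sq_nonneg v)
  have h3 : u ^ 2 * g ^ 2 ≤ τ ^ 2 * g ^ 2 :=
    mul_le_mul_of_nonneg_right (pow_le_pow_left₀ hu0 hu1 2) (sq_nonneg g)
  have h4 : 2 * (r * v) * (τ * g) = 2 * (τ - a * u) * v * g := by rw [← hrτ]; ring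
  nlinarith

/-- The exponential decay is traded for a rational one, which can be summed over the modes by
telescoping. The factor `1 - a` supplies the shift from `k` to `k + 1`, so the kernel is finite at
`k = 0` too. -/
lemma mode_kernel_le {l τ : ℝ} (hl : 0 < l) (hτ : 0 < τ) (k : ℕ) :
    Real.exp (-(τ * l)) ^ k * ((1 - Real.exp (-(τ * l))) / l) ≤
      2 * τ / (1 + l * ((k + 1) * τ)) := by
  have hx : 0 < τ * l := mul_pos hτ hl
  set a := Real.exp (-(τ * l)) with ha
  have ha0 : 0 < a := Real.exp_pos _
  have ha1 : a ≤ 1 := Real.exp_le_one_iff.2 (by linarith)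
  have h1 : a ^ k * (1 + k * (τ * l)) ≤ 1 := by
    have h := Real.add_one_le_exp (k * (τ * l))
    have e : a ^ k * Real.exp (k * (τ * l)) = 1 := by
      rw [ha, ← Real.exp_nat_mul, ← Real.exp_add]; simp
    rw [← e]
    exact mul_le_mul_of_nonneg_left (by linarith) (by positivity)
  have h2 : (1 - a) * (1 + τ * l) ≤ 2 * (τ * l) := by
    have := Real.add_one_le_exp (-(τ * l))
    nlinarith
  rw [mul_div_assoc', div_le_div_iff₀ hl (by positivity)]
  have h3 : 1 + l * ((k + 1) * τ) ≤ (1 + k * (τ * l)) * (1 + τ * l) := by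
    nlinarith [mul_nonneg (Nat.cast_nonneg (α := ℝ) k) (sq_nonneg (τ * l))]
  have h4 : 0 ≤ a ^ k * (1 - a) := mul_nonneg (by positivity) (by linarith)
  calc a ^ k * (1 - a) * (1 + l * ((k + 1) * τ))
      ≤ a ^ k * (1 - a) * ((1 + k * (τ * l)) * (1 + τ * l)) := by gcongr
    _ = (a ^ k * (1 + k * (τ * l))) * ((1 - a) * (1 + τ * l)) := by ring
    _ ≤ 1 * (2 * (τ * l)) := by
        refine mul_le_mul h1 h2 (mul_nonneg (by linarith) (by linarith)) zero_le_one
    _ = 2 * τ * l := by ring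

/-- A discrete form of `∫ dx / (1 + π² s x²) ~ s^{-1/2}`: with `a = π √s`, each term is dominated by
a multiple of a difference of `1 / (1 + a n)`. -/
lemma sum_inv_one_add_eigval_le {s : ℝ} (hs : 0 < s) (N : ℕ) :
    ∑ n ∈ Finset.range N, 1 / (1 + eigval n * s) ≤ 1 / √s := by
  have hq : 0 < √s := Real.sqrt_pos.2 hs
  have hss : √s ^ 2 = s := Real.sq_sqrt hs.le
  set a : ℝ := Real.pi * √s with ha
  have ha0 : 0 < a := mul_pos Real.pi_pos hq
  have hterm : ∀ n : ℕ, 1 / (1 + eigval n * s) ≤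
      (2 / a) * (1 / (1 + a * n) - 1 / (1 + a * (n + 1 : ℕ))) := fun n => by
    have e1 : eigval n * s = (a * (n + 1)) ^ 2 := by rw [eigval, ha, mul_pow, mul_pow, hss]; ring
    have hp : 0 < 1 + a * (n : ℝ) := by positivity
    have hp' : 0 < 1 + a * ((n + 1 : ℕ) : ℝ) := by positivity
    rw [e1, div_sub_div _ _ hp.ne' hp'.ne', div_mul_div_comm,
      div_le_div_iff₀ (by positivity) (by positivity)]
    push_cast
    have h2 : 0 ≤ a * (n : ℝ) := by positivity
    nlinarith [mul_nonneg ha0.le (sq_nonneg (a * (n + 1) - 1)), mul_pos ha0 ha0,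
      mul_nonneg ha0.le (mul_nonneg h2 ha0.le)]
  refine (Finset.sum_le_sum fun n _ => hterm n).trans ?_
  rw [← Finset.mul_sum, Finset.sum_range_sub' (fun n : ℕ => 1 / (1 + a * (n : ℝ)))]
  have h1 : 0 ≤ 1 / (1 + a * (N : ℝ)) := by positivity
  have h2 : 2 / a * (1 / (1 + a * ((0 : ℕ) : ℝ)) - 1 / (1 + a * (N : ℝ))) ≤ 2 / a := by
    have : 0 ≤ 2 / a := by positivity
    simp only [Nat.cast_zero, mul_zero, add_zero, div_one]
    nlinarith
  refine h2.trans ?_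
  rw [div_le_div_iff₀ ha0 hq, ha]
  nlinarith [Real.pi_gt_three]

/-- The quantity `((k + 1) τ)^{1/4}`. -/
def rootTime (τ : ℝ) (k : ℕ) : ℝ := √√((k + 1) * τ)

lemma rootTime_pos {τ : ℝ} (hτ : 0 < τ) (k : ℕ) : 0 < rootTime τ k :=
  Real.sqrt_pos.2 (Real.sqrt_pos.2 (by positivity))

lemma sum_mode_kernel_le {τ : ℝ} (hτ : 0 < τ) (k N : ℕ) :
    ∑ n ∈ Finset.range N, Real.exp (-(τ * eigval n)) ^ k *
      ((1 - Real.exp (-(τ * eigval n))) / eigval n) ≤ 2 * τ * (rootTime τ k ^ 2)⁻¹ := by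
  have hs : 0 < ((k : ℝ) + 1) * τ := by positivity
  calc _ ≤ ∑ n ∈ Finset.range N, 2 * τ * (1 / (1 + eigval n * ((k + 1) * τ))) :=
        Finset.sum_le_sum fun n _ => (mode_kernel_le (eigval_pos n) hτ k).trans_eq (by ring)
    _ ≤ 2 * τ * (1 / √((k + 1) * τ)) := by
        rw [← Finset.mul_sum]
        exact mul_le_mul_of_nonneg_left (sum_inv_one_add_eigval_le hs N) (by positivity)
    _ = _ := by rw [rootTime, Real.sq_sqrt (Real.sqrt_nonneg _), one_div]

/-- The integrability of `t^{-3/4}`: with fourth roots `c ≤ b` of consecutive times, `τ = b⁴ - c⁴ ≤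
4 b³ (b - c)`, and the differences telescope. -/
lemma sum_rootTime_le {τ T : ℝ} (hτ : 0 < τ) (m : ℕ) (hm : m * τ ≤ T) :
    ∑ k ∈ Finset.range m, τ * (rootTime τ k ^ 3)⁻¹ ≤ 4 * √√T := by
  have hterm : ∀ k : ℕ, τ * (rootTime τ k ^ 3)⁻¹ ≤
      4 * √√((k + 1 : ℕ) * τ) - 4 * √√(k * τ) := fun k => by
    have hp := rootTime_pos hτ k
    set b := rootTime τ k with hb
    have hb' : √√((k + 1 : ℕ) * τ) = b := by rw [hb, rootTime]; push_cast; rfl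
    rw [hb']
    set c := √√(k * τ) with hc
    have hc0 : 0 ≤ c := Real.sqrt_nonneg _
    have hcb : c ≤ b := by
      rw [hc, hb, rootTime]
      exact Real.sqrt_le_sqrt (Real.sqrt_le_sqrt (by nlinarith))
    have e1 : b ^ 4 = (k + 1) * τ := by
      rw [hb, rootTime, show 4 = 2 * 2 from rfl, pow_mul, Real.sq_sqrt (Real.sqrt_nonneg _),
        Real.sq_sqrt (by positivity)]
    have e2 : c ^ 4 = k * τ := by
      rw [hc, show 4 = 2 * 2 from rfl, pow_mul, Real.sq_sqrt (Real.sqrt_nonneg _),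
        Real.sq_sqrt (by positivity)]
    rw [← div_eq_mul_inv, div_le_iff₀ (by positivity)]
    have e3 : τ = b ^ 4 - c ^ 4 := by rw [e1, e2]; ring
    have e4 : b ^ 4 - c ^ 4 = (b - c) * (b ^ 3 + b ^ 2 * c + b * c ^ 2 + c ^ 3) := by ring
    have h1 : b ^ 3 + b ^ 2 * c + b * c ^ 2 + c ^ 3 ≤ 4 * b ^ 3 := by
      have i1 : b ^ 2 * c ≤ b ^ 2 * b := by gcongr
      have i2 : b * c ^ 2 ≤ b * b ^ 2 := by gcongr
      have i3 : c ^ 3 ≤ b ^ 3 := by gcongr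
      nlinarith
    rw [e3, e4]
    have := mul_le_mul_of_nonneg_left h1 (sub_nonneg.2 hcb)
    linarith
  refine (Finset.sum_le_sum fun k _ => hterm k).trans ?_
  rw [Finset.sum_range_sub (fun k : ℕ => 4 * √√(k * τ))]
  have := Real.sqrt_le_sqrt (Real.sqrt_le_sqrt hm)
  simp only [Nat.cast_zero, zero_mul, Real.sqrt_zero, mul_zero, sub_zero]
  linarith

/-! ### Pointwise Young inequalities -/

/-- With `b = t^{-1/4}` this exchanges the singularity `t^{-1/2}` against `|v|³` for quantities
bounded by the energy. If `b² ≤ |v|` the quartic term suffices; otherwise `|v| = √|v| √|v| ≤ σ b`.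
That only `σ`, the root of the supremum bound, appears is what lets the bootstrap close. -/
lemma weighted_cube_le {b σ v : ℝ} (hb : 0 ≤ b) (hσ : 0 ≤ σ) (hv : |v| ≤ σ ^ 2) :
    b ^ 2 * |v| ^ 3 ≤ v ^ 4 + σ * b ^ 3 * v ^ 2 := by
  have h4 : v ^ 4 = |v| ^ 4 := (Even.pow_abs (by decide) v).symm
  have h2 : v ^ 2 = |v| ^ 2 := (sq_abs v).symm
  rw [h4, h2]
  have h0 := abs_nonneg v
  set x := |v|
  rcases le_total (b ^ 2) x with h | h
  · have : b ^ 2 * x ^ 3 ≤ x * x ^ 3 := by gcongr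
    have : 0 ≤ σ * b ^ 3 * x ^ 2 := by positivity
    nlinarith
  · have e1 : √x ≤ σ := Real.sqrt_le_iff.2 ⟨hσ, hv⟩
    have e2 : √x ≤ b := Real.sqrt_le_iff.2 ⟨hb, h⟩
    have e3 : x = √x * √x := (Real.mul_self_sqrt h0).symm
    have e4 : x ≤ σ * b := by
      rw [e3]; exact mul_le_mul e1 e2 (Real.sqrt_nonneg _) hσ
    have : b ^ 2 * x ^ 2 * x ≤ b ^ 2 * x ^ 2 * (σ * b) := by gcongr
    have : 0 ≤ x ^ 4 := by positivity
    nlinarith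

lemma sq_mul_cube_le {b z : ℝ} (hb : 0 ≤ b) (hz : 0 ≤ z) : b ^ 2 * z ^ 3 ≤ b ^ 3 + z ^ 9 := by
  rcases le_total (z ^ 3) b with h | h
  · have : b ^ 2 * z ^ 3 ≤ b ^ 2 * b := by gcongr
    have : 0 ≤ z ^ 9 := by positivity
    nlinarith
  · have : b ^ 2 * z ^ 3 ≤ (z ^ 3) ^ 2 * z ^ 3 := by gcongr
    have : 0 ≤ b ^ 3 := by positivity
    nlinarith

end

section

/-! ### Fourier coefficients of the nonlinearity -/

lemma integral_sineSum_mul (N : ℕ) (v : ℕ → ℝ) {g : ℝ → ℝ} (hg : Continuous g) :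
    ∫ x, sineSum N v x * g x ∂leb =
      ∑ n ∈ Finset.range N, v n * ∫ x, eigfun n x * g x ∂leb := by
  simp only [sineSum, Finset.sum_mul, mul_assoc]
  rw [integral_finsetSum _ fun n _ => integrable_leb_of_continuous (by fun_prop)]
  simp only [integral_const_mul]

lemma integral_eigfun_mul_sineSum {N n : ℕ} (hn : n < N) (v : ℕ → ℝ) :
    ∫ x, eigfun n x * sineSum N v x ∂leb = v n := by
  simp only [mul_comm (eigfun n _)]
  rw [integral_sineSum_mul N v (continuous_eigfun n)]
  simp [integral_eigfun_mul_eigfun, hn]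

lemma integral_sineSum_sq (N : ℕ) (v : ℕ → ℝ) :
    ∫ x, sineSum N v x ^ 2 ∂leb = ∑ n ∈ Finset.range N, v n ^ 2 := by
  simp only [sq]
  rw [integral_sineSum_mul N v (continuous_sineSum N v)]
  exact Finset.sum_congr rfl fun n hn => by
    rw [integral_eigfun_mul_sineSum (Finset.mem_range.1 hn)]

lemma integral_sineSum_mul_nem (N : ℕ) {f : ℝ → ℝ} (hf : Continuous f) (v y : ℕ → ℝ) :
    ∫ x, sineSum N v x * f (sineSum N y x) ∂leb =
      ∑ n ∈ Finset.range N, v n * nemCoeff N f y n :=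
  integral_sineSum_mul N v (hf.comp (continuous_sineSum N y))

/-- Bessel's inequality, from expanding the square of `f(y)` minus its projection. -/
lemma sum_nemCoeff_sq_le (N : ℕ) {f : ℝ → ℝ} (hf : Continuous f) (y : ℕ → ℝ) :
    ∑ n ∈ Finset.range N, nemCoeff N f y n ^ 2 ≤ ∫ x, f (sineSum N y x) ^ 2 ∂leb := by
  have hc := continuous_sineSum N (nemCoeff N f y)
  have hc' : Continuous fun x => f (sineSum N y x) := hf.comp (continuous_sineSum N y)
  have h : 0 ≤ ∫ x, (f (sineSum N y x) - sineSum N (nemCoeff N f y) x) ^ 2 ∂leb :=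
    integral_nonneg fun x => sq_nonneg _
  have e : ∀ x, (f (sineSum N y x) - sineSum N (nemCoeff N f y) x) ^ 2 =
      f (sineSum N y x) ^ 2 - 2 * (sineSum N (nemCoeff N f y) x * f (sineSum N y x))
        + sineSum N (nemCoeff N f y) x ^ 2 := fun x => by ring
  simp only [e] at h
  rw [integral_add (integrable_leb_of_continuous (by fun_prop))
    (integrable_leb_of_continuous (by fun_prop)),
    integral_sub (integrable_leb_of_continuous (by fun_prop))
    (integrable_leb_of_continuous (by fun_prop)), integral_const_mul,
    integral_sineSum_mul_nem N hf, integral_sineSum_sq] at h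
  simp only [← sq] at h
  linarith

lemma abs_nemCoeff_le (N : ℕ) {f : ℝ → ℝ} (hf : Continuous f) (y : ℕ → ℝ) (n : ℕ) :
    |nemCoeff N f y n| ≤ √2 * ∫ x, |f (sineSum N y x)| ∂leb := by
  have hc' : Continuous fun x => f (sineSum N y x) := hf.comp (continuous_sineSum N y)
  rw [nemCoeff, ← integral_const_mul]
  refine (abs_integral_le_integral_abs).trans (integral_mono
    (integrable_leb_of_continuous (by fun_prop))
    (integrable_leb_of_continuous (by fun_prop)) fun x => ?_)
  simp only [abs_mul]
  exact mul_le_mul_of_nonneg_right (abs_eigfun_le n x) (abs_nonneg _)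

lemma integral_leb_le {g : ℝ → ℝ} (hg : Continuous g) {C : ℝ}
    (h : ∀ x ∈ Set.Icc (0 : ℝ) 1, g x ≤ C) : ∫ x, g x ∂leb ≤ C := by
  have : ∫ x, g x ∂leb ≤ ∫ _, C ∂leb := by
    refine integral_mono_ae (integrable_leb_of_continuous hg) (integrable_const _) ?_
    filter_upwards [ae_leb_mem] with x hx using h x (Set.Ioo_subset_Icc_self hx)
  simpa using this

lemma integral_leb_mono {g h : ℝ → ℝ} (hg : Continuous g) (hh : Continuous h)
    (hgh : ∀ x ∈ Set.Icc (0 : ℝ) 1, g x ≤ h x) : ∫ x, g x ∂leb ≤ ∫ x, h x ∂leb := by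
  refine integral_mono_ae (integrable_leb_of_continuous hg) (integrable_leb_of_continuous hh) ?_
  filter_upwards [ae_leb_mem] with x hx using hgh x (Set.Ioo_subset_Icc_self hx)

/-! ### The drift part of the scheme -/

lemma taming_pos {τ : ℝ} (hτ : 0 < τ) (N : ℕ) (f : ℝ → ℝ) (y : ℕ → ℝ) : 0 < taming τ N f y := by
  unfold taming; positivity

lemma taming_le_one {τ : ℝ} (hτ : 0 < τ) (N : ℕ) (f : ℝ → ℝ) (y : ℕ → ℝ) :
    taming τ N f y ≤ 1 :=
  inv_le_one_of_one_le₀ (le_add_of_nonneg_right (by positivity))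

/-- This is `x / (1 + τ x) ≤ 1 / τ`: taming bounds the drift independently of the state. -/
lemma abs_taming_mul_nemCoeff_le {τ : ℝ} (hτ : 0 < τ) {N : ℕ} (f : ℝ → ℝ) (y : ℕ → ℝ) {n : ℕ}
    (hn : n < N) : |taming τ N f y * nemCoeff N f y n| ≤ 1 / τ := by
  have h1 : |nemCoeff N f y n| ≤ √(∑ n ∈ Finset.range N, nemCoeff N f y n ^ 2) :=
    Real.abs_le_sqrt (Finset.single_le_sum (f := fun n => nemCoeff N f y n ^ 2)
      (fun i _ => sq_nonneg _) (Finset.mem_range.2 hn))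
  rw [abs_mul, abs_of_pos (taming_pos hτ N f y), taming, inv_mul_eq_div,
    div_le_div_iff₀ (by positivity) hτ]
  nlinarith

/-- The recursion of the scheme without noise, driven by the perturbation `Z` of the argument of
the nonlinearity. -/
structure IsDriftPart (τ : ℝ) (N : ℕ) (f : ℝ → ℝ) (Z v : ℕ → ℕ → ℝ) : Prop where
  zero : ∀ n, v 0 n = 0
  succ : ∀ m n, v (m + 1) n = Real.exp (-(τ * eigval n)) * v m n
    + (1 - Real.exp (-(τ * eigval n))) / eigval n *
      (taming τ N f (v m + Z m) * nemCoeff N f (v m + Z m) n)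

variable {τ : ℝ} {N : ℕ} {f : ℝ → ℝ} {Z v : ℕ → ℕ → ℝ}

/-- Discrete Duhamel formula. The truncated subtraction `m - 1 - j` is exact because `j < m`. -/
lemma IsDriftPart.eq_sum (h : IsDriftPart τ N f Z v) (m n : ℕ) :
    v m n = ∑ j ∈ Finset.range m, Real.exp (-(τ * eigval n)) ^ (m - 1 - j) *
      ((1 - Real.exp (-(τ * eigval n))) / eigval n) *
        (taming τ N f (v j + Z j) * nemCoeff N f (v j + Z j) n) := by
  induction m with
  | zero => simp [h.zero]
  | succ m ih =>
    rw [h.succ, Finset.sum_range_succ, ih, Finset.mul_sum]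
    congr 1
    · refine Finset.sum_congr rfl fun j hj => ?_
      have : m + 1 - 1 - j = (m - 1 - j) + 1 := by have := Finset.mem_range.1 hj; omega
      rw [this, pow_succ]
      ring
    · simp

/-- Smoothing from L¹ to the supremum norm: a bound on the coefficients uniform in the mode is
enough, because the kernel summed over all modes is of order `τ t^{-1/2}`, uniformly in `N`. -/
lemma IsDriftPart.abs_sineSum_le (h : IsDriftPart τ N f Z v) (hτ : 0 < τ) (m : ℕ) {b : ℕ → ℝ}
    (hb : ∀ j < m, ∀ n < N, |taming τ N f (v j + Z j) * nemCoeff N f (v j + Z j) n| ≤ b j)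
    (hb0 : ∀ j < m, 0 ≤ b j) (x : ℝ) :
    |sineSum N (v m) x| ≤ √2 * ∑ j ∈ Finset.range m,
      b j * (2 * τ * (rootTime τ (m - 1 - j) ^ 2)⁻¹) := by
  have hu : ∀ n, 0 ≤ (1 - Real.exp (-(τ * eigval n))) / eigval n := fun n =>
    div_nonneg (sub_nonneg.2 (Real.exp_le_one_iff.2
      (neg_nonpos.2 (mul_nonneg hτ.le (eigval_pos n).le)))) (eigval_pos n).le
  calc |sineSum N (v m) x| ≤ ∑ n ∈ Finset.range N, √2 * |v m n| := by
        refine (Finset.abs_sum_le_sum_abs _ _).trans (Finset.sum_le_sum fun n _ => ?_)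
        rw [abs_mul, mul_comm]
        exact mul_le_mul_of_nonneg_right (abs_eigfun_le n x) (abs_nonneg _)
    _ ≤ ∑ n ∈ Finset.range N, √2 * ∑ j ∈ Finset.range m, b j *
          (Real.exp (-(τ * eigval n)) ^ (m - 1 - j) *
            ((1 - Real.exp (-(τ * eigval n))) / eigval n)) := by
        refine Finset.sum_le_sum fun n hn => mul_le_mul_of_nonneg_left ?_ (Real.sqrt_nonneg 2)
        rw [h.eq_sum m n]
        refine (Finset.abs_sum_le_sum_abs _ _).trans (Finset.sum_le_sum fun j hj => ?_)
        have hk : 0 ≤ Real.exp (-(τ * eigval n)) ^ (m - 1 - j) *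
            ((1 - Real.exp (-(τ * eigval n))) / eigval n) := mul_nonneg (by positivity) (hu n)
        rw [abs_mul, abs_of_nonneg hk, mul_comm]
        exact mul_le_mul_of_nonneg_right
          (hb j (Finset.mem_range.1 hj) n (Finset.mem_range.1 hn)) hk
    _ = √2 * ∑ j ∈ Finset.range m, b j * ∑ n ∈ Finset.range N,
          Real.exp (-(τ * eigval n)) ^ (m - 1 - j) *
            ((1 - Real.exp (-(τ * eigval n))) / eigval n) := by
        rw [← Finset.mul_sum, Finset.sum_comm]
        simp only [Finset.mul_sum]
    _ ≤ _ := by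
        refine mul_le_mul_of_nonneg_left (Finset.sum_le_sum fun j hj => ?_) (Real.sqrt_nonneg 2)
        exact mul_le_mul_of_nonneg_left (sum_mode_kernel_le hτ _ N) (hb0 j (Finset.mem_range.1 hj))

lemma sqrt_two_le : √2 ≤ 2 := by
  rw [Real.sqrt_le_left (by norm_num)]; norm_num

lemma sum_rootTime_reflect_le {T : ℝ} (hτ : 0 < τ) (m : ℕ) (hm : m * τ ≤ T) :
    ∑ j ∈ Finset.range m, τ * (rootTime τ (m - 1 - j) ^ 3)⁻¹ ≤ 4 * √√T := by
  rw [Finset.sum_range_reflect (fun k => τ * (rootTime τ k ^ 3)⁻¹)]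
  exact sum_rootTime_le hτ m hm

lemma inv_sq_le_one_add_inv_cube {b : ℝ} (hb : 0 < b) : (b ^ 2)⁻¹ ≤ 1 + (b ^ 3)⁻¹ := by
  have := sq_mul_cube_le (inv_pos.2 hb).le zero_le_one
  simp only [one_pow, mul_one, inv_pow] at this
  linarith

/-- The unconditional bound. With `τ = T / M` it is linear in `M`, and it serves when the scheme has
left the moderate range. -/
lemma IsDriftPart.sineNorm_le_apriori {T : ℝ} (h : IsDriftPart τ N f Z v) (hτ : 0 < τ) (m : ℕ)
    (hm : m * τ ≤ T) : sineNorm N (v m) ≤ 4 * (T + 4 * √√T) / τ := by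
  have hT : 0 ≤ T := (mul_nonneg (Nat.cast_nonneg m) hτ.le).trans hm
  refine sineNorm_le (by positivity) fun x _ => ?_
  refine (h.abs_sineSum_le hτ m (b := fun _ => 1 / τ)
    (fun j _ n hn => abs_taming_mul_nemCoeff_le hτ f _ hn) (fun _ _ => by positivity) x).trans ?_
  have h1 : ∑ j ∈ Finset.range m, 1 / τ * (2 * τ * (rootTime τ (m - 1 - j) ^ 2)⁻¹) ≤
      2 / τ * (T + 4 * √√T) := by
    calc _ ≤ ∑ j ∈ Finset.range m,
          (2 / τ * τ + 2 / τ * (τ * (rootTime τ (m - 1 - j) ^ 3)⁻¹)) := by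
          refine Finset.sum_le_sum fun j _ => ?_
          have := inv_sq_le_one_add_inv_cube (rootTime_pos hτ (m - 1 - j))
          calc _ = 2 / τ * (τ * (rootTime τ (m - 1 - j) ^ 2)⁻¹) := by ring
            _ ≤ 2 / τ * (τ * (1 + (rootTime τ (m - 1 - j) ^ 3)⁻¹)) := by gcongr
            _ = _ := by ring
      _ = 2 / τ * (m * τ) + 2 / τ * ∑ j ∈ Finset.range m, τ * (rootTime τ (m - 1 - j) ^ 3)⁻¹ := by
          rw [Finset.sum_add_distrib, Finset.sum_const, Finset.card_range, nsmul_eq_mul,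
            ← Finset.mul_sum]
          ring
      _ ≤ 2 / τ * T + 2 / τ * (4 * √√T) := by
          gcongr; exact sum_rootTime_reflect_le hτ m hm
      _ = _ := by ring
  calc _ ≤ 2 * (2 / τ * (T + 4 * √√T)) :=
        mul_le_mul sqrt_two_le h1 (Finset.sum_nonneg fun j _ => by positivity) (by norm_num)
    _ = _ := by ring

/-! ### Energy estimate -/

lemma IsDriftPart.energy_step {c D A ρ z : ℝ} (h : IsDriftPart τ N f Z v) (hτ : 0 < τ)
    (hf : Continuous f) (hc : 0 < c) (hD : 0 ≤ D) (hA : 0 ≤ A)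
    (hfA : ∀ u, |f u| ≤ A * (1 + |u| ^ 3))
    (hdis : ∀ v z, v * f (v + z) ≤ -c * v ^ 4 + D * (1 + z ^ 4))
    (hρ : 1 ≤ ρ) {j : ℕ} (hZ : sineNorm N (Z j) ≤ z)
    (hR : sineNorm N (v j + Z j) ^ 3 ≤ ρ) :
    ∑ n ∈ Finset.range N, v (j + 1) n ^ 2
        + 2 * c * (1 + τ * (2 * A * ρ))⁻¹ * (τ * ∫ x, sineSum N (v j) x ^ 4 ∂leb) ≤
      ∑ n ∈ Finset.range N, v j n ^ 2 + 2 * D * τ * (1 + z ^ 4)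
        + 2 * τ ^ 2 * (2 * A * ρ) ^ 2 := by
  set y := v j + Z j with hy
  set θ := taming τ N f y with hθ
  have hz0 : 0 ≤ z := (sineNorm_nonneg _ _).trans hZ
  have hv4 := continuous_sineSum N (v j)
  have hI : 0 ≤ ∫ x, sineSum N (v j) x ^ 4 ∂leb := integral_nonneg fun x => by positivity
  have hg2 : ∑ n ∈ Finset.range N, nemCoeff N f y n ^ 2 ≤ (2 * A * ρ) ^ 2 := by
    refine (sum_nemCoeff_sq_le N hf y).trans (integral_leb_le (by fun_prop) fun x hx => ?_)
    have h1 : |sineSum N y x| ^ 3 ≤ ρ :=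
      (pow_le_pow_left₀ (abs_nonneg _) (TamedAllenCahn.abs_sineSum_le hx) 3).trans hR
    have h2 : |f (sineSum N y x)| ≤ 2 * A * ρ := by
      refine (hfA _).trans ?_
      nlinarith
    rw [← sq_abs]
    exact pow_le_pow_left₀ (abs_nonneg _) h2 2
  have hvg : ∑ n ∈ Finset.range N, v j n * nemCoeff N f y n ≤
      -c * (∫ x, sineSum N (v j) x ^ 4 ∂leb) + D * (1 + z ^ 4) := by
    rw [← integral_sineSum_mul_nem N hf]
    have e : -c * (∫ x, sineSum N (v j) x ^ 4 ∂leb) + D * (1 + z ^ 4) =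
        ∫ x, (-c * sineSum N (v j) x ^ 4 + D * (1 + z ^ 4)) ∂leb := by
      rw [integral_add (integrable_leb_of_continuous (by fun_prop)) (integrable_const _),
        integral_const_mul]
      simp
    rw [e]
    refine integral_leb_mono (hv4.mul (hf.comp (continuous_sineSum N y))) (by fun_prop)
      fun x hx => ?_
    rw [hy, sineSum_add]
    refine (hdis _ _).trans ?_
    have : sineSum N (Z j) x ^ 4 ≤ z ^ 4 := by
      rw [← Even.pow_abs (by decide : Even 4)]
      exact pow_le_pow_left₀ (abs_nonneg _) ((TamedAllenCahn.abs_sineSum_le hx).trans hZ) 4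
    gcongr
  have hθ0 : 0 < θ := taming_pos hτ N f y
  have hθ1 : θ ≤ 1 := taming_le_one hτ N f y
  have hθ2 : (1 + τ * (2 * A * ρ))⁻¹ ≤ θ := by
    -- Dissipation is useful only if taming does not switch it off; the bound `ρ` on the cube of the
    -- state gives the lower bound for the taming factor.
    rw [hθ, taming]
    gcongr
    exact Real.sqrt_le_iff.2 ⟨by positivity, hg2⟩
  have hstep : ∑ n ∈ Finset.range N, v (j + 1) n ^ 2 ≤ ∑ n ∈ Finset.range N, v j n ^ 2
      + 2 * τ * (θ * ∑ n ∈ Finset.range N, v j n * nemCoeff N f y n)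
      + 2 * τ ^ 2 * (θ ^ 2 * ∑ n ∈ Finset.range N, nemCoeff N f y n ^ 2) := by
    simp only [Finset.mul_sum, ← Finset.sum_add_distrib]
    refine Finset.sum_le_sum fun n _ => ?_
    rw [h.succ]
    refine (mode_energy (eigval_pos n) hτ _ _).trans_eq ?_
    ring
  have h1 : θ * ∑ n ∈ Finset.range N, v j n * nemCoeff N f y n ≤
      -(c * (1 + τ * (2 * A * ρ))⁻¹ * ∫ x, sineSum N (v j) x ^ 4 ∂leb) + D * (1 + z ^ 4) := by
    refine (mul_le_mul_of_nonneg_left hvg hθ0.le).trans ?_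
    have i1 := mul_le_mul_of_nonneg_right hθ2
      (mul_nonneg hc.le hI)
    have i2 : θ * (D * (1 + z ^ 4)) ≤ 1 * (D * (1 + z ^ 4)) := by gcongr
    nlinarith
  have h2 : θ ^ 2 * ∑ n ∈ Finset.range N, nemCoeff N f y n ^ 2 ≤ 1 * (2 * A * ρ) ^ 2 :=
    mul_le_mul (pow_le_one₀ hθ0.le hθ1) hg2 (Finset.sum_nonneg fun _ _ => sq_nonneg _) zero_le_one
  have h3 := mul_le_mul_of_nonneg_left h1 (by positivity : 0 ≤ 2 * τ)
  have h4 := mul_le_mul_of_nonneg_left h2 (by positivity : 0 ≤ 2 * τ ^ 2)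
  linarith

lemma IsDriftPart.energy {c D A ρ : ℝ} {z : ℕ → ℝ} (h : IsDriftPart τ N f Z v) (hτ : 0 < τ)
    (hf : Continuous f) (hc : 0 < c) (hD : 0 ≤ D) (hA : 0 ≤ A)
    (hfA : ∀ u, |f u| ≤ A * (1 + |u| ^ 3))
    (hdis : ∀ v z, v * f (v + z) ≤ -c * v ^ 4 + D * (1 + z ^ 4))
    (hρ : 1 ≤ ρ) (m : ℕ) (hZ : ∀ j < m, sineNorm N (Z j) ≤ z j)
    (hR : ∀ j < m, sineNorm N (v j + Z j) ^ 3 ≤ ρ) :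
    ∑ n ∈ Finset.range N, v m n ^ 2 + 2 * c * (1 + τ * (2 * A * ρ))⁻¹ *
        ∑ j ∈ Finset.range m, τ * ∫ x, sineSum N (v j) x ^ 4 ∂leb ≤
      ∑ j ∈ Finset.range m, (2 * D * τ * (1 + z j ^ 4) + 2 * τ ^ 2 * (2 * A * ρ) ^ 2) := by
  induction m with
  | zero => simp [h.zero]
  | succ m ih =>
    have ih' := ih (fun j hj => hZ j (by omega)) (fun j hj => hR j (by omega))
    have hs := h.energy_step hτ hf hc hD hA hfA hdis hρ (hZ m (by omega)) (hR m (by omega))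
    rw [Finset.sum_range_succ, Finset.sum_range_succ, mul_add]
    linarith

end

/-! ### From the energy to the supremum norm: the bootstrap. -/

section

variable {τ : ℝ} {N : ℕ} {f : ℝ → ℝ} {Z v : ℕ → ℕ → ℝ}

lemma abs_add_pow_three_le (a b : ℝ) : |a + b| ^ 3 ≤ 4 * (|a| ^ 3 + |b| ^ 3) := by
  have h := pow_le_pow_left₀ (abs_nonneg _) (abs_add_le a b) 3
  refine h.trans ?_
  have ha := abs_nonneg a
  have hb := abs_nonneg b
  nlinarith [mul_nonneg (add_nonneg ha hb) (sq_nonneg (|a| - |b|))]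

/-- The contribution of one time step to the supremum norm of the drift part. -/
lemma step_le {A b σ z : ℝ} (hf : Continuous f) (hA : 0 ≤ A)
    (hfA : ∀ u, |f u| ≤ A * (1 + |u| ^ 3)) (hb : 0 < b) (hσ : 0 ≤ σ) {v Z : ℕ → ℝ}
    (hZ : sineNorm N Z ≤ z) (hv : sineNorm N v ≤ σ ^ 2) :
    (∫ x, |f (sineSum N (v + Z) x)| ∂leb) * (b ^ 2)⁻¹ ≤
      4 * A * (1 + 2 * (b ^ 3)⁻¹ + z ^ 9 + ∫ x, sineSum N v x ^ 4 ∂leb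
        + σ * (b ^ 3)⁻¹ * ∑ n ∈ Finset.range N, v n ^ 2) := by
  have hz0 : 0 ≤ z := (sineNorm_nonneg _ _).trans hZ
  rw [← integral_mul_const, ← integral_sineSum_sq]
  have e : (4 * A * (1 + 2 * (b ^ 3)⁻¹ + z ^ 9 + ∫ x, sineSum N v x ^ 4 ∂leb
        + σ * (b ^ 3)⁻¹ * ∫ x, sineSum N v x ^ 2 ∂leb)) =
      ∫ x, 4 * A * (1 + 2 * (b ^ 3)⁻¹ + z ^ 9 + sineSum N v x ^ 4
        + σ * (b ^ 3)⁻¹ * sineSum N v x ^ 2) ∂leb := by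
    rw [integral_const_mul (4 * A), integral_add (integrable_leb_of_continuous (by fun_prop))
      (integrable_leb_of_continuous (by fun_prop)), integral_add (integrable_const _)
      (integrable_leb_of_continuous (by fun_prop)), integral_const_mul]
    simp
  rw [e]
  refine integral_leb_mono (by fun_prop) (by fun_prop) fun x hx => ?_
  set p := sineSum N v x
  set q := sineSum N Z x
  have hp : |p| ≤ σ ^ 2 := (abs_sineSum_le hx).trans hv
  have hq : |q| ^ 3 ≤ z ^ 3 := pow_le_pow_left₀ (abs_nonneg _) ((abs_sineSum_le hx).trans hZ) 3
  have hi : 0 < b⁻¹ := inv_pos.2 hb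
  -- All three inequalities are used with `b⁻¹`, where `b` stands for `t^{1/4}`.
  have h1 := weighted_cube_le hi.le hσ hp
  have h2 := sq_mul_cube_le hi.le hz0
  have h3 := sq_mul_cube_le hi.le zero_le_one
  rw [sineSum_add]
  have h4 : |f (p + q)| ≤ A * (1 + 4 * (|p| ^ 3 + z ^ 3)) := by
    refine (hfA _).trans (mul_le_mul_of_nonneg_left ?_ hA)
    have := abs_add_pow_three_le p q
    linarith
  simp only [← inv_pow]
  have h5 : |f (p + q)| * b⁻¹ ^ 2 ≤ A * (1 + 4 * (|p| ^ 3 + z ^ 3)) * b⁻¹ ^ 2 := by gcongr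
  refine h5.trans ?_
  have e2 : A * (1 + 4 * (|p| ^ 3 + z ^ 3)) * b⁻¹ ^ 2 =
      A * (b⁻¹ ^ 2 + 4 * (b⁻¹ ^ 2 * |p| ^ 3) + 4 * (b⁻¹ ^ 2 * z ^ 3)) := by ring
  have e3 : ∀ y : ℝ, 4 * A * y = A * (4 * y) := fun y => by ring
  rw [e2, e3]
  refine mul_le_mul_of_nonneg_left ?_ hA
  have : 0 < b⁻¹ ^ 3 := by positivity
  linarith

/-- The level `M^{1/6}` is what the cubic growth permits: then `‖F_N‖² = O(M)`, so the quadratic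
error per step is `O(τ² M) = O(τ)`, and its sum stays bounded. -/
lemma IsDriftPart.energy_le {T c D A Q : ℝ} {M m : ℕ} (hT : 0 < T) (hM : 1 ≤ M)
    (h : IsDriftPart (T / M) N f Z v)
    (hf : Continuous f) (hc : 0 < c) (hD : 0 ≤ D) (hA : 0 ≤ A)
    (hfA : ∀ u, |f u| ≤ A * (1 + |u| ^ 3))
    (hdis : ∀ v z, v * f (v + z) ≤ -c * v ^ 4 + D * (1 + z ^ 4))
    (hm : m ≤ M) (hR : ∀ j < m, sineNorm N (v j + Z j) ^ 6 ≤ M) (hQ1 : 1 ≤ Q)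
    (hQ : T / M * ∑ j ∈ Finset.range m, sineNorm N (Z j) ^ 9 ≤ Q - 1) :
    ∑ n ∈ Finset.range N, v m n ^ 2 + 2 * c * (1 + 2 * A * T)⁻¹ *
      ∑ j ∈ Finset.range m, T / M * ∫ x, sineSum N (v j) x ^ 4 ∂leb ≤
        (2 * D * (2 * T + 1) + 8 * A ^ 2 * T ^ 2) * Q := by
  have hM0 : (0 : ℝ) < M := by exact_mod_cast hM
  have hM1 : (1 : ℝ) ≤ M := by exact_mod_cast hM
  have hτM : M * (T / M) = T := by field_simp
  have hτ : 0 < T / M := by positivity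
  generalize T / M = τ at *
  have hmT : m * τ ≤ T := by
    rw [← hτM]
    exact mul_le_mul_of_nonneg_right (by exact_mod_cast hm) hτ.le
  -- The energy estimate is applied with `ρ = √M`. Its square enters the quadratic error, whereas
  -- the taming factor only needs `ρ ≤ M`.
  have hρ : 1 ≤ √(M : ℝ) := Real.one_le_sqrt.2 hM1
  have hρ2 : √(M : ℝ) ^ 2 = M := Real.sq_sqrt hM0.le
  have hρM : √(M : ℝ) ≤ M := by nlinarith
  have hR3 : ∀ j < m, sineNorm N (v j + Z j) ^ 3 ≤ √(M : ℝ) := fun j hj =>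
    Real.le_sqrt_of_sq_le (by rw [← pow_mul]; exact hR j hj)
  have e := h.energy (z := fun j => sineNorm N (Z j)) hτ hf hc hD hA hfA hdis hρ m
    (fun j _ => le_rfl) hR3
  have hI : 0 ≤ ∑ j ∈ Finset.range m, τ * ∫ x, sineSum N (v j) x ^ 4 ∂leb :=
    Finset.sum_nonneg fun j _ => mul_nonneg hτ.le (integral_nonneg fun x => by positivity)
  have h1 : (1 + 2 * A * T)⁻¹ ≤ (1 + τ * (2 * A * √(M : ℝ)))⁻¹ := by
    refine inv_anti₀ (by positivity) (add_le_add le_rfl ?_)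
    calc τ * (2 * A * √(M : ℝ)) ≤ τ * (2 * A * M) := by gcongr
      _ = 2 * A * (M * τ) := by ring
      _ = 2 * A * T := by rw [hτM]
  have h2 : 2 * c * (1 + 2 * A * T)⁻¹ *
        ∑ j ∈ Finset.range m, τ * ∫ x, sineSum N (v j) x ^ 4 ∂leb ≤
      2 * c * (1 + τ * (2 * A * √(M : ℝ)))⁻¹ *
        ∑ j ∈ Finset.range m, τ * ∫ x, sineSum N (v j) x ^ 4 ∂leb := by gcongr
  have h3 : ∑ j ∈ Finset.range m,
      (2 * D * τ * (1 + sineNorm N (Z j) ^ 4) + 2 * τ ^ 2 * (2 * A * √(M : ℝ)) ^ 2) ≤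
      ∑ j ∈ Finset.range m, (2 * D * τ * (2 + sineNorm N (Z j) ^ 9)
        + 8 * A ^ 2 * (M * τ) * τ) := by
    refine Finset.sum_le_sum fun j _ => add_le_add ?_ (le_of_eq ?_)
    · have hz0 := sineNorm_nonneg N (Z j)
      have hz4 : sineNorm N (Z j) ^ 4 ≤ 1 + sineNorm N (Z j) ^ 9 := by
        rcases le_total (sineNorm N (Z j)) 1 with h' | h'
        · have := pow_le_one₀ (n := 4) hz0 h'
          have := pow_nonneg hz0 9
          linarith
        · have := pow_le_pow_right₀ h' (show 4 ≤ 9 by norm_num)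
          linarith
      exact mul_le_mul_of_nonneg_left (by linarith) (by positivity)
    · rw [mul_pow, hρ2]; ring
  have h4 : ∑ j ∈ Finset.range m, (2 * D * τ * (2 + sineNorm N (Z j) ^ 9)
        + 8 * A ^ 2 * (M * τ) * τ) =
      2 * D * (2 * (m * τ) + τ * ∑ j ∈ Finset.range m, sineNorm N (Z j) ^ 9)
        + 8 * A ^ 2 * (M * τ) * (m * τ) := by
    rw [Finset.sum_add_distrib, ← Finset.mul_sum, Finset.sum_add_distrib]
    simp only [Finset.sum_const, Finset.card_range, nsmul_eq_mul]
    ring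
  have h5 : 2 * D * (2 * (m * τ) + τ * ∑ j ∈ Finset.range m, sineNorm N (Z j) ^ 9)
      + 8 * A ^ 2 * (M * τ) * (m * τ) ≤ 2 * D * (2 * T + (Q - 1)) + 8 * A ^ 2 * T * T := by
    rw [hτM]
    gcongr
  have j1 : 0 ≤ D * T * (Q - 1) := by have := sub_nonneg.2 hQ1; positivity
  have j2 : 0 ≤ A ^ 2 * T ^ 2 * (Q - 1) := by have := sub_nonneg.2 hQ1; positivity
  linarith

/-- The induction hypothesis enters linearly through `σ = κ Q`, while the conclusion has `σ²`. The
left side is therefore at most `(C₅ + C₆) κ Q²`, and `κ = C₅ + C₆ + 1` closes the induction. -/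
lemma bootstrap_arith {A T r Q C₃ C₄ κ : ℝ} (hA : 0 ≤ A) (hT : 0 ≤ T) (hr : 0 ≤ r) (hQ : 1 ≤ Q)
    (hC₃ : 0 ≤ C₃) (hC₄ : 0 ≤ C₄)
    (hκ : κ = 16 * A * (T + 8 * r + 1 + C₄) + 16 * A * (4 * r * C₃) + 1) :
    16 * A * (T + 2 * (4 * r) + (Q - 1) + C₄ * Q + (κ * Q) * (C₃ * Q) * (4 * r)) ≤
      κ ^ 2 * Q ^ 2 := by
  obtain ⟨C₅, hC₅⟩ : ∃ x, x = 16 * A * (T + 8 * r + 1 + C₄) := ⟨_, rfl⟩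
  obtain ⟨C₆, hC₆⟩ : ∃ x, x = 16 * A * (4 * r * C₃) := ⟨_, rfl⟩
  have hC₅0 : 0 ≤ C₅ := by rw [hC₅]; positivity
  have hC₆0 : 0 ≤ C₆ := by rw [hC₆]; positivity
  rw [← hC₅, ← hC₆] at hκ
  have hκ1 : 1 ≤ κ := by linarith
  have hA16 : 0 ≤ 16 * A := by positivity
  have i1 : 16 * A * (T + 2 * (4 * r) + (Q - 1) + C₄ * Q) ≤ C₅ * Q := by
    rw [hC₅, mul_assoc (16 * A)]
    refine mul_le_mul_of_nonneg_left ?_ hA16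
    have h1 := mul_nonneg hT (sub_nonneg.2 hQ)
    have h2 := mul_nonneg hr (sub_nonneg.2 hQ)
    linarith
  have i2 : 16 * A * ((κ * Q) * (C₃ * Q) * (4 * r)) = C₆ * κ * Q ^ 2 := by
    rw [hC₆]; ring
  have i3 : C₅ * Q ≤ C₅ * κ * Q ^ 2 := by
    have h1 : 1 * 1 ≤ κ * Q := mul_le_mul hκ1 hQ zero_le_one (by linarith)
    have h2 : 1 * (C₅ * Q) ≤ κ * Q * (C₅ * Q) :=
      mul_le_mul_of_nonneg_right (by linarith) (by positivity)
    linarith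
  have i4 : (C₅ + C₆) * κ * Q ^ 2 ≤ κ ^ 2 * Q ^ 2 := by
    refine mul_le_mul_of_nonneg_right ?_ (sq_nonneg Q)
    rw [sq]
    exact mul_le_mul_of_nonneg_right (by linarith) (by linarith)
  rw [mul_add, i2]
  linarith

/-- On the event that the scheme has stayed moderate, the drift part is controlled by the
perturbation. -/
lemma exists_drift_bound_of_moderate {T c D A : ℝ} (hT : 0 < T)
    (hf : Continuous f) (hc : 0 < c) (hD : 0 ≤ D) (hA : 0 ≤ A)
    (hfA : ∀ u, |f u| ≤ A * (1 + |u| ^ 3))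
    (hdis : ∀ v z, v * f (v + z) ≤ -c * v ^ 4 + D * (1 + z ^ 4)) :
    ∃ K, 0 ≤ K ∧ ∀ (M N : ℕ) (Z v : ℕ → ℕ → ℝ), 1 ≤ M → IsDriftPart (T / M) N f Z v →
      ∀ m ≤ M, (∀ j < m, sineNorm N (v j + Z j) ^ 6 ≤ M) →
      sineNorm N (v m) ≤
        K * (1 + T / M * ∑ j ∈ Finset.range M, sineNorm N (Z j) ^ 9) ^ 2 := by
  obtain ⟨C₃, hC₃⟩ : ∃ x, x = 2 * D * (2 * T + 1) + 8 * A ^ 2 * T ^ 2 := ⟨_, rfl⟩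
  obtain ⟨θ, hθ⟩ : ∃ x, x = (1 + 2 * A * T)⁻¹ := ⟨_, rfl⟩
  have hθ0 : 0 < θ := by rw [hθ]; positivity
  have hC₃0 : 0 ≤ C₃ := by rw [hC₃]; positivity
  obtain ⟨C₄, hC₄⟩ : ∃ x, x = C₃ / (2 * c * θ) := ⟨_, rfl⟩
  have hC₄0 : 0 ≤ C₄ := by rw [hC₄]; positivity
  obtain ⟨κ, hκ⟩ : ∃ x, x = 16 * A * (T + 8 * √√T + 1 + C₄) + 16 * A * (4 * √√T * C₃) + 1 :=
    ⟨_, rfl⟩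
  have hκ0 : 0 ≤ κ := by rw [hκ]; positivity
  refine ⟨κ ^ 2, by positivity, fun M N Z v hM h m hm hR => ?_⟩
  have hM0 : (0 : ℝ) < M := by exact_mod_cast hM
  have hτM : M * (T / M) = T := by field_simp
  have hτ : 0 < T / M := by positivity
  obtain ⟨Q, hQ⟩ : ∃ x, x = 1 + T / M * ∑ j ∈ Finset.range M, sineNorm N (Z j) ^ 9 := ⟨_, rfl⟩
  rw [← hQ]
  have hsum : ∀ k ≤ M, T / M * ∑ j ∈ Finset.range k, sineNorm N (Z j) ^ 9 ≤ Q - 1 := fun k hk => by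
    rw [hQ, add_sub_cancel_left]
    exact mul_le_mul_of_nonneg_left (Finset.sum_le_sum_of_subset_of_nonneg
      (Finset.range_mono hk) fun j _ _ => pow_nonneg (sineNorm_nonneg _ _) 9) hτ.le
  have hQ1 : 1 ≤ Q := by
    have := hsum 0 (Nat.zero_le _)
    rw [Finset.sum_range_zero, mul_zero] at this
    linarith
  have hkT : ∀ k ≤ M, (k : ℝ) * (T / M) ≤ T := fun k hk => by
    calc (k : ℝ) * (T / M) ≤ M * (T / M) :=
          mul_le_mul_of_nonneg_right (by exact_mod_cast hk) hτ.le
      _ = T := hτM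
  have hI0 : ∀ j, 0 ≤ ∫ x, sineSum N (v j) x ^ 4 ∂leb := fun j =>
    integral_nonneg fun x => by positivity
  have hen : ∀ k ≤ m, ∑ n ∈ Finset.range N, v k n ^ 2 + 2 * c * θ *
      ∑ j ∈ Finset.range k, T / M * ∫ x, sineSum N (v j) x ^ 4 ∂leb ≤ C₃ * Q := fun k hk => by
    rw [hθ, hC₃]
    exact h.energy_le hT hM hf hc hD hA hfA hdis (hk.trans hm) (fun j hj => hR j (by omega)) hQ1
      (hsum k (hk.trans hm))
  generalize T / (M : ℝ) = τ at *
  have he : ∀ k ≤ m, ∑ n ∈ Finset.range N, v k n ^ 2 ≤ C₃ * Q := fun k hk => by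
    have h1 := hen k hk
    have : 0 ≤ 2 * c * θ * ∑ j ∈ Finset.range k, τ * ∫ x, sineSum N (v j) x ^ 4 ∂leb :=
      mul_nonneg (by positivity) (Finset.sum_nonneg fun j _ => mul_nonneg hτ.le (hI0 j))
    linarith
  have h4 : ∀ k ≤ m, ∑ j ∈ Finset.range k, τ * ∫ x, sineSum N (v j) x ^ 4 ∂leb ≤ C₄ * Q :=
    fun k hk => by
    have h1 := hen k hk
    have : 0 ≤ ∑ n ∈ Finset.range N, v k n ^ 2 := Finset.sum_nonneg fun n _ => sq_nonneg _
    rw [hC₄, div_mul_eq_mul_div, le_div_iff₀ (by positivity)]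
    linarith
  -- Strong induction in time: Duhamel's formula at step `k` involves only `v j` with `j < k`, where
  -- `σ = κ Q` is available. The constant `κ` does not deteriorate with `k`.
  suffices main : ∀ k ≤ m, sineNorm N (v k) ≤ κ ^ 2 * Q ^ 2 from main m le_rfl
  intro k
  induction k using Nat.strong_induction_on with
  | _ k ih =>
    intro hk
    refine sineNorm_le (by positivity) fun x _ => ?_
    have hκQ : 0 ≤ κ * Q := by positivity
    refine (h.abs_sineSum_le hτ k
      (b := fun j => √2 * ∫ x, |f (sineSum N (v j + Z j) x)| ∂leb) (fun j _ n _ => ?_)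
      (fun j _ => mul_nonneg (Real.sqrt_nonneg 2) (integral_nonneg fun x => abs_nonneg _))
      x).trans ?_
    · rw [abs_mul, abs_of_pos (taming_pos hτ _ _ _)]
      exact (mul_le_of_le_one_left (abs_nonneg _) (taming_le_one hτ _ _ _)).trans
        (abs_nemCoeff_le N hf _ n)
    have hterm : ∀ j ∈ Finset.range k,
        √2 * (√2 * (∫ x, |f (sineSum N (v j + Z j) x)| ∂leb)
          * (2 * τ * (rootTime τ (k - 1 - j) ^ 2)⁻¹)) ≤
        16 * A * (τ + 2 * (τ * (rootTime τ (k - 1 - j) ^ 3)⁻¹) + τ * sineNorm N (Z j) ^ 9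
          + τ * ∫ x, sineSum N (v j) x ^ 4 ∂leb
          + (κ * Q) * (C₃ * Q) * (τ * (rootTime τ (k - 1 - j) ^ 3)⁻¹)) := fun j hj => by
      have hj' := Finset.mem_range.1 hj
      have s := step_le hf hA hfA (rootTime_pos hτ (k - 1 - j)) hκQ (le_refl (sineNorm N (Z j)))
        (by rw [mul_pow]; exact ih j hj' (by omega) : sineNorm N (v j) ≤ (κ * Q) ^ 2)
      have hr : 0 ≤ (rootTime τ (k - 1 - j) ^ 3)⁻¹ :=
        inv_nonneg.2 (pow_nonneg (rootTime_pos hτ _).le 3)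
      have s2 : (κ * Q) * (rootTime τ (k - 1 - j) ^ 3)⁻¹ * ∑ n ∈ Finset.range N, v j n ^ 2 ≤
          (κ * Q) * (rootTime τ (k - 1 - j) ^ 3)⁻¹ * (C₃ * Q) :=
        mul_le_mul_of_nonneg_left (he j (by omega)) (by positivity)
      have e1 : √2 * (√2 * (∫ x, |f (sineSum N (v j + Z j) x)| ∂leb)
          * (2 * τ * (rootTime τ (k - 1 - j) ^ 2)⁻¹)) =
          4 * τ * ((∫ x, |f (sineSum N (v j + Z j) x)| ∂leb)
            * (rootTime τ (k - 1 - j) ^ 2)⁻¹) := by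
        linear_combination (2 * τ * (∫ x, |f (sineSum N (v j + Z j) x)| ∂leb)
            * (rootTime τ (k - 1 - j) ^ 2)⁻¹) * Real.mul_self_sqrt (zero_le_two (α := ℝ))
      rw [e1]
      have s3 := mul_le_mul_of_nonneg_left s (by positivity : 0 ≤ 4 * τ)
      have s4 := mul_le_mul_of_nonneg_left s2 (by positivity : 0 ≤ 16 * A * τ)
      linarith
    rw [Finset.mul_sum]
    refine (Finset.sum_le_sum hterm).trans ?_
    rw [← Finset.mul_sum]
    simp only [Finset.sum_add_distrib, ← Finset.mul_sum]
    have b1 : ∑ _j ∈ Finset.range k, τ ≤ T := by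
      simpa using hkT k (hk.trans hm)
    have b2 := sum_rootTime_reflect_le hτ k (hkT k (hk.trans hm))
    rw [← Finset.mul_sum] at b2
    have b3 := hsum k (hk.trans hm)
    have b4 := h4 k hk
    rw [← Finset.mul_sum] at b4
    have b5 := mul_le_mul_of_nonneg_left b2 (by positivity : 0 ≤ (κ * Q) * (C₃ * Q))
    refine le_trans (mul_le_mul_of_nonneg_left ?_ (by positivity))
      (bootstrap_arith hA hT.le (Real.sqrt_nonneg _) hQ1 hC₃0 hC₄0 hκ)
    linarith

end

/-! ### Removing the moderateness condition at the level of moments. -/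

section

lemma pow_le_one_add_pow {x : ℝ} (hx : 0 ≤ x) {a b : ℕ} (h : a ≤ b) : x ^ a ≤ 1 + x ^ b := by
  rcases le_total x 1 with h' | h'
  · linarith [pow_le_one₀ (n := a) hx h', pow_nonneg hx b]
  · linarith [pow_le_pow_right₀ h' h]

lemma add_pow_le_two_pow {a b : ℝ} (ha : 0 ≤ a) (hb : 0 ≤ b) (n : ℕ) :
    (a + b) ^ n ≤ 2 ^ n * (a ^ n + b ^ n) := by
  refine (add_pow_le ha hb n).trans (mul_le_mul_of_nonneg_right ?_ (by positivity))
  exact pow_le_pow_right₀ one_le_two (Nat.sub_le n 1)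

lemma average_pow_le {M : ℕ} (hM : 1 ≤ M) {x : ℕ → ℝ} (hx : ∀ j, 0 ≤ x j) (n : ℕ) :
    (1 / M * ∑ j ∈ Finset.range M, x j) ^ n ≤ 1 / M * ∑ j ∈ Finset.range M, x j ^ n := by
  have hM0 : (M : ℝ) ≠ 0 := by exact_mod_cast (by omega : M ≠ 0)
  have := Real.pow_arith_mean_le_arith_mean_pow (Finset.range M) (fun _ => 1 / (M : ℝ)) x
    (fun _ _ => by positivity) (by simp [hM0]) (fun j _ => hx j) n
  simpa only [← Finset.mul_sum] using this

/-- The moments of a sequence that is controlled by a perturbation `z` until it exceeds the level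
`M^{1/6}`, and that never exceeds `z` by more than a multiple of `M`, are controlled by those of
`z`. -/
lemma exists_pow_le_of_controlled {K T : ℝ} (hK : 0 ≤ K) (hT : 0 < T) (p : ℕ) :
    ∃ C, 0 ≤ C ∧ ∀ (M : ℕ) (y z : ℕ → ℝ), 1 ≤ M → (∀ j, 0 ≤ y j) → (∀ j, 0 ≤ z j) →
      (∀ m ≤ M, (∀ j < m, y j ^ 6 ≤ M) →
        y m ≤ K * (1 + T / M * ∑ j ∈ Finset.range M, z j ^ 9) ^ 2 + z m) →
      (∀ m ≤ M, y m ≤ K * M + z m) →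
      ∀ m ≤ M, y m ^ p ≤ C * (1 + z m ^ (108 * (p + 1))
        + 1 / M * ∑ j ∈ Finset.range M, z j ^ (108 * (p + 1))) := by
  obtain ⟨q, hq⟩ : ∃ q, q = 6 * (p + 1) := ⟨_, rfl⟩
  -- The factors of the exponent: 9 from the powers inside `Q`, 2 from `Q ^ 2`, and `q = 6 (p + 1)`
  -- from raising `M ≤ y ^ 6` to the power `p + 1`.
  have hL : 108 * (p + 1) = 9 * (2 * q) := by omega
  rw [hL]
  obtain ⟨CQ, hCQ⟩ : ∃ x : ℝ, x = 2 ^ (2 * q) * (1 + T ^ (2 * q)) := ⟨_, rfl⟩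
  have hCQ0 : 0 ≤ CQ := by rw [hCQ]; positivity
  obtain ⟨Cg, hCg⟩ : ∃ x : ℝ, x = 2 ^ q * (K ^ q * CQ + 1) := ⟨_, rfl⟩
  have hCg0 : 0 ≤ Cg := by rw [hCg]; positivity
  refine ⟨(1 + Cg) + 2 ^ p * (K ^ p * Cg + 1), by positivity,
    fun M y z hM hy hz hgood hbad m hm => ?_⟩
  have hM0 : (0 : ℝ) < M := by exact_mod_cast hM
  obtain ⟨S, hS⟩ : ∃ S, S = 1 / M * ∑ j ∈ Finset.range M, z j ^ (9 * (2 * q)) := ⟨_, rfl⟩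
  have hS0 : 0 ≤ S := by
    rw [hS]; exact mul_nonneg (by positivity) (Finset.sum_nonneg fun j _ => pow_nonneg (hz j) _)
  rw [← hS]
  obtain ⟨Q, hQ⟩ : ∃ Q, Q = 1 + T / M * ∑ j ∈ Finset.range M, z j ^ 9 := ⟨_, rfl⟩
  rw [← hQ] at hgood
  have havg : 0 ≤ 1 / (M : ℝ) * ∑ j ∈ Finset.range M, z j ^ 9 :=
    mul_nonneg (by positivity) (Finset.sum_nonneg fun j _ => pow_nonneg (hz j) _)
  have hQ' : Q = 1 + T * (1 / M * ∑ j ∈ Finset.range M, z j ^ 9) := by rw [hQ]; ring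
  have hQ0 : 0 ≤ Q := by rw [hQ']; positivity
  have hQq : Q ^ (2 * q) ≤ CQ * (1 + S) := by
    have h1 : (1 / (M : ℝ) * ∑ j ∈ Finset.range M, z j ^ 9) ^ (2 * q) ≤ S := by
      refine (average_pow_le hM (fun j => pow_nonneg (hz j) 9) (2 * q)).trans_eq ?_
      rw [hS]
      simp only [← pow_mul]
    rw [hQ']
    refine (add_pow_le_two_pow zero_le_one (by positivity) _).trans ?_
    rw [one_pow, mul_pow, hCQ, mul_assoc]
    refine mul_le_mul_of_nonneg_left ?_ (by positivity)
    have h2 := mul_le_mul_of_nonneg_left h1 (by positivity : 0 ≤ T ^ (2 * q))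
    have h3 : 0 ≤ T ^ (2 * q) := by positivity
    nlinarith
  have hzq : ∀ j, z j ^ q ≤ 1 + z j ^ (9 * (2 * q)) := fun j =>
    pow_le_one_add_pow (hz j) (by omega)
  have hg : ∀ j, (K * Q ^ 2 + z j) ^ q ≤ 2 ^ q * (K ^ q * (CQ * (1 + S)) + z j ^ q) := fun j => by
    refine (add_pow_le_two_pow (by positivity) (hz j) _).trans ?_
    rw [mul_pow, ← pow_mul]
    gcongr
  have hg1 : ∀ j, (K * Q ^ 2 + z j) ^ q ≤ Cg * (1 + z j ^ (9 * (2 * q)) + S) := fun j => by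
    refine (hg j).trans ?_
    rw [hCg, mul_assoc]
    refine mul_le_mul_of_nonneg_left ?_ (by positivity)
    have h1 : 0 ≤ K ^ q * CQ := by positivity
    have h2 : 0 ≤ z j ^ (9 * (2 * q)) := pow_nonneg (hz j) _
    nlinarith [hzq j, mul_nonneg h1 h2]
  have hgS : 1 / M * ∑ j ∈ Finset.range M, (K * Q ^ 2 + z j) ^ q ≤ Cg * (1 + S) := by
    have h1 : ∑ j ∈ Finset.range M, (K * Q ^ 2 + z j) ^ q ≤
        ∑ j ∈ Finset.range M, 2 ^ q * (K ^ q * (CQ * (1 + S)) + 1 + z j ^ (9 * (2 * q))) :=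
      Finset.sum_le_sum fun j _ => (hg j).trans (mul_le_mul_of_nonneg_left
        (by linarith [hzq j]) (by positivity))
    have h2 : 1 / M * ∑ j ∈ Finset.range M,
        2 ^ q * (K ^ q * (CQ * (1 + S)) + 1 + z j ^ (9 * (2 * q))) = Cg * (1 + S) := by
      rw [← Finset.mul_sum, Finset.sum_add_distrib, Finset.sum_const, Finset.card_range,
        nsmul_eq_mul, hCg]
      have h3 : ∑ j ∈ Finset.range M, z j ^ (9 * (2 * q)) = M * S := by rw [hS]; field_simp
      rw [h3]
      field_simp
      ring
    rw [← h2]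
    exact mul_le_mul_of_nonneg_left h1 (by positivity)
  have hzm : 0 ≤ z m ^ (9 * (2 * q)) := pow_nonneg (hz m) _
  have hC1 : 0 ≤ 2 ^ p * (K ^ p * Cg + 1) := by positivity
  by_cases hall : ∀ j < m, y j ^ 6 ≤ M
  · have h1 := hgood m hm hall
    have h2 : y m ^ p ≤ 1 + (K * Q ^ 2 + z m) ^ q :=
      (pow_le_pow_left₀ (hy m) h1 p).trans
        (pow_le_one_add_pow (add_nonneg (by positivity) (hz m)) (by omega))
    have h3 := hg1 m
    have h4 : 0 ≤ 2 ^ p * (K ^ p * Cg + 1) * (1 + z m ^ (9 * (2 * q)) + S) := by positivity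
    linarith
  -- At the first index of exceedance the good bound is still valid, since it requires moderateness
  -- only strictly before.
  · have hex : ∃ j, j < m ∧ ¬ y j ^ 6 ≤ M := by push Not at hall ⊢; exact hall
    classical
    obtain ⟨hjm, hj⟩ := Nat.find_spec hex
    have hmin : ∀ i < Nat.find hex, y i ^ 6 ≤ M := fun i hi => by
      by_contra h'
      exact Nat.find_min hex hi ⟨hi.trans hjm, h'⟩
    generalize Nat.find hex = j at *
    have h1 := hgood j (by omega) hmin
    have h2 : (M : ℝ) ≤ (K * Q ^ 2 + z j) ^ 6 :=
      (not_le.1 hj).le.trans (pow_le_pow_left₀ (hy j) h1 6)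
    have h3 : (M : ℝ) ^ (p + 1) ≤ ∑ j ∈ Finset.range M, (K * Q ^ 2 + z j) ^ q := by
      refine le_trans ?_ (Finset.single_le_sum (f := fun j => (K * Q ^ 2 + z j) ^ q)
        (fun i _ => pow_nonneg (add_nonneg (by positivity) (hz i)) _)
        (Finset.mem_range.2 (by omega : j < M)))
      rw [hq, pow_mul]
      exact pow_le_pow_left₀ hM0.le h2 _
    -- The unknown index was absorbed by summing over all `M` steps. The extra power of `M` pays for
    -- turning that sum into an average.
    have h4 : (M : ℝ) ^ p ≤ Cg * (1 + S) := by
      refine le_trans ?_ hgS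
      rw [one_div, inv_mul_eq_div, le_div_iff₀ hM0, ← pow_succ]
      exact h3
    have h5 : y m ^ p ≤ 2 ^ p * (K ^ p * (Cg * (1 + S)) + (1 + z m ^ (9 * (2 * q)))) := by
      refine (pow_le_pow_left₀ (hy m) (hbad m hm) p).trans
        ((add_pow_le_two_pow (by positivity) (hz m) p).trans ?_)
      rw [mul_pow]
      have := pow_le_one_add_pow (hz m) (by omega : p ≤ 9 * (2 * q))
      gcongr
    have h6 : 2 ^ p * (K ^ p * (Cg * (1 + S)) + (1 + z m ^ (9 * (2 * q)))) ≤
        2 ^ p * (K ^ p * Cg + 1) * (1 + z m ^ (9 * (2 * q)) + S) := by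
      rw [mul_assoc]
      refine mul_le_mul_of_nonneg_left ?_ (by positivity)
      have : 0 ≤ K ^ p * Cg * z m ^ (9 * (2 * q)) := by positivity
      linarith
    have h7 : 0 ≤ (1 + Cg) * (1 + z m ^ (9 * (2 * q)) + S) := by positivity
    linarith

end

section

variable {Ω : Type*} {mΩ : MeasurableSpace Ω} {P : Measure Ω}

/-! ### Gaussian sums -/

lemma hasLaw_gaussian_add {X Y : Ω → ℝ} {v w : ℝ} (hv : 0 ≤ v) (hw : 0 ≤ w)
    (hX : HasLaw X (gaussianReal 0 v.toNNReal) P) (hY : HasLaw Y (gaussianReal 0 w.toNNReal) P)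
    (h : IndepFun X Y P) :
    HasLaw (fun ω => X ω + Y ω) (gaussianReal 0 (v + w).toNNReal) P where
  aemeasurable := hX.aemeasurable.add hY.aemeasurable
  map_eq := by
    have := gaussianReal_add_gaussianReal_of_indepFun h hX.map_eq hY.map_eq
    rw [add_zero, ← Real.toNNReal_add hv hw] at this
    exact this

lemma hasLaw_gaussian_const_mul {X : Ω → ℝ} {v : ℝ} (c : ℝ)
    (hX : HasLaw X (gaussianReal 0 v.toNNReal) P) :
    HasLaw (fun ω => c * X ω) (gaussianReal 0 (c ^ 2 * v).toNNReal) P := by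
  have h := gaussianReal_const_mul hX c
  have e : NNReal.mk (c ^ 2) (sq_nonneg _) * v.toNNReal = (c ^ 2 * v).toNNReal := by
    rw [Real.toNNReal_mul (sq_nonneg c)]
    congr 1
    exact (Real.toNNReal_of_nonneg (sq_nonneg c)).symm
  rwa [mul_zero, e] at h

lemma hasLaw_zero_gaussian [IsProbabilityMeasure P] :
    HasLaw (fun _ : Ω => (0 : ℝ)) (gaussianReal 0 (0 : ℝ).toNNReal) P := by
  rw [Real.toNNReal_zero, gaussianReal_zero_var]
  exact hasLaw_dirac_of_ae_eq (ae_of_all _ fun _ => rfl)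

lemma hasLaw_gaussian_sum [IsProbabilityMeasure P] {X : ℕ → Ω → ℝ} {v : ℕ → ℝ}
    (hv : ∀ n, 0 ≤ v n) (hm : ∀ n, Measurable (X n))
    (hX : ∀ n, HasLaw (X n) (gaussianReal 0 (v n).toNNReal) P) (hi : iIndepFun X P) (b : ℕ → ℝ)
    (S : Finset ℕ) :
    HasLaw (fun ω => ∑ n ∈ S, b n * X n ω)
      (gaussianReal 0 (∑ n ∈ S, b n ^ 2 * v n).toNNReal) P := by
  classical
  have hi' : iIndepFun (fun n ω => b n * X n ω) P :=
    hi.comp (fun n x => b n * x) fun n => measurable_id.const_mul _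
  have hm' : ∀ n, Measurable (fun ω => b n * X n ω) := fun n => (hm n).const_mul _
  induction S using Finset.induction_on with
  | empty => simpa using hasLaw_zero_gaussian
  | insert i S hiS ih =>
    have hind : IndepFun (fun ω => ∑ n ∈ S, b n * X n ω) (fun ω => b i * X i ω) P := by
      have := hi'.indepFun_finsetSum_of_notMem hm' hiS
      convert this using 1
      ext ω
      simp
    have := hasLaw_gaussian_add (Finset.sum_nonneg fun n _ => mul_nonneg (sq_nonneg _) (hv n))
      (mul_nonneg (sq_nonneg (b i)) (hv i)) ih (hasLaw_gaussian_const_mul (b i) (hX i)) hind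
    simp only [Finset.sum_insert hiS]
    simpa only [add_comm] using this

/-- The norm of a standard Gaussian random variable in `L^q`. -/
def gaussianMoment (q : ℕ) : ℝ := (eLpNorm id q (gaussianReal 0 1)).toReal

lemma gaussianMoment_nonneg (q : ℕ) : 0 ≤ gaussianMoment q := ENNReal.toReal_nonneg

lemma eLpNorm_le_of_hasLaw_gaussian {X : Ω → ℝ} {v w : ℝ} (hvw : v ≤ w) (q : ℕ)
    (hX : HasLaw X (gaussianReal 0 v.toNNReal) P) :
    eLpNorm X q P ≤ ENNReal.ofReal (√w * gaussianMoment q) := by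
  have hfin : eLpNorm id q (gaussianReal 0 1) ≠ ∞ :=
    (memLp_id_gaussianReal' q (ENNReal.natCast_ne_top q)).eLpNorm_ne_top
  have e0 : eLpNorm id q (gaussianReal 0 1) = ENNReal.ofReal (gaussianMoment q) :=
    (ENNReal.ofReal_toReal hfin).symm
  -- For negative `v` both sides are the Dirac mass at `0`.
  have e1 : gaussianReal 0 v.toNNReal = (gaussianReal 0 1).map (fun x => √v * x) := by
    rw [gaussianReal_map_const_mul, mul_zero, mul_one]
    congr 1
    ext
    rw [Real.coe_toNNReal']
    change _ = √v ^ 2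
    rcases le_total 0 v with h | h
    · rw [Real.sq_sqrt h, max_eq_left h]
    · rw [Real.sqrt_eq_zero_of_nonpos h, max_eq_right h]; simp
  have e2 : eLpNorm X q P = eLpNorm id q (gaussianReal 0 v.toNNReal) := by
    rw [← hX.map_eq, eLpNorm_map_measure aestronglyMeasurable_id hX.aemeasurable]
    rfl
  have e3 : (id ∘ fun x : ℝ => √v * x) = √v • (id : ℝ → ℝ) := by ext; simp
  rw [e2, e1, eLpNorm_map_measure aestronglyMeasurable_id (by fun_prop), e3, eLpNorm_const_smul, e0,
    Real.enorm_eq_ofReal (Real.sqrt_nonneg v), ← ENNReal.ofReal_mul (Real.sqrt_nonneg v)]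
  exact ENNReal.ofReal_le_ofReal (mul_le_mul_of_nonneg_right (Real.sqrt_le_sqrt hvw)
    (gaussianMoment_nonneg q))

/-! ### Integrals of step functions against the Wiener process -/

/-- The integral of a step function on the grid `s`. -/
def stepSum (B : ℝ → Ω → ℝ) (s c : ℕ → ℝ) (L : ℕ) (ω : Ω) : ℝ :=
  ∑ l ∈ Finset.range L, c l * (B (s (l + 1)) ω - B (s l) ω)

variable {T : ℝ} {ℱ : Filtration ℝ mΩ} {B : ℕ → ℝ → Ω → ℝ}

lemma IsCylindricalWiener.measurable (hB : IsCylindricalWiener P T ℱ B) (n : ℕ) {t : ℝ}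
    (h0 : 0 ≤ t) (hT : t ≤ T) : Measurable (B n t) :=
  (hB.adapted n t h0 hT).mono (ℱ.le t) le_rfl

lemma IsCylindricalWiener.measurable_stepSum (hB : IsCylindricalWiener P T ℱ B) (n : ℕ)
    {s : ℕ → ℝ} (c : ℕ → ℝ) {L : ℕ} (h0 : ∀ l ≤ L, 0 ≤ s l) (hT : ∀ l ≤ L, s l ≤ T) :
    Measurable (stepSum (B n) s c L) := by
  unfold stepSum
  refine Finset.measurable_fun_sum _ fun l hl => ?_
  have := Finset.mem_range.1 hl
  exact ((hB.measurable n (h0 _ (by omega)) (hT _ (by omega))).sub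
    (hB.measurable n (h0 _ (by omega)) (hT _ (by omega)))).const_mul _

/-- Induction over the grid: the earlier sum is measurable with respect to the past, of which the
next increment is independent, so the variances add. -/
lemma IsCylindricalWiener.hasLaw_stepSum [IsProbabilityMeasure P]
    (hB : IsCylindricalWiener P T ℱ B) (n : ℕ)
    {s : ℕ → ℝ} (hs : Monotone s) (c : ℕ → ℝ) {L : ℕ} (h0 : 0 ≤ s 0) (hT : s L ≤ T) :
    HasLaw (stepSum (B n) s c L)
      (gaussianReal 0 (∑ l ∈ Finset.range L, c l ^ 2 * (s (l + 1) - s l)).toNNReal) P := by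
  have hs0 : ∀ l, 0 ≤ s l := fun l => h0.trans (hs (Nat.zero_le l))
  induction L with
  | zero =>
    unfold stepSum
    simpa using hasLaw_zero_gaussian
  | succ L ih =>
    have hLT : s L ≤ T := (hs (Nat.le_succ L)).trans hT
    have hmeas : Measurable[ℱ (s L)] (stepSum (B n) s c L) := by
      unfold stepSum
      refine Finset.measurable_fun_sum _ fun l hl => ?_
      have hl' := Finset.mem_range.1 hl
      have h1 : Measurable[ℱ (s L)] (B n (s (l + 1))) :=
        (hB.adapted n _ (hs0 _) ((hs hl').trans hLT)).mono (ℱ.mono (hs hl')) le_rfl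
      have h2 : Measurable[ℱ (s L)] (B n (s l)) :=
        (hB.adapted n _ (hs0 _) ((hs hl'.le).trans hLT)).mono (ℱ.mono (hs hl'.le)) le_rfl
      exact (h1.sub h2).const_mul _
    have hinc := hB.gaussian_increments n (s L) (s (L + 1)) (hs0 L) (hs (Nat.le_succ L)) hT
    have hind : IndepFun (stepSum (B n) s c L)
        (fun ω => c L * (B n (s (L + 1)) ω - B n (s L) ω)) P := by
      have h := (hB.indep_past (s L) (s (L + 1)) (hs0 L) (hs (Nat.le_succ L)) hT).symm
      refine indep_of_indep_of_le_left (indep_of_indep_of_le_right h ?_) hmeas.comap_le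
      have hf : Measurable (fun x : ℕ → ℝ => c L * x n) := (measurable_pi_apply n).const_mul _
      rw [show (fun ω => c L * (B n (s (L + 1)) ω - B n (s L) ω)) =
        (fun x : ℕ → ℝ => c L * x n) ∘ fun ω n => B n (s (L + 1)) ω - B n (s L) ω from rfl,
        ← MeasurableSpace.comap_comp]
      exact MeasurableSpace.comap_mono hf.comap_le
    have := hasLaw_gaussian_add (Finset.sum_nonneg fun l _ => mul_nonneg (sq_nonneg (c l))
      (sub_nonneg.2 (hs (Nat.le_succ l))))
      (mul_nonneg (sq_nonneg (c L)) (sub_nonneg.2 (hs (Nat.le_succ L)))) (ih hLT)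
      (hasLaw_gaussian_const_mul (c L) hinc) hind
    rw [Finset.sum_range_succ]
    convert this using 1
    ext ω
    rw [stepSum, Finset.sum_range_succ, stepSum]

lemma IsCylindricalWiener.iIndepFun_stepSum
    (hB : IsCylindricalWiener P T ℱ B) (s : ℕ → ℝ) (c : ℕ → ℕ → ℝ) {L : ℕ}
    (h0 : ∀ l ≤ L, 0 ≤ s l) (hT : ∀ l ≤ L, s l ≤ T) :
    iIndepFun (fun n => stepSum (B n) s (c n) L) P := by
  have h0T : (0 : ℝ) ≤ T := (h0 0 (Nat.zero_le _)).trans (hT 0 (Nat.zero_le _))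
  -- `Set.projIcc` makes evaluation of a path on `[0, T]` total; on the grid it is the identity.
  have h := hB.indep_family.comp
    (fun n (x : Set.Icc (0 : ℝ) T → ℝ) => ∑ l ∈ Finset.range L,
      c n l * (x (Set.projIcc 0 T h0T (s (l + 1))) - x (Set.projIcc 0 T h0T (s l))))
    (fun n => by fun_prop)
  convert h using 2 with n
  ext ω
  refine Finset.sum_congr rfl fun l hl => ?_
  have hl' := Finset.mem_range.1 hl
  rw [Set.projIcc_of_mem h0T ⟨h0 (l + 1) (by omega), hT (l + 1) (by omega)⟩,
    Set.projIcc_of_mem h0T ⟨h0 l (by omega), hT l (by omega)⟩]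

lemma IsCylindricalWiener.eLpNorm_sum_stepSum_le [IsProbabilityMeasure P]
    (hB : IsCylindricalWiener P T ℱ B) {s : ℕ → ℝ} (hs : Monotone s) (c : ℕ → ℕ → ℝ) {L : ℕ}
    (h0 : 0 ≤ s 0) (hT : s L ≤ T) {w : ℕ → ℝ}
    (hw : ∀ n, ∑ l ∈ Finset.range L, c n l ^ 2 * (s (l + 1) - s l) ≤ w n) (b : ℕ → ℝ)
    (S : Finset ℕ) (q : ℕ) :
    eLpNorm (fun ω => ∑ n ∈ S, b n * stepSum (B n) s (c n) L ω) q P ≤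
      ENNReal.ofReal (√(∑ n ∈ S, b n ^ 2 * w n) * gaussianMoment q) := by
  have hs0 : ∀ l ≤ L, 0 ≤ s l := fun l _ => h0.trans (hs (Nat.zero_le l))
  have hsT : ∀ l ≤ L, s l ≤ T := fun l hl => (hs hl).trans hT
  refine eLpNorm_le_of_hasLaw_gaussian ?_ q (hasLaw_gaussian_sum
    (fun n => Finset.sum_nonneg fun l _ => mul_nonneg (sq_nonneg (c n l))
      (sub_nonneg.2 (hs (Nat.le_succ l))))
    (fun n => hB.measurable_stepSum n (c n) hs0 hsT)
    (fun n => hB.hasLaw_stepSum n hs (c n) h0 hT) (hB.iIndepFun_stepSum s c hs0 hsT) b S)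
  exact Finset.sum_le_sum fun n _ => mul_le_mul_of_nonneg_left (hw n) (sq_nonneg _)

end

/-! ### Existence of the stochastic integral for Lipschitz integrands. -/

section

variable {Ω : Type*} {mΩ : MeasurableSpace Ω} {P : Measure Ω}
variable {T : ℝ} {ℱ : Filtration ℝ mΩ} {B : ℕ → ℝ → Ω → ℝ}

/-- The equidistant grid with starting point `a` and step `h`. -/
def grid (a h : ℝ) (k : ℕ) : ℝ := a + k * h

lemma grid_mono (a : ℝ) {h : ℝ} (hh : 0 ≤ h) : Monotone (grid a h) := fun k l hkl => by
  unfold grid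
  have : (k : ℝ) ≤ l := by exact_mod_cast hkl
  gcongr

/-- The increments inside a coarse cell telescope. In `c (l / J)` the division is that of natural
numbers and picks out the coarse cell. -/
lemma stepSum_refine (B : ℝ → Ω → ℝ) (a h : ℝ) (c : ℕ → ℝ) {J : ℕ} (hJ : 0 < J) (i : ℕ) (ω : Ω) :
    stepSum B (grid a h) c i ω = stepSum B (grid a (h / J)) (fun l => c (l / J)) (i * J) ω := by
  have hJ0 : (J : ℝ) ≠ 0 := by exact_mod_cast hJ.ne'
  induction i with
  | zero => simp [stepSum]
  | succ i ih =>
    rw [stepSum, Finset.sum_range_succ, ← stepSum, ih, Nat.succ_mul, stepSum, stepSum,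
      Finset.sum_range_add]
    congr 1
    have e : ∀ l ∈ Finset.range J, c ((i * J + l) / J) *
        (B (grid a (h / J) (i * J + l + 1)) ω - B (grid a (h / J) (i * J + l)) ω) =
        c i * (B (grid a (h / J) (i * J + (l + 1))) ω - B (grid a (h / J) (i * J + l)) ω) :=
      fun l hl => by
        have : (i * J + l) / J = i := by
          rw [mul_comm, Nat.mul_add_div hJ, Nat.div_eq_of_lt (Finset.mem_range.1 hl), add_zero]
        rw [this, add_assoc]
    rw [Finset.sum_congr rfl e, ← Finset.mul_sum,
      Finset.sum_range_sub (fun l => B (grid a (h / J) (i * J + l)) ω)]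
    have e1 : grid a (h / J) (i * J + J) = grid a h (i + 1) := by
      unfold grid; push_cast; field_simp
    have e2 : grid a (h / J) (i * J + 0) = grid a h i := by
      unfold grid; push_cast; field_simp; ring
    rw [e1, e2]

/-- The approximations of the stochastic integral of `g` over `[a, b]`. -/
def stochSum (B : ℝ → Ω → ℝ) (a b : ℝ) (g : ℝ → ℝ) (K : ℕ) : Ω → ℝ :=
  stepSum B (grid a ((b - a) / (K + 1 : ℕ)))
    (fun k => g (grid a ((b - a) / (K + 1 : ℕ)) k)) (K + 1)

lemma IsCylindricalWiener.eLpNorm_stepSum_le [IsProbabilityMeasure P]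
    (hB : IsCylindricalWiener P T ℱ B) (n : ℕ) {s : ℕ → ℝ} (hs : Monotone s) (c : ℕ → ℝ) {L : ℕ}
    (h0 : 0 ≤ s 0) (hT : s L ≤ T) {δ : ℝ} (hδ : 0 ≤ δ) (hc : ∀ l < L, |c l| ≤ δ) :
    eLpNorm (stepSum (B n) s c L) 2 P ≤
      ENNReal.ofReal (δ * √T * gaussianMoment 2) := by
  have hv : ∑ l ∈ Finset.range L, c l ^ 2 * (s (l + 1) - s l) ≤ δ ^ 2 * T := by
    calc _ ≤ ∑ l ∈ Finset.range L, δ ^ 2 * (s (l + 1) - s l) := by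
          refine Finset.sum_le_sum fun l hl => mul_le_mul_of_nonneg_right ?_
            (sub_nonneg.2 (hs (Nat.le_succ l)))
          rw [← sq_abs]
          exact pow_le_pow_left₀ (abs_nonneg _) (hc l (Finset.mem_range.1 hl)) 2
      _ = δ ^ 2 * (s L - s 0) := by rw [← Finset.mul_sum, Finset.sum_range_sub]
      _ ≤ _ := by gcongr; linarith
  have := eLpNorm_le_of_hasLaw_gaussian hv 2 (hB.hasLaw_stepSum n hs c h0 hT)
  rwa [Real.sqrt_mul (sq_nonneg δ), Real.sqrt_sq hδ] at this

lemma IsCylindricalWiener.memLp_stepSum [IsProbabilityMeasure P]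
    (hB : IsCylindricalWiener P T ℱ B) (n : ℕ) {s : ℕ → ℝ} (hs : Monotone s) (c : ℕ → ℝ) {L : ℕ}
    (h0 : 0 ≤ s 0) (hT : s L ≤ T) : MemLp (stepSum (B n) s c L) 2 P := by
  refine ⟨(hB.hasLaw_stepSum n hs c h0 hT).aemeasurable.aestronglyMeasurable, ?_⟩
  refine (hB.eLpNorm_stepSum_le n hs c h0 hT (δ := ∑ l ∈ Finset.range L, |c l|)
    (Finset.sum_nonneg fun _ _ => abs_nonneg _) fun l hl => ?_).trans_lt ENNReal.ofReal_lt_top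
  exact Finset.single_le_sum (f := fun l => |c l|) (fun _ _ => abs_nonneg _)
    (Finset.mem_range.2 hl)

/-- On the common refinement with `(K + 1) (J + 1)` cells the difference is one step sum, whose
coefficients are small by the Lipschitz bound. -/
lemma IsCylindricalWiener.eLpNorm_stochSum_sub_le [IsProbabilityMeasure P]
    (hB : IsCylindricalWiener P T ℱ B) (n : ℕ) {a b : ℝ} (ha : 0 ≤ a) (hab : a ≤ b) (hb : b ≤ T)
    {g : ℝ → ℝ} {Λ : ℝ} (hΛ : 0 ≤ Λ)
    (hg : ∀ s ∈ Set.Icc a b, ∀ t ∈ Set.Icc a b, |g s - g t| ≤ Λ * |s - t|) (K J : ℕ) :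
    eLpNorm (stochSum (B n) a b g K - stochSum (B n) a b g J) 2 P ≤
      ENNReal.ofReal (Λ * ((b - a) / (K + 1 : ℕ) + (b - a) / (J + 1 : ℕ)) * √T
        * gaussianMoment 2) := by
  have hba := sub_nonneg.2 hab
  set h : ℝ := (b - a) / (K + 1 : ℕ) / (J + 1 : ℕ) with hh
  have hh0 : 0 ≤ h := by positivity
  have hh' : h = (b - a) / (J + 1 : ℕ) / (K + 1 : ℕ) := by rw [hh, div_right_comm]
  -- A fine grid point lies at most one coarse mesh width to the right of the left end point of its
  -- coarse cell. Used for both coarse grids.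
  have hloc : ∀ (I R l : ℕ), (b - a) / (I + 1 : ℕ) / (R + 1 : ℕ) = h → l < (I + 1) * (R + 1) →
      grid a ((b - a) / (I + 1 : ℕ)) (l / (R + 1)) ∈ Set.Icc a b ∧
      grid a h l - (b - a) / (I + 1 : ℕ) ≤ grid a ((b - a) / (I + 1 : ℕ)) (l / (R + 1)) ∧
      grid a ((b - a) / (I + 1 : ℕ)) (l / (R + 1)) ≤ grid a h l := fun I R l hIR hl => by
    have h1 : (0 : ℝ) < (I + 1 : ℕ) := by positivity
    have h2 : (0 : ℝ) < (R + 1 : ℕ) := by positivity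
    have e1 : (b - a) / (I + 1 : ℕ) = (R + 1 : ℕ) * h := by rw [← hIR]; field_simp
    have e2 : b - a = (I + 1 : ℕ) * ((R + 1 : ℕ) * h) := by rw [← e1]; field_simp
    have l1 : ((l / (R + 1) : ℕ) : ℝ) * (R + 1 : ℕ) ≤ l := by
      exact_mod_cast Nat.div_mul_le_self l (R + 1)
    have l2 : (l : ℝ) ≤ ((l / (R + 1) : ℕ) : ℝ) * (R + 1 : ℕ) + (R + 1 : ℕ) := by
      have := Nat.lt_div_mul_add (a := l) (b := R + 1) (Nat.succ_pos R)
      exact_mod_cast this.le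
    have l3 : ((l / (R + 1) : ℕ) : ℝ) ≤ (I + 1 : ℕ) := by
      have : l / (R + 1) < I + 1 := Nat.div_lt_of_lt_mul (by rwa [mul_comm])
      exact_mod_cast this.le
    rw [e1]
    unfold grid
    have m1 := mul_le_mul_of_nonneg_right l1 hh0
    have m2 := mul_le_mul_of_nonneg_right l2 hh0
    have m3 := mul_le_mul_of_nonneg_right l3 (mul_nonneg h2.le hh0)
    refine ⟨⟨?_, ?_⟩, ?_, ?_⟩
    · have : 0 ≤ ((l / (R + 1) : ℕ) : ℝ) * ((R + 1 : ℕ) * h) := by positivity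
      linarith
    · linarith
    · linarith
    · linarith
  have hJ1 : 0 < J + 1 := Nat.succ_pos J
  have hK1 : 0 < K + 1 := Nat.succ_pos K
  have e : stochSum (B n) a b g K - stochSum (B n) a b g J =
      stepSum (B n) (grid a h) (fun l => g (grid a ((b - a) / (K + 1 : ℕ)) (l / (J + 1)))
        - g (grid a ((b - a) / (J + 1 : ℕ)) (l / (K + 1)))) ((K + 1) * (J + 1)) := by
    ext ω
    rw [Pi.sub_apply, stochSum, stochSum, stepSum_refine _ _ _ _ hJ1 (K + 1),
      stepSum_refine (B n) a ((b - a) / (J + 1 : ℕ)) _ hK1 (J + 1),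
      ← hh, ← hh', mul_comm (J + 1) (K + 1)]
    simp only [stepSum, sub_mul, Finset.sum_sub_distrib]
  rw [e]
  have hend : grid a h ((K + 1) * (J + 1)) = b := by
    unfold grid
    rw [hh, Nat.cast_mul]
    have h1 : ((K + 1 : ℕ) : ℝ) ≠ 0 := by positivity
    have h2 : ((J + 1 : ℕ) : ℝ) ≠ 0 := by positivity
    field_simp
    ring
  refine hB.eLpNorm_stepSum_le n (grid_mono a hh0) _ (by simpa [grid] using ha)
    (hend.trans_le hb) (by positivity) fun l hl => ?_
  obtain ⟨p1, p2, p3⟩ := hloc K J l hh.symm hl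
  obtain ⟨q1, q2, q3⟩ := hloc J K l hh'.symm (by rwa [mul_comm])
  refine (hg _ p1 _ q1).trans (mul_le_mul_of_nonneg_left ?_ hΛ)
  have : 0 ≤ (b - a) / (K + 1 : ℕ) := by positivity
  have : 0 ≤ (b - a) / (J + 1 : ℕ) := by positivity
  rw [abs_le]
  constructor <;> linarith

/-- The stochastic integral of a Lipschitz function exists. -/
lemma IsCylindricalWiener.exists_isStochIntegral [IsProbabilityMeasure P]
    (hB : IsCylindricalWiener P T ℱ B) (n : ℕ) {a b : ℝ} (ha : 0 ≤ a) (hab : a ≤ b) (hb : b ≤ T)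
    {g : ℝ → ℝ} {Λ : ℝ} (hΛ : 0 ≤ Λ)
    (hg : ∀ s ∈ Set.Icc a b, ∀ t ∈ Set.Icc a b, |g s - g t| ≤ Λ * |s - t|) :
    ∃ I, IsStochIntegral P (B n) a b g I := by
  have hmem : ∀ K, MemLp (stochSum (B n) a b g K) 2 P := fun K => by
    have hK : ((K + 1 : ℕ) : ℝ) ≠ 0 := by positivity
    refine hB.memLp_stepSum n (grid_mono a (div_nonneg (sub_nonneg.2 hab) (Nat.cast_nonneg _))) _
      (by simpa [grid] using ha) (le_of_eq_of_le ?_ hb)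
    unfold grid
    field_simp
    ring
  have hlim : Tendsto (fun K : ℕ => (b - a) / (K + 1 : ℕ)) atTop (𝓝 0) :=
    (tendsto_const_div_atTop_nhds_zero_nat (b - a)).comp (tendsto_add_atTop_nat 1)
  have hbound : Tendsto (fun p : ℕ × ℕ => ENNReal.ofReal (Λ * ((b - a) / (p.1 + 1 : ℕ)
      + (b - a) / (p.2 + 1 : ℕ)) * √T * gaussianMoment 2)) atTop (𝓝 0) := by
    rw [← prod_atTop_atTop_eq]
    have h := (((hlim.comp tendsto_fst).add (hlim.comp tendsto_snd) :
      Tendsto (fun p : ℕ × ℕ => (b - a) / (p.1 + 1 : ℕ) + (b - a) / (p.2 + 1 : ℕ))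
        (atTop ×ˢ atTop) (𝓝 (0 + 0))).const_mul Λ).mul_const (√T) |>.mul_const (gaussianMoment 2)
    have h' := ENNReal.tendsto_ofReal h
    simpa using h'
  have hcau : CauchySeq fun K => (hmem K).toLp (stochSum (B n) a b g K) := by
    rw [Lp.cauchySeq_Lp_iff_cauchySeq_eLpNorm]
    refine tendsto_of_tendsto_of_tendsto_of_le_of_le tendsto_const_nhds hbound
      (fun _ => zero_le) fun p => ?_
    have e : eLpNorm (⇑((hmem p.1).toLp (stochSum (B n) a b g p.1))
        - ⇑((hmem p.2).toLp (stochSum (B n) a b g p.2))) 2 P =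
        eLpNorm (stochSum (B n) a b g p.1 - stochSum (B n) a b g p.2) 2 P :=
      eLpNorm_congr_ae ((hmem p.1).coeFn_toLp.sub (hmem p.2).coeFn_toLp)
    simp only
    rw [e]
    exact hB.eLpNorm_stochSum_sub_le n ha hab hb hΛ hg p.1 p.2
  obtain ⟨I, hI⟩ := cauchySeq_tendsto_of_complete hcau
  refine ⟨I, Lp.memLp I, ?_⟩
  have h := (Lp.tendsto_Lp_iff_tendsto_eLpNorm' _ I).1 hI
  refine h.congr fun K => ?_
  exact eLpNorm_congr_ae ((hmem K).coeFn_toLp.sub (EventuallyEq.refl _ _))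

lemma stochIntegral_spec {B : ℝ → Ω → ℝ} {a b : ℝ} {g : ℝ → ℝ}
    (h : ∃ I, IsStochIntegral P B a b g I) :
    IsStochIntegral P B a b g (stochIntegral P B a b g) := by
  rw [stochIntegral, dif_pos h]
  exact h.choose_spec

end

/-! ### The supremum norm of a random sine series. -/

section

variable {Ω : Type*} {mΩ : MeasurableSpace Ω} {P : Measure Ω}

/-- The derivative of `∑_{n < N} y_n e_n`. -/
def sineDeriv (N : ℕ) (y : ℕ → ℝ) (x : ℝ) : ℝ :=
  ∑ n ∈ Finset.range N, y n * (√2 * (Real.cos (((n : ℝ) + 1) * Real.pi * x)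
    * (((n : ℝ) + 1) * Real.pi)))

@[fun_prop]
lemma continuous_sineDeriv (N : ℕ) (y : ℕ → ℝ) : Continuous (sineDeriv N y) := by
  unfold sineDeriv; fun_prop

lemma hasDerivAt_sineSum (N : ℕ) (y : ℕ → ℝ) (x : ℝ) :
    HasDerivAt (sineSum N y) (sineDeriv N y x) x := by
  refine HasDerivAt.fun_sum fun n _ => HasDerivAt.const_mul _ ?_
  have h1 : HasDerivAt (fun z : ℝ => ((n : ℝ) + 1) * Real.pi * z)
      (((n : ℝ) + 1) * Real.pi) x := by
    simpa using (hasDerivAt_id x).const_mul (((n : ℝ) + 1) * Real.pi)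
  exact (h1.sin).const_mul √2

/-- A one-dimensional Sobolev inequality: `s(x)^q` is the integral of its derivative because `s(0) =
0`. The free parameter `κ` balances the function against its derivative and is later taken as the
frequency of the block. -/
lemma sineNorm_pow_le (N : ℕ) (y : ℕ → ℝ) {q : ℕ} (hq : q ≠ 0) (hqe : Even q) {κ : ℝ} (hκ : 0 < κ) :
    sineNorm N y ^ q ≤
      q * κ * ∫ x, (|sineSum N y x| ^ q + |κ⁻¹ * sineDeriv N y x| ^ q) ∂leb := by
  have hI : 0 ≤ q * κ * ∫ x, (|sineSum N y x| ^ q + |κ⁻¹ * sineDeriv N y x| ^ q) ∂leb :=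
    mul_nonneg (by positivity) (integral_nonneg fun x => by positivity)
  suffices h : sineNorm N y ≤
      (q * κ * ∫ x, (|sineSum N y x| ^ q + |κ⁻¹ * sineDeriv N y x| ^ q) ∂leb) ^ (1 / q : ℝ) by
    refine (pow_le_pow_left₀ (sineNorm_nonneg N y) h q).trans_eq ?_
    rw [one_div, Real.rpow_inv_natCast_pow hI hq]
  refine sineNorm_le (Real.rpow_nonneg hI _) fun x hx => ?_
  refine le_of_pow_le_pow_left₀ hq (Real.rpow_nonneg hI _) ?_
  rw [one_div, Real.rpow_inv_natCast_pow hI hq, hqe.pow_abs]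
  set G : ℝ → ℝ := fun t => q * sineSum N y t ^ (q - 1) * sineDeriv N y t with hG
  have hGc : Continuous G := by rw [hG]; fun_prop
  have hftc := intervalIntegral.integral_eq_sub_of_hasDerivAt (a := 0) (b := x)
    (f := fun t => sineSum N y t ^ q) (f' := G) (fun t _ => (hasDerivAt_sineSum N y t).pow q)
    (hGc.intervalIntegrable _ _)
  have h0 : sineSum N y 0 = 0 := by simp [sineSum, eigfun]
  rw [h0, zero_pow hq, sub_zero] at hftc
  rw [← hftc]
  calc ∫ t in (0 : ℝ)..x, G t ≤ ∫ t in (0 : ℝ)..x, |G t| :=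
        intervalIntegral.integral_mono_on hx.1 (hGc.intervalIntegrable _ _)
          (hGc.abs.intervalIntegrable _ _) fun t _ => le_abs_self _
    _ ≤ ∫ t in (0 : ℝ)..1, |G t| :=
        intervalIntegral.integral_mono_interval le_rfl hx.1 hx.2
          (ae_of_all _ fun t => abs_nonneg _) (hGc.abs.intervalIntegrable _ _)
    _ = ∫ t, |G t| ∂leb := (integral_leb _).symm
    _ ≤ ∫ t, q * κ * (|sineSum N y t| ^ q + |κ⁻¹ * sineDeriv N y t| ^ q) ∂leb := by
        refine integral_leb_mono hGc.abs (by fun_prop) fun t _ => ?_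
        obtain ⟨u, hu⟩ : ∃ u, u = |sineSum N y t| := ⟨_, rfl⟩
        obtain ⟨w, hw⟩ : ∃ w, w = |κ⁻¹ * sineDeriv N y t| := ⟨_, rfl⟩
        have hu0 : 0 ≤ u := hu ▸ abs_nonneg _
        have hw0 : 0 ≤ w := hw ▸ abs_nonneg _
        have e : |G t| = q * κ * (u ^ (q - 1) * w) := by
          rw [hG, hu, hw, abs_mul, abs_mul, abs_mul, abs_pow, Nat.abs_cast,
            abs_of_pos (inv_pos.2 hκ)]
          field_simp
        rw [e, ← hu, ← hw]
        refine mul_le_mul_of_nonneg_left ?_ (by positivity)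
        -- The product `u^{q-1} w` is at most the `q`-th power of the larger factor.
        have hq1 : q - 1 + 1 = q := Nat.succ_pred_eq_of_ne_zero hq
        rcases le_total w u with h | h
        · calc u ^ (q - 1) * w ≤ u ^ (q - 1) * u := by gcongr
            _ = u ^ q := by rw [← pow_succ, hq1]
            _ ≤ _ := le_add_of_nonneg_right (by positivity)
        · calc u ^ (q - 1) * w ≤ w ^ (q - 1) * w := by gcongr
            _ = w ^ q := by rw [← pow_succ, hq1]
            _ ≤ _ := le_add_of_nonneg_left (by positivity)
    _ = _ := integral_const_mul _ _

lemma ofReal_sineNorm_pow_le (N : ℕ) (y : ℕ → ℝ) {q : ℕ} (hq : q ≠ 0) (hqe : Even q) {κ : ℝ}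
    (hκ : 0 < κ) :
    ENNReal.ofReal (sineNorm N y) ^ q ≤ ENNReal.ofReal (q * κ) *
      ∫⁻ x, (‖sineSum N y x‖ₑ ^ q + ‖κ⁻¹ * sineDeriv N y x‖ₑ ^ q) ∂leb := by
  rw [← ENNReal.ofReal_pow (sineNorm_nonneg _ _)]
  refine (ENNReal.ofReal_le_ofReal (sineNorm_pow_le N y hq hqe hκ)).trans_eq ?_
  rw [ENNReal.ofReal_mul (by positivity), ofReal_integral_eq_lintegral_ofReal
    (integrable_leb_of_continuous (by fun_prop)) (ae_of_all _ fun x => by positivity)]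
  congr 2
  ext x
  rw [ENNReal.ofReal_add (by positivity) (by positivity), ENNReal.ofReal_pow (abs_nonneg _),
    ENNReal.ofReal_pow (abs_nonneg _), Real.enorm_eq_ofReal_abs, Real.enorm_eq_ofReal_abs]

lemma lintegral_enorm_pow_eq {f : Ω → ℝ} {q : ℕ} (hq : q ≠ 0) :
    ∫⁻ ω, ‖f ω‖ₑ ^ q ∂P = eLpNorm f q P ^ q := by
  rw [eLpNorm_eq_lintegral_rpow_enorm_toReal (by exact_mod_cast hq) (ENNReal.natCast_ne_top q),
    ENNReal.toReal_natCast, ← ENNReal.rpow_natCast _ q, ← ENNReal.rpow_mul,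
    one_div_mul_cancel (by exact_mod_cast hq), ENNReal.rpow_one]
  simp only [ENNReal.rpow_natCast]

/-- The coefficients `y_n` with `2^k ≤ n + 1 < 2^{k+1}`. -/
def dyadicBlock (k : ℕ) (y : ℕ → ℝ) (n : ℕ) : ℝ := if Nat.log 2 (n + 1) = k then y n else 0

lemma sineNorm_le_sum_dyadicBlock (N : ℕ) (y : ℕ → ℝ) :
    sineNorm N y ≤ ∑ k ∈ Finset.range N, sineNorm N (dyadicBlock k y) := by
  refine sineNorm_le (Finset.sum_nonneg fun k _ => sineNorm_nonneg _ _) fun x hx => ?_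
  have e : sineSum N y x = ∑ k ∈ Finset.range N, sineSum N (dyadicBlock k y) x := by
    simp only [sineSum]
    rw [Finset.sum_comm]
    refine Finset.sum_congr rfl fun n hn => ?_
    rw [← Finset.sum_mul]
    congr 1
    have hlog : Nat.log 2 (n + 1) < N :=
      (Nat.lt_succ_iff.1 (Nat.log_lt_self 2 (Nat.succ_ne_zero n))).trans_lt (Finset.mem_range.1 hn)
    simp [dyadicBlock, hlog]
  rw [e]
  exact (Finset.abs_sum_le_sum_abs _ _).trans (Finset.sum_le_sum fun k _ => abs_sineSum_le hx)

/-- The indices below `N` of the `k`-th dyadic block. -/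
def dyadicSet (N k : ℕ) : Finset ℕ := (Finset.range N).filter fun n => Nat.log 2 (n + 1) = k

lemma card_dyadicSet_le (N k : ℕ) : (dyadicSet N k).card ≤ 2 ^ k := by
  have hsub : dyadicSet N k ⊆ Finset.Ico (2 ^ k - 1) (2 ^ k - 1 + 2 ^ k) := fun n hn => by
    have h := (Finset.mem_filter.1 hn).2
    have h1 : 2 ^ k ≤ n + 1 := h ▸ Nat.pow_log_le_self 2 (Nat.succ_ne_zero n)
    have h2 : n + 1 < 2 ^ (k + 1) := h ▸ Nat.lt_pow_succ_log_self one_lt_two (n + 1)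
    have h3 : 1 ≤ 2 ^ k := Nat.one_le_two_pow
    rw [pow_succ] at h2
    rw [Finset.mem_Ico]
    omega
  refine (Finset.card_le_card hsub).trans ?_
  simp

lemma sum_dyadicBlock_mul (N k : ℕ) (y c : ℕ → ℝ) :
    ∑ n ∈ Finset.range N, dyadicBlock k y n * c n = ∑ n ∈ dyadicSet N k, c n * y n := by
  rw [dyadicSet, Finset.sum_filter]
  refine Finset.sum_congr rfl fun n _ => ?_
  rw [dyadicBlock]
  split_ifs
  · ring
  · ring

/-- At most `2^k` modes, each of variance of order `4^{-k}`: the block has variance of order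
`2^{-k}`. -/
lemma sum_dyadicSet_le (N k : ℕ) {b : ℕ → ℝ}
    (hb : ∀ n, Nat.log 2 (n + 1) = k → b n ^ 2 * (eigval n)⁻¹ ≤ 2 / 4 ^ k) :
    ∑ n ∈ dyadicSet N k, b n ^ 2 * (eigval n)⁻¹ ≤ 2 / 2 ^ k := by
  calc _ ≤ ∑ n ∈ dyadicSet N k, (2 / 4 ^ k : ℝ) :=
        Finset.sum_le_sum fun n hn => hb n (Finset.mem_filter.1 hn).2
    _ = (dyadicSet N k).card * (2 / 4 ^ k : ℝ) := by rw [Finset.sum_const, nsmul_eq_mul]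
    _ ≤ 2 ^ k * (2 / 4 ^ k) := by
        refine mul_le_mul_of_nonneg_right ?_ (by positivity)
        exact_mod_cast card_dyadicSet_le N k
    _ = _ := by
        rw [show (4 : ℝ) ^ k = 2 ^ k * 2 ^ k by rw [← mul_pow]; norm_num]
        field_simp

lemma eigfun_sq_div_eigval_le {n k : ℕ} (h : Nat.log 2 (n + 1) = k) (x : ℝ) :
    eigfun n x ^ 2 * (eigval n)⁻¹ ≤ 2 / 4 ^ k := by
  have h1 : (2 : ℝ) ^ k ≤ n + 1 := by
    have : 2 ^ k ≤ n + 1 := h ▸ Nat.pow_log_le_self 2 (Nat.succ_ne_zero n)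
    exact_mod_cast this
  have h2 : eigfun n x ^ 2 ≤ 2 := by
    rw [← sq_abs]
    refine (pow_le_pow_left₀ (abs_nonneg _) (abs_eigfun_le n x) 2).trans_eq ?_
    exact Real.sq_sqrt zero_le_two
  have h3 : (4 : ℝ) ^ k ≤ eigval n := by
    rw [eigval, show (4 : ℝ) ^ k = 1 * (2 ^ k) ^ 2 by
      rw [← pow_mul, mul_comm k 2, pow_mul]; norm_num]
    exact mul_le_mul (by nlinarith [Real.pi_gt_three]) (pow_le_pow_left₀ (by positivity) h1 2)
      (by positivity) (by positivity)
  rw [← div_eq_mul_inv]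
  exact div_le_div₀ zero_le_two h2 (by positivity) h3

lemma eigfun_deriv_sq_div_eigval_le (n k : ℕ) (x : ℝ) :
    (((2 : ℝ) ^ k)⁻¹ * (√2 * (Real.cos (((n : ℝ) + 1) * Real.pi * x)
      * (((n : ℝ) + 1) * Real.pi)))) ^ 2 * (eigval n)⁻¹ ≤ 2 / 4 ^ k := by
  have e : (((2 : ℝ) ^ k)⁻¹ * (√2 * (Real.cos (((n : ℝ) + 1) * Real.pi * x)
      * (((n : ℝ) + 1) * Real.pi)))) ^ 2 * (eigval n)⁻¹ =
      Real.cos (((n : ℝ) + 1) * Real.pi * x) ^ 2 * (2 / 4 ^ k) := by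
    rw [eigval, mul_pow, mul_pow, Real.sq_sqrt zero_le_two,
      show (4 : ℝ) ^ k = (2 ^ k) ^ 2 by rw [← pow_mul, mul_comm k 2, pow_mul]; norm_num]
    field_simp
  rw [e]
  exact mul_le_of_le_one_left (by positivity) (Real.cos_sq_le_one _)

/-- The ratio of the geometric series that bounds the dyadic blocks. -/
def dyadicRatio : ℝ := √√(1 / 2)

lemma dyadicRatio_nonneg : 0 ≤ dyadicRatio := Real.sqrt_nonneg _

lemma dyadicRatio_pow : dyadicRatio ^ 4 = 1 / 2 := by
  rw [dyadicRatio, show 4 = 2 * 2 from rfl, pow_mul, Real.sq_sqrt (Real.sqrt_nonneg _),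
    Real.sq_sqrt (by norm_num)]

lemma dyadicRatio_lt_one : dyadicRatio < 1 := by
  by_contra h
  have := one_le_pow₀ (not_lt.1 h) (n := 4)
  rw [dyadicRatio_pow] at this
  norm_num at this

/-- The constant in the bound of the dyadic blocks. -/
def dyadicConst (i : ℕ) (Γ : ℝ) : ℝ := 1 + 8 * i * 2 ^ (2 * i) * Γ ^ (4 * i)

/-- The Sobolev factor `2^k` competes with `2^{-k/2}` raised to the power `4 i`, that is `2^{-2ik}`.
Since `i ≥ 1` at least `2^{-ik}` remains, whose root of order `4 i` is `2^{-k/4}`. -/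
lemma dyadicConst_bound {i : ℕ} (hi : i ≠ 0) {Γ : ℝ} (hΓ : 0 ≤ Γ) (k : ℕ) :
    (4 * i : ℕ) * 2 ^ k * (2 * (√(2 / 2 ^ k) * Γ) ^ (4 * i)) ≤
      (dyadicConst i Γ * dyadicRatio ^ k) ^ (4 * i) := by
  have e1 : √((2 : ℝ) / 2 ^ k) ^ (4 * i) = 2 ^ (2 * i) * ((1 / 2) ^ k) ^ (2 * i) := by
    rw [show 4 * i = 2 * (2 * i) by ring, pow_mul, Real.sq_sqrt (by positivity), ← mul_pow]
    congr 1
    rw [one_div, inv_pow]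
    rfl
  have e2 : (dyadicRatio ^ k) ^ (4 * i) = ((1 / 2) ^ k) ^ i := by
    rw [← pow_mul, show k * (4 * i) = 4 * (k * i) by ring, pow_mul, dyadicRatio_pow, pow_mul]
  have e3 : (2 : ℝ) ^ k * ((1 / 2) ^ k) ^ (2 * i) ≤ ((1 / 2) ^ k) ^ i := by
    obtain ⟨i, rfl⟩ := Nat.exists_eq_succ_of_ne_zero hi
    have h1 : (2 : ℝ) ^ k * (1 / 2) ^ k = 1 := by rw [← mul_pow]; norm_num
    have h2 : ((1 / 2 : ℝ) ^ k) ^ (2 * (i + 1)) =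
        (1 / 2) ^ k * (((1 / 2) ^ k) ^ i * ((1 / 2) ^ k) ^ (i + 1)) := by ring
    rw [h2, ← mul_assoc, h1, one_mul]
    refine mul_le_of_le_one_left (by positivity) (pow_le_one₀ (by positivity)
      (pow_le_one₀ (by norm_num) (by norm_num)))
  have e4 : 8 * i * 2 ^ (2 * i) * Γ ^ (4 * i) ≤ dyadicConst i Γ ^ (4 * i) := by
    have h1 : 1 ≤ dyadicConst i Γ := by
      rw [dyadicConst]
      have : 0 ≤ 8 * i * 2 ^ (2 * i) * Γ ^ (4 * i) := by positivity
      linarith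
    refine le_trans ?_ (le_self_pow₀ h1 (by omega))
    rw [dyadicConst]
    linarith
  rw [mul_pow, mul_pow, e1, e2]
  push_cast
  calc _ = 8 * i * 2 ^ (2 * i) * Γ ^ (4 * i) * (2 ^ k * ((1 / 2) ^ k) ^ (2 * i)) := by ring
    _ ≤ dyadicConst i Γ ^ (4 * i) * ((1 / 2) ^ k) ^ i :=
      mul_le_mul e4 e3 (by positivity) (le_trans (by positivity) e4)

variable {y : ℕ → Ω → ℝ}

/-- After the Sobolev inequality and Tonelli's theorem only moments at a fixed point `x` remain.
There the block and its rescaled derivative are linear functionals to which `hyp` applies. -/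
lemma eLpNorm_sineNorm_dyadicBlock_le [IsProbabilityMeasure P] (hy : ∀ n, Measurable (y n))
    {i : ℕ} (hi : i ≠ 0) {Γ : ℝ} (hΓ : 0 ≤ Γ)
    (hyp : ∀ (b : ℕ → ℝ) (S : Finset ℕ), eLpNorm (fun ω => ∑ n ∈ S, b n * y n ω) (4 * i : ℕ) P ≤
      ENNReal.ofReal (√(∑ n ∈ S, b n ^ 2 * (eigval n)⁻¹) * Γ)) (N k : ℕ) :
    eLpNorm (fun ω => sineNorm N (dyadicBlock k fun n => y n ω)) (4 * i : ℕ) P ≤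
      ENNReal.ofReal (dyadicConst i Γ * dyadicRatio ^ k) := by
  have hq : 4 * i ≠ 0 := by omega
  have hqe : Even (4 * i) := ⟨2 * i, by ring⟩
  have hκ : (0 : ℝ) < 2 ^ k := by positivity
  have hC : 0 ≤ dyadicConst i Γ * dyadicRatio ^ k :=
    mul_nonneg (by unfold dyadicConst; positivity) (pow_nonneg dyadicRatio_nonneg k)
  rw [← ENNReal.pow_le_pow_left_iff hq, ← lintegral_enorm_pow_eq hq]
  set u : Ω → ℕ → ℝ := fun ω => dyadicBlock k fun n => y n ω with hu
  have hum : ∀ n, Measurable fun ω => u ω n := fun n => by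
    simp only [hu, dyadicBlock]
    split_ifs
    · exact hy n
    · exact measurable_const
  have hmeas : Measurable fun p : Ω × ℝ =>
      ‖sineSum N (u p.1) p.2‖ₑ ^ (4 * i)
        + ‖((2 : ℝ) ^ k)⁻¹ * sineDeriv N (u p.1) p.2‖ₑ ^ (4 * i) := by
    have hp : ∀ n, Measurable fun p : Ω × ℝ => u p.1 n := fun n => (hum n).comp measurable_fst
    have h1 : Measurable fun p : Ω × ℝ => sineSum N (u p.1) p.2 :=
      Finset.measurable_fun_sum _ fun n _ =>
        (hp n).mul ((continuous_eigfun n).measurable.comp measurable_snd)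
    have h2 : Measurable fun p : Ω × ℝ => sineDeriv N (u p.1) p.2 :=
      Finset.measurable_fun_sum _ fun n _ => (hp n).mul (by fun_prop)
    exact (h1.enorm.pow_const _).add ((h2.const_mul _).enorm.pow_const _)
  have hx : ∀ x, ∫⁻ ω, (‖sineSum N (u ω) x‖ₑ ^ (4 * i)
      + ‖((2 : ℝ) ^ k)⁻¹ * sineDeriv N (u ω) x‖ₑ ^ (4 * i)) ∂P ≤
      2 * ENNReal.ofReal (√(2 / 2 ^ k) * Γ) ^ (4 * i) := fun x => by
    have hb : ∀ b : ℕ → ℝ, (∀ n, Nat.log 2 (n + 1) = k → b n ^ 2 * (eigval n)⁻¹ ≤ 2 / 4 ^ k) →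
        ∫⁻ ω, ‖∑ n ∈ dyadicSet N k, b n * y n ω‖ₑ ^ (4 * i) ∂P ≤
          ENNReal.ofReal (√(2 / 2 ^ k) * Γ) ^ (4 * i) := fun b hb => by
      rw [lintegral_enorm_pow_eq hq]
      refine pow_le_pow_left' ((hyp b _).trans (ENNReal.ofReal_le_ofReal ?_)) _
      exact mul_le_mul_of_nonneg_right (Real.sqrt_le_sqrt (sum_dyadicSet_le N k hb)) hΓ
    have e1 : ∀ ω, sineSum N (u ω) x = ∑ n ∈ dyadicSet N k, eigfun n x * y n ω := fun ω =>
      sum_dyadicBlock_mul N k _ _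
    have e2 : ∀ ω, ((2 : ℝ) ^ k)⁻¹ * sineDeriv N (u ω) x = ∑ n ∈ dyadicSet N k,
        (((2 : ℝ) ^ k)⁻¹ * (√2 * (Real.cos (((n : ℝ) + 1) * Real.pi * x)
          * (((n : ℝ) + 1) * Real.pi)))) * y n ω := fun ω => by
      rw [sineDeriv, sum_dyadicBlock_mul, Finset.mul_sum]
      exact Finset.sum_congr rfl fun n _ => by ring
    have hm : Measurable fun ω => ‖sineSum N (u ω) x‖ₑ ^ (4 * i) :=
      (Finset.measurable_fun_sum _ fun n _ => (hum n).mul_const _).enorm.pow_const _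
    rw [lintegral_add_left hm, two_mul]
    simp only [e1, e2]
    exact add_le_add (hb _ fun n hn => eigfun_sq_div_eigval_le hn x)
      (hb _ fun n _ => eigfun_deriv_sq_div_eigval_le n k x)
  calc ∫⁻ ω, ‖sineNorm N (u ω)‖ₑ ^ (4 * i) ∂P
      ≤ ∫⁻ ω, ENNReal.ofReal ((4 * i : ℕ) * 2 ^ k) * ∫⁻ x, (‖sineSum N (u ω) x‖ₑ ^ (4 * i)
          + ‖((2 : ℝ) ^ k)⁻¹ * sineDeriv N (u ω) x‖ₑ ^ (4 * i)) ∂leb ∂P := by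
        refine lintegral_mono fun ω => ?_
        rw [Real.enorm_eq_ofReal (sineNorm_nonneg _ _)]
        exact ofReal_sineNorm_pow_le N (u ω) hq hqe hκ
    _ = ENNReal.ofReal ((4 * i : ℕ) * 2 ^ k) * ∫⁻ x, ∫⁻ ω, (‖sineSum N (u ω) x‖ₑ ^ (4 * i)
          + ‖((2 : ℝ) ^ k)⁻¹ * sineDeriv N (u ω) x‖ₑ ^ (4 * i)) ∂P ∂leb := by
        rw [lintegral_const_mul' _ _ ENNReal.ofReal_ne_top,
          lintegral_lintegral_swap hmeas.aemeasurable]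
    _ ≤ ENNReal.ofReal ((4 * i : ℕ) * 2 ^ k) * ∫⁻ _x,
          2 * ENNReal.ofReal (√(2 / 2 ^ k) * Γ) ^ (4 * i) ∂leb := by
        gcongr with x
        exact hx x
    _ = ENNReal.ofReal ((4 * i : ℕ) * 2 ^ k * (2 * (√(2 / 2 ^ k) * Γ) ^ (4 * i))) := by
        rw [lintegral_const, measure_univ, mul_one,
          ENNReal.ofReal_mul (p := ((4 * i : ℕ) : ℝ) * 2 ^ k) (by positivity),
          ENNReal.ofReal_mul zero_le_two, ENNReal.ofReal_pow (by positivity), ENNReal.ofReal_ofNat]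
    _ ≤ _ := by
        rw [← ENNReal.ofReal_pow hC]
        exact ENNReal.ofReal_le_ofReal (dyadicConst_bound hi hΓ k)

/-- A random sine series whose linear functionals have the moments of Gaussian variables with
variances at most `λ_n⁻¹` has bounded moments of its supremum norm. -/
lemma eLpNorm_sineNorm_le_of_gaussian_bound [IsProbabilityMeasure P] (hy : ∀ n, Measurable (y n))
    {i : ℕ} (hi : i ≠ 0) {Γ : ℝ} (hΓ : 0 ≤ Γ)
    (hyp : ∀ (b : ℕ → ℝ) (S : Finset ℕ), eLpNorm (fun ω => ∑ n ∈ S, b n * y n ω) (4 * i : ℕ) P ≤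
      ENNReal.ofReal (√(∑ n ∈ S, b n ^ 2 * (eigval n)⁻¹) * Γ)) (N : ℕ) :
    eLpNorm (fun ω => sineNorm N fun n => y n ω) (4 * i : ℕ) P ≤
      ENNReal.ofReal (dyadicConst i Γ * (1 - dyadicRatio)⁻¹) := by
  have hC : 0 ≤ dyadicConst i Γ := by unfold dyadicConst; positivity
  have hr := dyadicRatio_nonneg
  have hm : ∀ k, Measurable fun ω => sineNorm N (dyadicBlock k fun n => y n ω) := fun k => by
    refine (continuous_sineNorm N).measurable.comp (measurable_pi_lambda _ fun n => ?_)
    simp only [dyadicBlock]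
    split_ifs
    · exact hy n
    · exact measurable_const
  calc eLpNorm (fun ω => sineNorm N fun n => y n ω) (4 * i : ℕ) P
      ≤ eLpNorm (∑ k ∈ Finset.range N, fun ω => sineNorm N (dyadicBlock k fun n => y n ω))
          (4 * i : ℕ) P := by
        refine eLpNorm_mono_real fun ω => ?_
        rw [Real.norm_of_nonneg (sineNorm_nonneg _ _), Finset.sum_apply]
        exact sineNorm_le_sum_dyadicBlock N _
    _ ≤ ∑ k ∈ Finset.range N,
          eLpNorm (fun ω => sineNorm N (dyadicBlock k fun n => y n ω)) (4 * i : ℕ) P :=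
        eLpNorm_sum_le (fun k _ => (hm k).aestronglyMeasurable) (by exact_mod_cast (by omega))
    _ ≤ ∑ k ∈ Finset.range N, ENNReal.ofReal (dyadicConst i Γ * dyadicRatio ^ k) :=
        Finset.sum_le_sum fun k _ => eLpNorm_sineNorm_dyadicBlock_le hy hi hΓ hyp N k
    _ = ENNReal.ofReal (dyadicConst i Γ * ∑ k ∈ Finset.range N, dyadicRatio ^ k) := by
        rw [Finset.mul_sum, ENNReal.ofReal_sum_of_nonneg fun k _ => by positivity]
    _ ≤ _ := by
        refine ENNReal.ofReal_le_ofReal (mul_le_mul_of_nonneg_left ?_ hC)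
        rw [← tsum_geometric_of_lt_one hr dyadicRatio_lt_one]
        exact (summable_geometric_of_lt_one hr dyadicRatio_lt_one).sum_le_tsum _
          fun k _ => pow_nonneg hr k

end

section

variable {Ω : Type*} {mΩ : MeasurableSpace Ω} {P : Measure Ω}
variable {T : ℝ} {ℱ : Filtration ℝ mΩ} {B : ℕ → ℝ → Ω → ℝ}

/-! ### The linear part of the scheme -/

/-- The coefficients of the scheme without nonlinearity. -/
def linCoeff (τ : ℝ) (ξ : ℕ → ℝ) (η : ℕ → ℕ → ℝ) : ℕ → ℕ → ℝ
  | 0, n => ξ n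
  | m + 1, n => Real.exp (-(τ * eigval n)) * linCoeff τ ξ η m n + η m n

lemma linCoeff_eq_add (τ : ℝ) (ξ : ℕ → ℝ) (η : ℕ → ℕ → ℝ) (m : ℕ) :
    linCoeff τ ξ η m = (fun n => Real.exp (-(τ * eigval n)) ^ m * ξ n) + linCoeff τ 0 η m := by
  induction m with
  | zero => ext n; simp [linCoeff]
  | succ m ih =>
    ext n
    rw [linCoeff, ih, Pi.add_apply, Pi.add_apply, linCoeff, pow_succ]
    ring

lemma isDriftPart_sub (τ : ℝ) (N : ℕ) (f : ℝ → ℝ) (ξ : ℕ → ℝ) (η : ℕ → ℕ → ℝ) :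
    IsDriftPart τ N f (linCoeff τ ξ η)
      fun m => schemeCoeff τ N f ξ η m - linCoeff τ ξ η m where
  zero n := by simp [schemeCoeff, linCoeff]
  succ m n := by
    simp only [sub_add_cancel, Pi.sub_apply]
    rw [schemeCoeff, linCoeff]
    ring

/-! ### The noise -/

/-- The noise increments of the scheme. -/
def noiseIncr (P : Measure Ω) (B : ℕ → ℝ → Ω → ℝ) (τ : ℝ) (ω : Ω) (j n : ℕ) : ℝ :=
  stochIntegral P (B n) (j * τ) ((j + 1 : ℕ) * τ)
    (fun s => Real.exp (-(((j + 1 : ℕ) * τ - s) * eigval n))) ω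

/-- The approximations of the noise increments. -/
def noiseIncrApprox (B : ℕ → ℝ → Ω → ℝ) (τ : ℝ) (K : ℕ) (ω : Ω) (j n : ℕ) : ℝ :=
  stochSum (B n) (j * τ) ((j + 1 : ℕ) * τ)
    (fun s => Real.exp (-(((j + 1 : ℕ) * τ - s) * eigval n))) K ω

/-- By the semigroup property the approximate noise of all steps merges into one step-function
integral over `[0, mτ]`, so its law is an explicit Gaussian. -/
lemma linCoeff_noiseIncrApprox (B : ℕ → ℝ → Ω → ℝ) (τ : ℝ) (K m n : ℕ) (ω : Ω) :
    linCoeff τ 0 (noiseIncrApprox B τ K ω) m n =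
      stepSum (B n) (grid 0 (τ / (K + 1 : ℕ)))
        (fun l => Real.exp (-((m * τ - grid 0 (τ / (K + 1 : ℕ)) l) * eigval n)))
        (m * (K + 1)) ω := by
  induction m with
  | zero => simp [linCoeff, stepSum]
  | succ m ih =>
    have hK : ((K + 1 : ℕ) : ℝ) ≠ 0 := by positivity
    rw [linCoeff, ih, Nat.succ_mul, stepSum, stepSum, Finset.sum_range_add, Finset.mul_sum,
      noiseIncrApprox, stochSum, stepSum]
    congr 1
    · refine Finset.sum_congr rfl fun l _ => ?_
      rw [← mul_assoc, ← Real.exp_add]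
      congr 2
      push_cast
      ring
    · have e : ∀ k : ℕ, grid (m * τ) (((m + 1 : ℕ) * τ - m * τ) / (K + 1 : ℕ)) k =
          grid 0 (τ / (K + 1 : ℕ)) (m * (K + 1) + k) := fun k => by
        unfold grid
        push_cast at hK ⊢
        field_simp
        ring
      refine Finset.sum_congr rfl fun l _ => ?_
      rw [e, e, add_assoc]

/-- A left-point Riemann sum of an increasing exponential, dominated by a telescoping sum; the bound
is uniform in the mesh and in `t`. -/
lemma sum_exp_sq_mul_grid_le {l h : ℝ} (hl : 0 < l) (hh : 0 ≤ h) (t : ℝ) (L : ℕ)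
    (ht : grid 0 h L = t) :
    ∑ k ∈ Finset.range L, Real.exp (-((t - grid 0 h k) * l)) ^ 2
      * (grid 0 h (k + 1) - grid 0 h k) ≤ l⁻¹ := by
  have hterm : ∀ k, Real.exp (-((t - grid 0 h k) * l)) ^ 2 * (grid 0 h (k + 1) - grid 0 h k) ≤
      l⁻¹ * Real.exp (-((t - grid 0 h (k + 1)) * l)) ^ 2
        - l⁻¹ * Real.exp (-((t - grid 0 h k) * l)) ^ 2 := fun k => by
    have e1 : grid 0 h (k + 1) = grid 0 h k + h := by unfold grid; push_cast; ring
    have e2 : Real.exp (-((t - grid 0 h (k + 1)) * l)) =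
        Real.exp (-((t - grid 0 h k) * l)) * Real.exp (h * l) := by
      rw [← Real.exp_add, e1]; congr 1; ring
    have h1 := Real.add_one_le_exp (h * l)
    have h2 : 0 ≤ h * l := by positivity
    have h3 : h * l + 1 ≤ Real.exp (h * l) ^ 2 := by nlinarith
    rw [e2, e1, add_sub_cancel_left, mul_pow]
    have h4 : 0 ≤ Real.exp (-((t - grid 0 h k) * l)) ^ 2 := by positivity
    have h5 : h ≤ l⁻¹ * (Real.exp (h * l) ^ 2 - 1) := by
      rw [inv_mul_eq_div, le_div_iff₀ hl]; linarith
    nlinarith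
  refine (Finset.sum_le_sum fun k _ => hterm k).trans ?_
  rw [Finset.sum_range_sub (fun k => l⁻¹ * Real.exp (-((t - grid 0 h k) * l)) ^ 2), ht]
  have : 0 ≤ l⁻¹ * Real.exp (-((t - grid 0 h 0) * l)) ^ 2 := by positivity
  simp only [sub_self, zero_mul, neg_zero, Real.exp_zero, one_pow, mul_one]
  linarith

lemma abs_exp_sub_exp_le {x y : ℝ} (hx : x ≤ 0) (hy : y ≤ 0) :
    |Real.exp x - Real.exp y| ≤ |x - y| := by
  wlog h : y ≤ x generalizing x y
  · rw [abs_sub_comm, abs_sub_comm x]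
    exact this hy hx (le_of_not_ge h)
  rw [abs_of_nonneg (sub_nonneg.2 (Real.exp_le_exp.2 h)), abs_of_nonneg (sub_nonneg.2 h)]
  have h1 : Real.exp y = Real.exp x * Real.exp (y - x) := by rw [← Real.exp_add]; congr 1; ring
  have h2 := Real.add_one_le_exp (y - x)
  have h3 := Real.exp_le_one_iff.2 hx
  have h4 := Real.exp_pos x
  rw [h1]
  nlinarith

lemma IsCylindricalWiener.isStochIntegral_noiseIncr [IsProbabilityMeasure P]
    (hB : IsCylindricalWiener P T ℱ B) {τ : ℝ} (hτ : 0 ≤ τ) {j : ℕ} (hj : (j + 1 : ℕ) * τ ≤ T)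
    (n : ℕ) :
    IsStochIntegral P (B n) (j * τ) ((j + 1 : ℕ) * τ)
      (fun s => Real.exp (-(((j + 1 : ℕ) * τ - s) * eigval n)))
      (fun ω => noiseIncr P B τ ω j n) := by
  have hl := eigval_pos n
  refine stochIntegral_spec (hB.exists_isStochIntegral n (by positivity)
    (mul_le_mul_of_nonneg_right (by exact_mod_cast Nat.le_succ j) hτ) hj hl.le
    fun s hs t ht => ?_)
  refine (abs_exp_sub_exp_le (neg_nonpos.2 (mul_nonneg (sub_nonneg.2 hs.2) hl.le))
    (neg_nonpos.2 (mul_nonneg (sub_nonneg.2 ht.2) hl.le))).trans_eq ?_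
  rw [show -(((j + 1 : ℕ) * τ - s) * eigval n) - -(((j + 1 : ℕ) * τ - t) * eigval n) =
    eigval n * (s - t) by ring, abs_mul, abs_of_pos hl]

lemma IsCylindricalWiener.measurable_linCoeff_approx
    (hB : IsCylindricalWiener P T ℱ B) {τ : ℝ} (hτ : 0 ≤ τ) {m : ℕ} (hm : m * τ ≤ T) (K n : ℕ) :
    Measurable fun ω => linCoeff τ 0 (noiseIncrApprox B τ K ω) m n := by
  simp only [linCoeff_noiseIncrApprox]
  have hmono := grid_mono 0 (h := τ / (K + 1 : ℕ)) (by positivity)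
  have hend : grid 0 (τ / (K + 1 : ℕ)) (m * (K + 1)) = m * τ := by
    unfold grid; push_cast; field_simp; ring
  exact hB.measurable_stepSum n _
    (fun l _ => le_trans (by simp [grid]) (hmono (Nat.zero_le l)))
    fun l hl => (hmono hl).trans (hend.trans_le hm)

lemma IsCylindricalWiener.eLpNorm_sineNorm_approx_le [IsProbabilityMeasure P]
    (hB : IsCylindricalWiener P T ℱ B) {τ : ℝ} (hτ : 0 ≤ τ) {m : ℕ} (hm : m * τ ≤ T)
    {i : ℕ} (hi : i ≠ 0) (K N : ℕ) :
    eLpNorm (fun ω => sineNorm N (linCoeff τ 0 (noiseIncrApprox B τ K ω) m)) (4 * i : ℕ) P ≤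
      ENNReal.ofReal (dyadicConst i (gaussianMoment (4 * i)) * (1 - dyadicRatio)⁻¹) := by
  refine eLpNorm_sineNorm_le_of_gaussian_bound
    (fun n => hB.measurable_linCoeff_approx hτ hm K n) hi (gaussianMoment_nonneg _)
    (fun b S => ?_) N
  simp only [linCoeff_noiseIncrApprox]
  have hend : grid 0 (τ / (K + 1 : ℕ)) (m * (K + 1)) = m * τ := by
    unfold grid; push_cast; field_simp; ring
  exact hB.eLpNorm_sum_stepSum_le (grid_mono 0 (by positivity)) _ (by simp [grid])
    (hend.trans_le hm)
    (fun n => sum_exp_sq_mul_grid_le (eigval_pos n) (by positivity) _ _ hend) b S _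

lemma IsCylindricalWiener.aestronglyMeasurable_linCoeff [IsProbabilityMeasure P]
    (hB : IsCylindricalWiener P T ℱ B) {τ : ℝ} (hτ : 0 ≤ τ) {m : ℕ} (hm : m * τ ≤ T) (n : ℕ) :
    AEStronglyMeasurable (fun ω => linCoeff τ 0 (noiseIncr P B τ ω) m n) P := by
  induction m with
  | zero => simpa [linCoeff] using aestronglyMeasurable_const
  | succ m ih =>
    have hm' : m * τ ≤ T :=
      (mul_le_mul_of_nonneg_right (by exact_mod_cast Nat.le_succ m) hτ).trans hm
    simp only [linCoeff]
    exact ((ih hm').const_mul _).add (hB.isStochIntegral_noiseIncr hτ hm n).1.1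

lemma IsCylindricalWiener.tendsto_linCoeff_approx [IsProbabilityMeasure P]
    (hB : IsCylindricalWiener P T ℱ B) {τ : ℝ} (hτ : 0 ≤ τ) {m : ℕ} (hm : m * τ ≤ T) (n : ℕ) :
    Tendsto (fun K => eLpNorm (fun ω => linCoeff τ 0 (noiseIncrApprox B τ K ω) m n
      - linCoeff τ 0 (noiseIncr P B τ ω) m n) 2 P) atTop (𝓝 0) := by
  induction m with
  | zero => simp [linCoeff]
  | succ m ih =>
    have hm' : m * τ ≤ T :=
      (mul_le_mul_of_nonneg_right (by exact_mod_cast Nat.le_succ m) hτ).trans hm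
    obtain ⟨hmem, hlim⟩ := hB.isStochIntegral_noiseIncr hτ hm n
    have hmeas : ∀ K, AEStronglyMeasurable (fun ω => noiseIncrApprox B τ K ω m n) P := fun K => by
      have h1 := hB.measurable_linCoeff_approx hτ hm K n
      have h2 := (hB.measurable_linCoeff_approx hτ hm' K n).const_mul (Real.exp (-(τ * eigval n)))
      have h3 := (h1.sub h2).aestronglyMeasurable (μ := P)
      refine h3.congr (ae_of_all _ fun ω => ?_)
      simp [linCoeff]
    have hsum := (ENNReal.Tendsto.const_mul (a := ‖Real.exp (-(τ * eigval n))‖ₑ) (ih hm')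
      (Or.inr enorm_ne_top)).add hlim
    rw [mul_zero, add_zero] at hsum
    refine tendsto_of_tendsto_of_tendsto_of_le_of_le tendsto_const_nhds hsum
      (fun _ => zero_le) fun K => ?_
    have e : (fun ω => linCoeff τ 0 (noiseIncrApprox B τ K ω) (m + 1) n
        - linCoeff τ 0 (noiseIncr P B τ ω) (m + 1) n) =
        (Real.exp (-(τ * eigval n)) • fun ω => linCoeff τ 0 (noiseIncrApprox B τ K ω) m n
          - linCoeff τ 0 (noiseIncr P B τ ω) m n) +
        fun ω => noiseIncrApprox B τ K ω m n - noiseIncr P B τ ω m n := by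
      ext ω
      simp only [linCoeff, Pi.add_apply, Pi.smul_apply, smul_eq_mul]
      ring
    simp only
    rw [e]
    refine (eLpNorm_add_le ?_ ?_ one_le_two).trans ?_
    · exact ((hB.measurable_linCoeff_approx hτ hm' K n).aestronglyMeasurable.sub
        (hB.aestronglyMeasurable_linCoeff hτ hm' n)).const_smul _
    · exact (hmeas K).sub hmem.1
    · rw [eLpNorm_const_smul]
      exact le_rfl

lemma aestronglyMeasurable_sineNorm {y : Ω → ℕ → ℝ}
    (hy : ∀ n, AEStronglyMeasurable (fun ω => y ω n) P) (N : ℕ) :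
    AEStronglyMeasurable (fun ω => sineNorm N (y ω)) P :=
  (continuous_sineNorm N).comp_aestronglyMeasurable
    (aemeasurable_pi_lambda _ fun n => (hy n).aemeasurable).aestronglyMeasurable

/-- The moments of the supremum norm of the discrete stochastic convolution. -/
lemma IsCylindricalWiener.eLpNorm_sineNorm_noise_le [IsProbabilityMeasure P]
    (hB : IsCylindricalWiener P T ℱ B) {τ : ℝ} (hτ : 0 ≤ τ) {m : ℕ} (hm : m * τ ≤ T)
    {i : ℕ} (hi : i ≠ 0) (N : ℕ) :
    eLpNorm (fun ω => sineNorm N (linCoeff τ 0 (noiseIncr P B τ ω) m)) (4 * i : ℕ) P ≤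
      ENNReal.ofReal (dyadicConst i (gaussianMoment (4 * i)) * (1 - dyadicRatio)⁻¹) := by
  have hmA : ∀ K, AEStronglyMeasurable
      (fun ω => sineNorm N (linCoeff τ 0 (noiseIncrApprox B τ K ω) m)) P := fun K =>
    aestronglyMeasurable_sineNorm
      (fun n => (hB.measurable_linCoeff_approx hτ hm K n).aestronglyMeasurable) N
  have hmL : AEStronglyMeasurable (fun ω => sineNorm N (linCoeff τ 0 (noiseIncr P B τ ω) m)) P :=
    aestronglyMeasurable_sineNorm (fun n => hB.aestronglyMeasurable_linCoeff hτ hm n) N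
  -- Convergence in L² gives convergence in measure, under which a uniform bound in a higher moment
  -- passes to the limit.
  refine eLpNorm_le_of_tendstoInMeasure (u := atTop)
    (Eventually.of_forall fun K => hB.eLpNorm_sineNorm_approx_le hτ hm hi K N)
    (tendstoInMeasure_of_tendsto_eLpNorm two_ne_zero hmA hmL ?_) hmA
  have hsum : Tendsto (fun K => ‖√2‖ₑ * ∑ n ∈ Finset.range N,
      eLpNorm (fun ω => linCoeff τ 0 (noiseIncrApprox B τ K ω) m n
        - linCoeff τ 0 (noiseIncr P B τ ω) m n) 2 P) atTop (𝓝 0) := by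
    have h := tendsto_finsetSum (Finset.range N) fun n _ => hB.tendsto_linCoeff_approx hτ hm n
    rw [Finset.sum_const_zero] at h
    simpa using ENNReal.Tendsto.const_mul (a := ‖√2‖ₑ) h (Or.inr enorm_ne_top)
  refine tendsto_of_tendsto_of_tendsto_of_le_of_le tendsto_const_nhds hsum
    (fun _ => zero_le) fun K => ?_
  have hd : ∀ n, AEStronglyMeasurable (fun ω => linCoeff τ 0 (noiseIncrApprox B τ K ω) m n
      - linCoeff τ 0 (noiseIncr P B τ ω) m n) P := fun n =>
    (hB.measurable_linCoeff_approx hτ hm K n).aestronglyMeasurable.sub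
      (hB.aestronglyMeasurable_linCoeff hτ hm n)
  calc eLpNorm ((fun ω => sineNorm N (linCoeff τ 0 (noiseIncrApprox B τ K ω) m))
        - fun ω => sineNorm N (linCoeff τ 0 (noiseIncr P B τ ω) m)) 2 P
      ≤ eLpNorm (√2 • ∑ n ∈ Finset.range N, fun ω =>
          ‖linCoeff τ 0 (noiseIncrApprox B τ K ω) m n
            - linCoeff τ 0 (noiseIncr P B τ ω) m n‖) 2 P := by
        refine eLpNorm_mono_real fun ω => ?_
        rw [Pi.sub_apply, Pi.smul_apply, Finset.sum_apply, smul_eq_mul, Real.norm_eq_abs, abs_le]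
        have h1 := abs_sineNorm_sub_le N (linCoeff τ 0 (noiseIncrApprox B τ K ω) m)
          (linCoeff τ 0 (noiseIncr P B τ ω) m)
        have h2 := abs_sineNorm_sub_le N (linCoeff τ 0 (noiseIncr P B τ ω) m)
          (linCoeff τ 0 (noiseIncrApprox B τ K ω) m)
        simp only [abs_sub_comm (linCoeff τ 0 (noiseIncr P B τ ω) m _)] at h2
        simp only [Real.norm_eq_abs]
        constructor <;> linarith
    _ ≤ ‖√2‖ₑ * ∑ n ∈ Finset.range N, eLpNorm (fun ω =>
          ‖linCoeff τ 0 (noiseIncrApprox B τ K ω) m n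
            - linCoeff τ 0 (noiseIncr P B τ ω) m n‖) 2 P := by
        rw [eLpNorm_const_smul]
        gcongr
        exact eLpNorm_sum_le (fun n _ => (hd n).norm) one_le_two
    _ = _ := by simp only [eLpNorm_norm]

/-! ### The initial value -/

lemma sum_mul_eq_sum_sub_mul (c d : ℕ → ℝ) (N : ℕ) :
    ∑ n ∈ Finset.range N, c n * d n = ∑ k ∈ Finset.range N,
      (c k - c (k + 1)) * ∑ n ∈ Finset.range (k + 1), d n
        + c N * ∑ n ∈ Finset.range N, d n := by
  induction N with
  | zero => simp
  | succ N ih =>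
    rw [Finset.sum_range_succ, ih, Finset.sum_range_succ (fun k => (c k - c (k + 1)) * _),
      Finset.sum_range_succ d N]
    ring

/-- Multiplying the coefficients by an antitone sequence gives a combination of partial sums. -/
lemma sineNorm_mul_le {c : ℕ → ℝ} (hc : Antitone c) (hc0 : ∀ n, 0 ≤ c n) (ξ : ℕ → ℝ) (N : ℕ) :
    sineNorm N (fun n => c n * ξ n) ≤
      ∑ k ∈ Finset.range N, (c k - c (k + 1)) * sineNorm (k + 1) ξ + c N * sineNorm N ξ := by
  have hd : ∀ k, 0 ≤ c k - c (k + 1) := fun k => sub_nonneg.2 (hc (Nat.le_succ k))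
  refine sineNorm_le (add_nonneg (Finset.sum_nonneg fun k _ => mul_nonneg (hd k)
    (sineNorm_nonneg _ _)) (mul_nonneg (hc0 N) (sineNorm_nonneg _ _))) fun x hx => ?_
  have e : sineSum N (fun n => c n * ξ n) x = ∑ k ∈ Finset.range N,
      (c k - c (k + 1)) * sineSum (k + 1) ξ x + c N * sineSum N ξ x := by
    simp only [sineSum, mul_assoc]
    exact sum_mul_eq_sum_sub_mul c (fun n => ξ n * eigfun n x) N
  rw [e]
  refine (abs_add_le _ _).trans (add_le_add ?_ ?_)
  · refine (Finset.abs_sum_le_sum_abs _ _).trans (Finset.sum_le_sum fun k _ => ?_)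
    rw [abs_mul, abs_of_nonneg (hd k)]
    exact mul_le_mul_of_nonneg_left (abs_sineSum_le hx) (hd k)
  · rw [abs_mul, abs_of_nonneg (hc0 N)]
    exact mul_le_mul_of_nonneg_left (abs_sineSum_le hx) (hc0 N)

/-- The Abel weights `c k - c (k + 1)` and `c N` are nonnegative with sum `c 0 ≤ 1`, so a bound
uniform over the partial sums survives multiplication. -/
lemma eLpNorm_sineNorm_mul_le {c : ℕ → ℝ} (hc : Antitone c) (hc0 : ∀ n, 0 ≤ c n) (hc1 : c 0 ≤ 1)
    {ξ : Ω → ℕ → ℝ} (hξ : ∀ n, AEStronglyMeasurable (fun ω => ξ ω n) P) {p : ℝ≥0∞} (hp : 1 ≤ p)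
    {C : ℝ≥0∞} {N : ℕ} (hN : 1 ≤ N)
    (hC : ∀ k, 1 ≤ k → eLpNorm (fun ω => sineNorm k (ξ ω)) p P ≤ C) :
    eLpNorm (fun ω => sineNorm N (fun n => c n * ξ ω n)) p P ≤ C := by
  have hd : ∀ k, 0 ≤ c k - c (k + 1) := fun k => sub_nonneg.2 (hc (Nat.le_succ k))
  have hm : ∀ k, AEStronglyMeasurable (fun ω => sineNorm k (ξ ω)) P := fun k =>
    aestronglyMeasurable_sineNorm hξ k
  have hsm : ∀ (a : ℝ) (k : ℕ), 0 ≤ a → 1 ≤ k →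
      eLpNorm (a • fun ω => sineNorm k (ξ ω)) p P ≤ ENNReal.ofReal a * C := fun a k ha hk => by
    rw [eLpNorm_const_smul, Real.enorm_eq_ofReal ha]
    gcongr
    exact hC k hk
  calc eLpNorm (fun ω => sineNorm N (fun n => c n * ξ ω n)) p P
      ≤ eLpNorm ((∑ k ∈ Finset.range N, (c k - c (k + 1)) • fun ω => sineNorm (k + 1) (ξ ω))
          + c N • fun ω => sineNorm N (ξ ω)) p P := by
        refine eLpNorm_mono_real fun ω => ?_
        rw [Real.norm_of_nonneg (sineNorm_nonneg _ _), Pi.add_apply, Finset.sum_apply]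
        exact sineNorm_mul_le hc hc0 (ξ ω) N
    _ ≤ eLpNorm (∑ k ∈ Finset.range N, (c k - c (k + 1)) • fun ω => sineNorm (k + 1) (ξ ω)) p P
          + eLpNorm (c N • fun ω => sineNorm N (ξ ω)) p P :=
        eLpNorm_add_le (Finset.aestronglyMeasurable_sum _ fun k _ => (hm _).const_smul _)
          ((hm N).const_smul _) hp
    _ ≤ ∑ k ∈ Finset.range N, ENNReal.ofReal (c k - c (k + 1)) * C + ENNReal.ofReal (c N) * C :=
        add_le_add ((eLpNorm_sum_le (fun k _ => (hm _).const_smul _) hp).trans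
          (Finset.sum_le_sum fun k _ => hsm _ _ (hd k) (Nat.succ_pos k))) (hsm _ _ (hc0 N) hN)
    _ = ENNReal.ofReal (c 0) * C := by
        rw [← Finset.sum_mul, ← add_mul, ← ENNReal.ofReal_sum_of_nonneg fun k _ => hd k,
          ← ENNReal.ofReal_add (Finset.sum_nonneg fun k _ => hd k) (hc0 N),
          Finset.sum_range_sub' c, sub_add_cancel]
    _ ≤ 1 * C := by
        gcongr
        exact ENNReal.ofReal_le_one.2 hc1
    _ = C := one_mul C

lemma eLpNorm_sineNorm_initial_le {τ : ℝ} (hτ : 0 ≤ τ) (m : ℕ)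
    {ξ : Ω → ℕ → ℝ} (hξ : ∀ n, AEStronglyMeasurable (fun ω => ξ ω n) P) {p : ℝ≥0∞} (hp : 1 ≤ p)
    {C : ℝ≥0∞} {N : ℕ} (hN : 1 ≤ N)
    (hC : ∀ k, 1 ≤ k → eLpNorm (fun ω => sineNorm k (ξ ω)) p P ≤ C) :
    eLpNorm (fun ω => sineNorm N (fun n => Real.exp (-(τ * eigval n)) ^ m * ξ ω n)) p P ≤ C := by
  have h1 : Antitone fun n : ℕ => Real.exp (-(τ * eigval n)) ^ m := fun a b hab => by
    have hab' : (a : ℝ) ≤ b := by exact_mod_cast hab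
    have hle : eigval a ≤ eigval b := by
      unfold eigval
      gcongr
    exact pow_le_pow_left₀ (Real.exp_pos _).le (Real.exp_le_exp.2 (neg_le_neg
      (mul_le_mul_of_nonneg_left hle hτ))) m
  have h2 : ∀ n : ℕ, 0 ≤ Real.exp (-(τ * eigval n)) ^ m := fun n => by positivity
  have h3 : Real.exp (-(τ * eigval 0)) ^ m ≤ 1 :=
    pow_le_one₀ (Real.exp_pos _).le (Real.exp_le_one_iff.2
      (neg_nonpos.2 (mul_nonneg hτ (eigval_pos 0).le)))
  exact eLpNorm_sineNorm_mul_le h1 h2 h3 hξ hp hN hC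

end

section

variable {Ω : Type*} {mΩ : MeasurableSpace Ω} {P : Measure Ω}
variable {T : ℝ} {ℱ : Filtration ℝ mΩ} {B : ℕ → ℝ → Ω → ℝ}

/-! ### Measurability of the scheme -/

lemma measurable_nemCoeff (N : ℕ) {f : ℝ → ℝ} (hf : Continuous f) (n : ℕ) :
    Measurable fun y => nemCoeff N f y n := by
  have h : Continuous (Function.uncurry fun (y : ℕ → ℝ) (x : ℝ) =>
      eigfun n x * f (sineSum N y x)) := by
    refine ((continuous_eigfun n).comp continuous_snd).mul (hf.comp ?_)
    unfold sineSum
    exact continuous_finsetSum _ fun k _ =>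
      ((continuous_apply k).comp continuous_fst).mul ((continuous_eigfun k).comp continuous_snd)
  exact (h.stronglyMeasurable.integral_prod_right (ν := leb)).measurable

lemma measurable_taming (τ : ℝ) (N : ℕ) {f : ℝ → ℝ} (hf : Continuous f) :
    Measurable (taming τ N f) := by
  unfold taming
  exact (((Finset.measurable_sum _ fun n _ => (measurable_nemCoeff N hf n).pow_const 2).sqrt
    |>.const_mul τ).const_add 1).inv

lemma aemeasurable_schemeCoeff {τ : ℝ} (N : ℕ) {f : ℝ → ℝ} (hf : Continuous f)
    {ξ : Ω → ℕ → ℝ} {η : Ω → ℕ → ℕ → ℝ} {m : ℕ} (hξ : ∀ n, AEMeasurable (fun ω => ξ ω n) P)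
    (hη : ∀ j < m, ∀ n, AEMeasurable (fun ω => η ω j n) P) :
    AEMeasurable (fun ω => schemeCoeff τ N f (ξ ω) (η ω) m) P := by
  induction m with
  | zero => exact aemeasurable_pi_lambda _ hξ
  | succ m ih =>
    have ih' := ih fun j hj => hη j (hj.trans (Nat.lt_succ_self m))
    refine aemeasurable_pi_lambda _ fun n => ?_
    simp only [schemeCoeff]
    exact ((((measurable_pi_apply n).comp_aemeasurable ih').const_mul _).add
      (((measurable_taming τ N hf).comp_aemeasurable ih').mul
        (((measurable_nemCoeff N hf n).comp_aemeasurable ih').const_mul _))).add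
      (hη m (Nat.lt_succ_self m) n)

/-! ### The moment bound -/

lemma ofReal_rpow_le_one_add_pow {y p : ℝ} (hy : 0 ≤ y) (hp : 0 ≤ p) :
    ENNReal.ofReal y ^ p ≤ 1 + ENNReal.ofReal (y ^ ⌈p⌉₊) := by
  rw [ENNReal.ofReal_rpow_of_nonneg hy hp, ← ENNReal.ofReal_one,
    ← ENNReal.ofReal_add zero_le_one (by positivity)]
  refine ENNReal.ofReal_le_ofReal ?_
  rcases le_total y 1 with h | h
  · linarith [Real.rpow_le_one hy h hp, pow_nonneg hy ⌈p⌉₊]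
  · have := Real.rpow_le_rpow_of_exponent_le h (Nat.le_ceil p)
    rw [Real.rpow_natCast] at this
    linarith

/-- The time average of the moments is bounded by their common bound `I ^ L`, so nothing depends on
`M`. -/
lemma lintegral_rpow_le_of_pathwise [IsProbabilityMeasure P] {y : Ω → ℝ} {z : ℕ → Ω → ℝ} {p C : ℝ}
    {I : ℝ≥0∞} {L M m : ℕ} (hp : 0 ≤ p) (hL : L ≠ 0) (hC : 0 ≤ C) (hM : 1 ≤ M) (hm : m ≤ M)
    (hz0 : ∀ j ω, 0 ≤ z j ω) (hz : ∀ j ≤ M, AEStronglyMeasurable (z j) P)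
    (hI : ∀ j ≤ M, eLpNorm (z j) L P ≤ I) (hy0 : ∀ ω, 0 ≤ y ω)
    (hy : ∀ ω, y ω ^ ⌈p⌉₊ ≤
      C * (1 + z m ω ^ L + 1 / M * ∑ j ∈ Finset.range M, z j ω ^ L)) :
    ∫⁻ ω, ENNReal.ofReal (y ω) ^ p ∂P ≤ 1 + ENNReal.ofReal C * (1 + I ^ L + I ^ L) := by
  have hM0 : (M : ℝ) ≠ 0 := by exact_mod_cast (by omega : M ≠ 0)
  have hzm : ∀ j ≤ M, AEMeasurable (fun ω => ENNReal.ofReal (z j ω ^ L)) P := fun j hj =>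
    ((hz j hj).aemeasurable.pow_const L).ennreal_ofReal
  have hzI : ∀ j ≤ M, ∫⁻ ω, ENNReal.ofReal (z j ω ^ L) ∂P ≤ I ^ L := fun j hj => by
    refine le_of_eq_of_le ?_ (pow_le_pow_left' (hI j hj) L)
    rw [← lintegral_enorm_pow_eq hL]
    simp only [Real.enorm_eq_ofReal (hz0 j _), ENNReal.ofReal_pow (hz0 j _)]
  have hsum : ∀ s : Finset ℕ, (∀ j ∈ s, j ≤ M) →
      AEMeasurable (fun ω => ∑ j ∈ s, ENNReal.ofReal (z j ω ^ L)) P := fun s hs =>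
    Finset.aemeasurable_fun_sum s fun j hj => hzm j (hs j hj)
  have hrange : ∀ j ∈ Finset.range M, j ≤ M := fun j hj => (Finset.mem_range.1 hj).le
  calc ∫⁻ ω, ENNReal.ofReal (y ω) ^ p ∂P
      ≤ ∫⁻ ω, 1 + ENNReal.ofReal C * (1 + ENNReal.ofReal (z m ω ^ L)
          + ENNReal.ofReal (1 / M) * ∑ j ∈ Finset.range M, ENNReal.ofReal (z j ω ^ L)) ∂P := by
        refine lintegral_mono fun ω => (ofReal_rpow_le_one_add_pow (hy0 ω) hp).trans ?_
        gcongr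
        refine (ENNReal.ofReal_le_ofReal (hy ω)).trans_eq ?_
        have h1 : ∀ j, 0 ≤ z j ω ^ L := fun j => pow_nonneg (hz0 j ω) L
        have h2 : 0 ≤ ∑ j ∈ Finset.range M, z j ω ^ L := Finset.sum_nonneg fun j _ => h1 j
        rw [ENNReal.ofReal_mul hC, ENNReal.ofReal_add (add_nonneg zero_le_one (h1 m))
            (by positivity), ENNReal.ofReal_add zero_le_one (h1 m),
          ENNReal.ofReal_mul (by positivity), ENNReal.ofReal_sum_of_nonneg fun j _ => h1 j,
          ENNReal.ofReal_one]
    _ = 1 + ENNReal.ofReal C * (1 + ∫⁻ ω, ENNReal.ofReal (z m ω ^ L) ∂P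
          + ENNReal.ofReal (1 / M) *
            ∑ j ∈ Finset.range M, ∫⁻ ω, ENNReal.ofReal (z j ω ^ L) ∂P) := by
        rw [lintegral_add_left measurable_const, lintegral_const_mul' _ _ ENNReal.ofReal_ne_top,
          lintegral_add_right' _ ((hsum _ hrange).const_mul _), lintegral_add_left measurable_const,
          lintegral_const_mul' _ _ ENNReal.ofReal_ne_top,
          lintegral_finsetSum' _ fun j hj => hzm j (hrange j hj)]
        simp
    _ ≤ 1 + ENNReal.ofReal C * (1 + I ^ L
          + ENNReal.ofReal (1 / M) * ∑ j ∈ Finset.range M, I ^ L) := by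
        gcongr with j hj
        · exact hzI m hm
        · exact hzI j (hrange j hj)
    _ = 1 + ENNReal.ofReal C * (1 + I ^ L + I ^ L) := by
        rw [Finset.sum_const, Finset.card_range, nsmul_eq_mul, ← mul_assoc,
          ← ENNReal.ofReal_natCast, ← ENNReal.ofReal_mul (by positivity),
          one_div_mul_cancel hM0, ENNReal.ofReal_one, one_mul]

/-- A pathwise bound of the scheme by its linear part. -/
lemma exists_schemeCoeff_pow_le (hT : 0 < T) {a₃ : ℝ} (ha : a₃ < 0) (a₂ a₁ a₀ : ℝ) (p : ℕ) :
    ∃ C, 0 ≤ C ∧ ∀ (M N : ℕ) (ξ : ℕ → ℝ) (η : ℕ → ℕ → ℝ), 1 ≤ M → ∀ m ≤ M,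
      sineNorm N (schemeCoeff (T / M) N (cubic a₃ a₂ a₁ a₀) ξ η m) ^ p ≤
        C * (1 + sineNorm N (linCoeff (T / M) ξ η m) ^ (108 * (p + 1))
          + 1 / M * ∑ j ∈ Finset.range M,
            sineNorm N (linCoeff (T / M) ξ η j) ^ (108 * (p + 1))) := by
  obtain ⟨A, hA, hfA⟩ := abs_cubic_le a₃ a₂ a₁ a₀
  obtain ⟨c, D, hc, hD, hdis⟩ := cubic_dissipative ha a₂ a₁ a₀
  obtain ⟨K₁, hK₁, hmod⟩ := exists_drift_bound_of_moderate hT (continuous_cubic a₃ a₂ a₁ a₀)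
    hc hD hA hfA hdis
  obtain ⟨K₂, hK₂⟩ : ∃ x, x = 4 * (T + 4 * √√T) / T := ⟨_, rfl⟩
  have hK₂0 : 0 ≤ K₂ := by rw [hK₂]; positivity
  obtain ⟨C, hC, hmain⟩ := exists_pow_le_of_controlled (add_nonneg hK₁ hK₂0) hT p
  refine ⟨C, hC, fun M N ξ η hM m hm => ?_⟩
  have hMp : (0 : ℝ) < M := by exact_mod_cast hM
  have hdrift := isDriftPart_sub (T / M) N (cubic a₃ a₂ a₁ a₀) ξ η
  have hsplit : ∀ j, sineNorm N (schemeCoeff (T / M) N (cubic a₃ a₂ a₁ a₀) ξ η j) ≤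
      sineNorm N (schemeCoeff (T / M) N (cubic a₃ a₂ a₁ a₀) ξ η j - linCoeff (T / M) ξ η j)
        + sineNorm N (linCoeff (T / M) ξ η j) := fun j => by
    simpa using sineNorm_add_le N
      (schemeCoeff (T / M) N (cubic a₃ a₂ a₁ a₀) ξ η j - linCoeff (T / M) ξ η j)
      (linCoeff (T / M) ξ η j)
  refine hmain M (fun j => sineNorm N (schemeCoeff (T / M) N (cubic a₃ a₂ a₁ a₀) ξ η j))
    (fun j => sineNorm N (linCoeff (T / M) ξ η j)) hM (fun j => sineNorm_nonneg _ _)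
    (fun j => sineNorm_nonneg _ _) (fun k hk hsmall => ?_) (fun k hk => ?_) m hm
  · refine (hsplit k).trans (add_le_add ?_ le_rfl)
    refine (hmod M N _ _ hM hdrift k hk fun j hj => ?_).trans ?_
    · simpa using hsmall j hj
    · exact mul_le_mul_of_nonneg_right (le_add_of_nonneg_right hK₂0) (sq_nonneg _)
  · refine (hsplit k).trans (add_le_add ?_ le_rfl)
    have hkT : (k : ℝ) * (T / M) ≤ T := by
      rw [mul_div_assoc', div_le_iff₀ hMp, mul_comm]
      exact mul_le_mul_of_nonneg_left (by exact_mod_cast hk) hT.le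
    refine (hdrift.sineNorm_le_apriori (div_pos hT hMp) k hkT).trans ?_
    rw [show 4 * (T + 4 * √√T) / (T / M) = K₂ * M by rw [hK₂]; field_simp]
    exact mul_le_mul_of_nonneg_right (le_add_of_nonneg_left hK₁) hMp.le

lemma IsInitialValue.measurable_inner {p₀ : ℕ} {X₀ : Ω → H} (h : IsInitialValue P ℱ p₀ X₀)
    (n : ℕ) : Measurable fun ω => (inner ℝ (basis n) (X₀ ω) : ℝ) := by
  -- Measurability of the initial value refers explicitly to `borel H`, so that σ-algebra is made
  -- the instance here.
  let _ : MeasurableSpace H := borel H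
  have _ : BorelSpace H := ⟨rfl⟩
  have h0 : Measurable X₀ := h.measurable_init.mono (ℱ.le 0) le_rfl
  exact (continuous_const.inner continuous_id).measurable.comp h0

lemma IsInitialValue.exists_eLpNorm_le [IsProbabilityMeasure P] {p₀ L : ℕ} {X₀ : Ω → H}
    (h : IsInitialValue P ℱ p₀ X₀) (hL : 1 ≤ L) (hp₀ : L ≤ p₀) :
    ∃ C : ℝ≥0∞, C ≠ ∞ ∧ ∀ k, 1 ≤ k →
      eLpNorm (fun ω => sineNorm k fun n => inner ℝ (basis n) (X₀ ω)) L P ≤ C := by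
  refine ⟨_, h.proj_moment.ne, fun k hk => ?_⟩
  have hm : AEStronglyMeasurable
      (fun ω => sineNorm k fun n => (inner ℝ (basis n) (X₀ ω) : ℝ)) P :=
    aestronglyMeasurable_sineNorm (fun n => (h.measurable_inner n).aestronglyMeasurable) k
  -- On a probability space the moment of order `L` is bounded by the one of order `p₀`; this is
  -- where `p₀` must be large.
  refine (eLpNorm_le_eLpNorm_of_exponent_le (by exact_mod_cast hp₀ : (L : ℝ≥0∞) ≤ p₀) hm).trans ?_
  refine le_trans (le_of_eq ?_) (le_iSup₂ (f := fun (N : ℕ) (_ : 1 ≤ N) =>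
    (∫⁻ ω, supNorm (proj N (X₀ ω)) ^ p₀ ∂P) ^ (1 / p₀ : ℝ)) k hk)
  rw [eLpNorm_eq_lintegral_rpow_enorm_toReal (by exact_mod_cast (by omega : p₀ ≠ 0))
    (ENNReal.natCast_ne_top p₀), ENNReal.toReal_natCast]
  congr 1
  refine lintegral_congr fun ω => ?_
  simp only [proj, galerkinOp_apply, one_mul]
  rw [supNorm_sineElt, ENNReal.rpow_natCast, Real.enorm_eq_ofReal (sineNorm_nonneg _ _)]

end

end TamedAllenCahn

end

open TamedAllenCahn

theorem mainTheorem3 (p : ℝ) (hp : 2 ≤ p) :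
    ∃ q : ℕ, 1 ≤ q ∧ ∀ p₀ : ℕ, q ≤ p₀ →
      ∀ (T : ℝ), 0 < T → ∀ (a₃ a₂ a₁ a₀ : ℝ), a₃ < 0 →
      ∀ (Ω : Type*) (mΩ : MeasurableSpace Ω) (P : Measure Ω) (_ : IsProbabilityMeasure P)
        (ℱ : Filtration ℝ mΩ) (B : ℕ → ℝ → Ω → ℝ) (X₀ : Ω → H),
      IsNormalFiltration P T ℱ → IsCylindricalWiener P T ℱ B → IsInitialValue P ℱ p₀ X₀ →
      (∀ M N m : ℕ, 1 ≤ M → 1 ≤ N → m ≤ M →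
        AEMeasurable (fun ω => supNorm (scheme P T (cubic a₃ a₂ a₁ a₀) B X₀ M N m ω)) P) ∧
      (⨆ (M : ℕ) (_ : 1 ≤ M) (N : ℕ) (_ : 1 ≤ N) (m : ℕ) (_ : m ≤ M),
        ∫⁻ ω, supNorm (scheme P T (cubic a₃ a₂ a₁ a₀) B X₀ M N m ω) ^ p ∂P) < ∞ := by
  -- The exponent of the pathwise bound for the integer power `⌈p⌉₊`. It depends on `p` alone, and
  -- it is a multiple of four, as the dyadic estimate demands.
  obtain ⟨L, hL⟩ : ∃ L, L = 108 * (⌈p⌉₊ + 1) := ⟨_, rfl⟩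
  obtain ⟨i, hi⟩ : ∃ i, i = 27 * (⌈p⌉₊ + 1) := ⟨_, rfl⟩
  have hLi : L = 4 * i := by omega
  refine ⟨L, by omega, fun p₀ hp₀ T hT a₃ a₂ a₁ a₀ ha Ω mΩ P _ ℱ B X₀ _ hB hX => ?_⟩
  have hstep : ∀ {M j : ℕ}, 1 ≤ M → j ≤ M → (j : ℝ) * (T / M) ≤ T := fun {M j} hM hj => by
    have hMp : (0 : ℝ) < M := by exact_mod_cast hM
    rw [mul_div_assoc', div_le_iff₀ hMp, mul_comm]
    exact mul_le_mul_of_nonneg_left (by exact_mod_cast hj) hT.le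
  have hτ : ∀ M : ℕ, 0 ≤ T / M := fun M => by positivity
  have hscheme : ∀ (M N m : ℕ) ω, supNorm (scheme P T (cubic a₃ a₂ a₁ a₀) B X₀ M N m ω) =
      ENNReal.ofReal (sineNorm N (schemeCoeff (T / M) N (cubic a₃ a₂ a₁ a₀)
        (fun n => inner ℝ (basis n) (X₀ ω)) (noiseIncr P B (T / M) ω) m)) := fun M N m ω => by
    rw [scheme_eq_sineElt P T (continuous_cubic a₃ a₂ a₁ a₀), supNorm_sineElt]
    rfl
  have hξ : ∀ n, AEStronglyMeasurable (fun ω => (inner ℝ (basis n) (X₀ ω) : ℝ)) P := fun n =>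
    (hX.measurable_inner n).aestronglyMeasurable
  refine ⟨fun M N m hM _ hm => ?_, ?_⟩
  · simp only [hscheme]
    refine ((continuous_sineNorm N).measurable.comp_aemeasurable
      (aemeasurable_schemeCoeff N (continuous_cubic a₃ a₂ a₁ a₀)
        (fun n => (hξ n).aemeasurable) fun j hj n => ?_)).ennreal_ofReal
    exact (hB.isStochIntegral_noiseIncr (hτ M) (hstep hM (by omega)) n).1.1.aemeasurable
  obtain ⟨C, hC, hpath⟩ := exists_schemeCoeff_pow_le hT ha a₂ a₁ a₀ ⌈p⌉₊
  rw [← hL] at hpath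
  obtain ⟨C₀, hC₀, hinit⟩ := hX.exists_eLpNorm_le (by omega) hp₀
  have hL1 : (1 : ℝ≥0∞) ≤ L := by exact_mod_cast (by omega : 1 ≤ L)
  -- A bound for the linear part uniform in `M`, `N` and time: initial value plus noise.
  obtain ⟨I, hI⟩ : ∃ I, I = C₀ + ENNReal.ofReal
    (dyadicConst i (gaussianMoment (4 * i)) * (1 - dyadicRatio)⁻¹) := ⟨_, rfl⟩
  have hItop : I ≠ ∞ := by rw [hI]; exact ENNReal.add_ne_top.2 ⟨hC₀, ENNReal.ofReal_ne_top⟩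
  have hbound : (1 + ENNReal.ofReal C * (1 + I ^ L + I ^ L)) < ∞ :=
    ENNReal.add_lt_top.2 ⟨ENNReal.one_lt_top, ENNReal.mul_lt_top ENNReal.ofReal_lt_top
      (ENNReal.add_lt_top.2 ⟨ENNReal.add_lt_top.2 ⟨ENNReal.one_lt_top,
        ENNReal.pow_lt_top hItop.lt_top⟩, ENNReal.pow_lt_top hItop.lt_top⟩)⟩
  refine lt_of_le_of_lt (iSup_le fun M => iSup_le fun hM => iSup_le fun N => iSup_le fun hN =>
    iSup_le fun m => iSup_le fun hm => ?_) hbound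
  simp only [hscheme]
  have hsmeas : ∀ j ≤ M, AEStronglyMeasurable (fun ω => sineNorm N fun n =>
      Real.exp (-(T / M * eigval n)) ^ j * inner ℝ (basis n) (X₀ ω)) P := fun j _ =>
    aestronglyMeasurable_sineNorm (fun n => (hξ n).const_mul _) N
  have hnmeas : ∀ j ≤ M, AEStronglyMeasurable
      (fun ω => sineNorm N (linCoeff (T / M) 0 (noiseIncr P B (T / M) ω) j)) P := fun j hj =>
    aestronglyMeasurable_sineNorm
      (fun n => hB.aestronglyMeasurable_linCoeff (hτ M) (hstep hM hj) n) N
  refine lintegral_rpow_le_of_pathwise (z := fun j ω => sineNorm N (linCoeff (T / M)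
    (fun n => inner ℝ (basis n) (X₀ ω)) (noiseIncr P B (T / M) ω) j)) (by linarith) (by omega)
    hC hM hm (fun j ω => sineNorm_nonneg _ _) (fun j hj => ?_) (fun j hj => ?_)
    (fun ω => sineNorm_nonneg _ _) fun ω => hpath M N _ _ hM m hm
  · refine aestronglyMeasurable_sineNorm (fun n => ?_) N
    simp only [linCoeff_eq_add _ (fun n => (inner ℝ (basis n) (X₀ _) : ℝ)), Pi.add_apply]
    exact ((hξ n).const_mul _).add (hB.aestronglyMeasurable_linCoeff (hτ M) (hstep hM hj) n)
  · have h1 : eLpNorm (fun ω => sineNorm N (linCoeff (T / M)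
        (fun n => inner ℝ (basis n) (X₀ ω)) (noiseIncr P B (T / M) ω) j)) L P ≤
        eLpNorm ((fun ω => sineNorm N fun n =>
          Real.exp (-(T / M * eigval n)) ^ j * inner ℝ (basis n) (X₀ ω)) +
          fun ω => sineNorm N (linCoeff (T / M) 0 (noiseIncr P B (T / M) ω) j)) L P := by
      refine eLpNorm_mono_real fun ω => ?_
      rw [Real.norm_of_nonneg (sineNorm_nonneg _ _), linCoeff_eq_add]
      exact sineNorm_add_le N _ _
    refine (h1.trans (eLpNorm_add_le (hsmeas j hj) (hnmeas j hj) hL1)).trans ?_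
    rw [hI]
    refine add_le_add (eLpNorm_sineNorm_initial_le (hτ M) j hξ hL1 hN hinit) ?_
    rw [hLi]
    exact hB.eLpNorm_sineNorm_noise_le (hτ M) (hstep hM hj) (by omega) N
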